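/- **Setting.** Let $d,\tilde d\in\mathbb N$ and let $(\varepsilon_i)_{i\in\mathbb Z}$ be i.i.d. random vectors in $\mathbb R^{\tilde d}$. For $n\ge 1$ and integers $i\le n$ let $J_{i,n}:(\mathbb R^{\tilde d})^{\mathbb N_0}\to\mathbb R^d$ be measurable, $X_i=X_{i,n}=J_{i,n}(\varepsilon_i,\varepsilon_{i-1},\dots)$ with coordinates $X_{ij}$, $1\le j\le d$, and $Z_i=(X_i,X_{i-1},X_{i-2},\dots)$. For a random variable $W$ put $\|W\|_q=\mathbb E[|W|^q]^{1/q}$ ($0<q<\infty$), and let $\|W\|_\infty$ be the essential supremum of $|W|$. Let $X_i^{*(i-k)}$ be $X_i$ with $\varepsilon_{i-k}$ replaced by an independent copy $\varepsilon_{i-k}^*$, and $$\delta_q^X(k)=\sup_{i\le n}\ \sup_{1\le j\le d}\|X_{ij}-X_{ij}^{*(i-k)}\|_q,\qquad k\in\mathbb N_0 .$$ For each $n$ let $\mathcal F=\mathcal F_n$ be a finite non-empty class of measurable functions $f:(\mathbb R^d)^{\mathbb N_0}\times[0,1]\to\mathbb R$, let $H=1\vee\log|\mathcal F|$, and put $$\mathbb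 G_n(f)=\frac1{\sqrt n}\sum_{i=1}^n\Big\{f\big(Z_i,\tfrac in\big)-\mathbb E f\big(Z_i,\tfrac in\big)\Big\},\qquad \|f\|_{2,n}=\Big(\frac1n\sum_{i=1}^n\big\|f\big(Z_i,\tfrac in\big)\big\|_2^2\Big)^{1/2}.$$ Let $(\Delta(k))_{k\ge0}$ be a nonnegative, decreasing, summable sequence, $\mathbb D_n\ge0$, and $$V(f)=\|f\|_{2,n}+\sum_{k=1}^\infty\min\{\|f\|_{2,n},\mathbb D_n\Delta(k)\},\qquad \beta(q)=\sum_{j\ge q}\Delta(j),$$ $$q^*(x)=\min\{q\in\mathbb N: q\ge 1,\ \beta(q)\le qx\}\ (x>0),\qquad r(\delta)=\max\{x>0: q^*(x)x\le\delta\}\ (\delta>0).$$ **Assumption.** There are $\nu\ge2$ (real), $p\in(1,\infty]$, $s\in(0,1]$, constants $C_X,C_R,C_{\bar f}>0$ and a summable sequence $L=(L_j)_{j\ge0}$ of nonnegative reals, none of them depending on $n$, such that for every $n\ge1$: 1. Every $f\in\mathcal F$ has the form $f(z,u)=D_{f,n}(u)\,\bar f(z,u)$, and there is a function $R=R_n:(\mathbb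 R^d)^{\mathbb N_0}\times[0,1]\to[0,\infty)$, measurable in $z$, such that for all $f\in\mathcal F$, $u\in[0,1]$ and all sequences $z,z'$, $$|\bar f(z,u)-\bar f(z',u)|\le\Big(\sum_{j\ge0}L_j|z_j-z_j'|_\infty^s\Big)\big(R(z,u)+R(z',u)\big)$$ (no condition when the series diverges), $|\bar f(0,u)|\le C_{\bar f}$ and $|R(0,u)|\le C_R$. 2. $\|R(Z_i,u)\|_{\nu p}\le C_R$ for $1\le i\le n$, $u\in[0,1]$, and $\|X_{ij}\|_{\nu sp/(p-1)}\le C_X$ for all integers $i\le n$ and $1\le j\le d$ (where $p/(p-1)=1$ if $p=\infty$). 3. $2dC_R\sum_{j=0}^kL_j\,\delta^X_{\nu sp/(p-1)}(k-j)^s\le\Delta(k)$ for all $k\ge0$. 4. $\big(\frac1n\sum_{i=1}^n|D_{f,n}(\frac in)|^2\big)^{1/2}\le\mathbb D_n$ for all $f\in\mathcal F$. Let $C_\Delta=4d\big(\sum_jL_j\big)C_X^sC_R+C_{\bar f}$ and $D_n^\infty(u)=\max_{f\in\mathcal F}|D_{f,n}(u)|$. For $\kappa\in\{2,\nu\}$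 let $\mathbb D^\infty_{\kappa,n}$ be any number with $\big(\frac1n\sum_{i=1}^nD_n^\infty(\frac in)^\kappa\big)^{1/\kappa}\le\mathbb D^\infty_{\kappa,n}$, and let $\mathbb D_n^\infty=\mathbb D_{2,n}^\infty>0$. **Corollary (uniform convergence rates, smooth case).** Let $\sigma\in(0,\infty)$ be such that $$\sup_{n\ge1}\sup_{f\in\mathcal F}V(f)\le\sigma,\qquad \sup_{n\ge1}\frac{\mathbb D^\infty_{\nu,n}}{\mathbb D^\infty_n}<\infty,\qquad \sup_{n\ge1}\frac{C_\Delta H}{n^{1-2/\nu}\,r\big(\sigma/\mathbb D^\infty_n\big)^2}<\infty .$$ Then $\max_{f\in\mathcal F}|\mathbb G_n(f)|=O_p(\sqrt H)$, i.e. for every $\eta>0$ there is $K>0$ with $\mathbb P\big(\max_{f\in\mathcal F}|\mathbb G_n(f)|>K\sqrt H\big)\le\eta$ for all $n\ge1$. -/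

import Mathlib

open MeasureTheory ProbabilityTheory
open scoped ENNReal

noncomputable section

namespace FDep

/-- Sequences `(z_j)_{j ≥ 0}` in `ℝ^d`; `Fin d → ℝ` carries the maximum norm. -/
abbrev Seq (d : ℕ) : Type := ℕ → (Fin d → ℝ)

/-- Real-valued functions on `(ℝ^d)^{ℕ₀} × [0,1]`. -/
abbrev Fn (d : ℕ) : Type := Seq d × unitInterval → ℝ

/-- The point `i / n` of `[0,1]`, for `1 ≤ i ≤ n`. -/
def gridPoint (n i : ℕ) : unitInterval :=
  Set.projIcc (0 : ℝ) 1 zero_le_one ((i : ℝ) / (n : ℝ))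

/-! ### The process and its functional dependence measure -/

section Arrays

variable {Ω : Type*} [MeasurableSpace Ω] {d m : ℕ}

/-- `X_i` as a functional `J_{i,n}(e_i, e_{i-1}, …)` of a two-sided innovation path `e`. -/
def shiftProc (J : ℕ → ℤ → (ℕ → (Fin m → ℝ)) → (Fin d → ℝ)) (n : ℕ) (i : ℤ)
    (e : ℤ → (Fin m → ℝ)) : Fin d → ℝ :=
  J n i (fun k => e (i - (k : ℤ)))

/-- `X_i = J_{i,n}(ε_i, ε_{i-1}, …)`. -/
def obs (ε : ℤ → Ω → (Fin m → ℝ)) (J : ℕ → ℤ → (ℕ → (Fin m → ℝ)) → (Fin d → ℝ))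
    (n : ℕ) (i : ℤ) (ω : Ω) : Fin d → ℝ :=
  shiftProc J n i (fun l => ε l ω)

/-- `Z_i = (X_i, X_{i-1}, X_{i-2}, …)`. -/
def obsPast (ε : ℤ → Ω → (Fin m → ℝ)) (J : ℕ → ℤ → (ℕ → (Fin m → ℝ)) → (Fin d → ℝ))
    (n : ℕ) (i : ℤ) (ω : Ω) : Seq d :=
  fun j => obs ε J n (i - (j : ℤ)) ω

/-- The innovation path in which `ε_l` is replaced by an independent copy. The copy is realised on
the product space: `ε_l^*(ω, ω') = ε_l(ω')`, while the other innovations are functions of `ω`. -/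
def coupledPath (ε : ℤ → Ω → (Fin m → ℝ)) (l : ℤ) (w : Ω × Ω) : ℤ → (Fin m → ℝ) :=
  Function.update (fun t => ε t w.1) l (ε l w.2)

/-- The uniform functional dependence measure
`δ_q^X(k) = sup_{i ≤ n} sup_j ‖X_{ij} - X_{ij}^{*(i-k)}‖_q` (for the `n`-th row of the array). -/
def depMeasure (μ : Measure Ω) (ε : ℤ → Ω → (Fin m → ℝ))
    (J : ℕ → ℤ → (ℕ → (Fin m → ℝ)) → (Fin d → ℝ)) (n : ℕ) (q : ℝ≥0∞) (k : ℕ) : ℝ≥0∞ :=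
  ⨆ i : {i : ℤ // i ≤ (n : ℤ)}, ⨆ j : Fin d,
    eLpNorm (fun w : Ω × Ω =>
      shiftProc J n i (fun t => ε t w.1) j
        - shiftProc J n i (coupledPath ε ((i : ℤ) - (k : ℤ)) w) j) q (μ.prod μ)

/-- `ε_i`, `i ∈ ℤ`, are independent and identically distributed random vectors. -/
structure IsIID (μ : Measure Ω) (ε : ℤ → Ω → (Fin m → ℝ)) : Prop where
  measurable : ∀ i, Measurable (ε i)
  indep : iIndepFun ε μ
  ident : ∀ i, IdentDistrib (ε i) (ε 0) μ μ

/-- The empirical process `𝔾_n(f) = n^{-1/2} ∑_{i=1}^n (f(Z_i, i/n) - E f(Z_i, i/n))`. -/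
def empProc (μ : Measure Ω) (ε : ℤ → Ω → (Fin m → ℝ))
    (J : ℕ → ℤ → (ℕ → (Fin m → ℝ)) → (Fin d → ℝ)) (n : ℕ) (f : Fn d) (ω : Ω) : ℝ :=
  1 / Real.sqrt n * ∑ i ∈ Finset.Icc 1 n,
    (f (obsPast ε J n i ω, gridPoint n i) - ∫ ω', f (obsPast ε J n i ω', gridPoint n i) ∂μ)

/-- `‖f‖_{2,n} = (n^{-1} ∑_{i=1}^n ‖f(Z_i, i/n)‖_2^2)^{1/2}`. -/
def normTwo (μ : Measure Ω) (ε : ℤ → Ω → (Fin m → ℝ))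
    (J : ℕ → ℤ → (ℕ → (Fin m → ℝ)) → (Fin d → ℝ)) (n : ℕ) (f : Fn d) : ℝ≥0∞ :=
  ((n : ℝ≥0∞)⁻¹ * ∑ i ∈ Finset.Icc 1 n,
    eLpNorm (fun ω => f (obsPast ε J n i ω, gridPoint n i)) 2 μ ^ 2) ^ (1 / 2 : ℝ)

/-- `V(f) = ‖f‖_{2,n} + ∑_{k ≥ 1} min(‖f‖_{2,n}, 𝔻_n Δ(k))`. -/
def V (μ : Measure Ω) (ε : ℤ → Ω → (Fin m → ℝ))
    (J : ℕ → ℤ → (ℕ → (Fin m → ℝ)) → (Fin d → ℝ)) (Δ : ℕ → ℝ) (DD : ℕ → ℝ)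
    (n : ℕ) (f : Fn d) : ℝ≥0∞ :=
  normTwo μ ε J n f
    + ∑' k : ℕ, min (normTwo μ ε J n f) (ENNReal.ofReal (DD n * Δ (k + 1)))

end Arrays

/-! ### The function class -/

/-- `(L, s, R, (C_R, C_f))`-classes of functions. The Hölder bound reads
`|f(z,u) - f(z',u)| ≤ |z - z'|_{L,s}^s (R(z,u) + R(z',u))` with
`|z|_{L,s}^s = ∑_j L_j |z_j|_∞^s`; it says nothing when this series diverges. -/
structure IsHolderClass {d : ℕ} (Fbar : Set (Fn d)) (L : ℕ → ℝ) (s : ℝ) (R : Fn d)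
    (C_R C_f : ℝ) : Prop where
  L_nonneg : ∀ j, 0 ≤ L j
  L_summable : Summable L
  s_pos : 0 < s
  s_le_one : s ≤ 1
  R_nonneg : ∀ x, 0 ≤ R x
  R_measurable : ∀ u, Measurable (fun z => R (z, u))
  C_R_pos : 0 < C_R
  C_f_pos : 0 < C_f
  holder : ∀ f ∈ Fbar, ∀ (u : unitInterval) (z z' : Seq d),
    Summable (fun j => L j * ‖z j - z' j‖ ^ s) →
      |f (z, u) - f (z', u)| ≤ (∑' j, L j * ‖z j - z' j‖ ^ s) * (R (z, u) + R (z', u))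
  f_zero : ∀ f ∈ Fbar, ∀ u : unitInterval, |f (0, u)| ≤ C_f
  R_zero : ∀ u : unitInterval, |R (0, u)| ≤ C_R

/-- The compatibility condition on the finite class `F` in the `n`-th row: every `f ∈ F` is
`f(z,u) = D_f(u) · fbar_f(z,u)`, the `fbar_f` form an `(L, s, R, C)`-class, and the moment,
dependence and size conditions hold. The exponent `ν s p / (p - 1)` is `ν s · p'`, with `p'` the
conjugate exponent of `p ∈ (1, ∞]`. -/
structure Compatible {Ω : Type*} [MeasurableSpace Ω] {d m : ℕ} (μ : Measure Ω)
    (ε : ℤ → Ω → (Fin m → ℝ)) (J : ℕ → ℤ → (ℕ → (Fin m → ℝ)) → (Fin d → ℝ)) (n : ℕ)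
    (F : Finset (Fn d)) (D : Fn d → unitInterval → ℝ) (fbar : Fn d → Fn d)
    (L : ℕ → ℝ) (s : ℝ) (R : Fn d) (C_R C_f ν : ℝ) (p : ℝ≥0∞) (C_X : ℝ)
    (Δ : ℕ → ℝ) (DDn : ℝ) : Prop where
  f_measurable : ∀ f ∈ F, Measurable f
  decomp : ∀ f ∈ F, ∀ (z : Seq d) (u : unitInterval), f (z, u) = D f u * fbar f (z, u)
  holderClass : IsHolderClass (fbar '' (F : Set (Fn d))) L s R C_R C_f
  two_le : 2 ≤ ν
  one_lt : 1 < p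
  C_X_pos : 0 < C_X
  R_moment : ∀ i ∈ Finset.Icc 1 n, ∀ u : unitInterval,
    eLpNorm (fun ω => R (obsPast ε J n i ω, u)) (ENNReal.ofReal ν * p) μ ≤ ENNReal.ofReal C_R
  X_moment : ∀ i : ℤ, i ≤ (n : ℤ) → ∀ j : Fin d,
    eLpNorm (fun ω => obs ε J n i ω j) (ENNReal.ofReal (ν * s) * ENNReal.conjExponent p) μ
      ≤ ENNReal.ofReal C_X
  dependence : ∀ k : ℕ,
    ENNReal.ofReal (2 * d * C_R) * ∑ j ∈ Finset.range (k + 1), ENNReal.ofReal (L j) *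
      depMeasure μ ε J n (ENNReal.ofReal (ν * s) * ENNReal.conjExponent p) (k - j) ^ s
      ≤ ENNReal.ofReal (Δ k)
  D_bound : ∀ f ∈ F,
    Real.sqrt (1 / (n : ℝ) * ∑ i ∈ Finset.Icc 1 n, |D f (gridPoint n i)| ^ 2) ≤ DDn

/-- `D^∞(u) = sup_{f ∈ F} |D_f(u)|` for a finite class `F`. -/
def supD {d : ℕ} (F : Finset (Fn d)) (D : Fn d → unitInterval → ℝ) (u : unitInterval) : ℝ :=
  ⨆ f : {f // f ∈ F}, |D f u|

/-- `(n^{-1} ∑_{i=1}^n D^∞(i/n)^κ)^{1/κ}`. -/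
def supDMean {d : ℕ} (F : Finset (Fn d)) (D : Fn d → unitInterval → ℝ) (κ : ℝ) (n : ℕ) : ℝ :=
  (1 / (n : ℝ) * ∑ i ∈ Finset.Icc 1 n, supD F D (gridPoint n i) ^ κ) ^ (1 / κ)

/-- `H = 1 ∨ log |F|`. -/
def entropyH {d : ℕ} (F : Finset (Fn d)) : ℝ := max 1 (Real.log (F.card : ℝ))

/-! ### The functions `β`, `q^*`, `r` attached to `Δ`, and the constant `C_Δ` -/

/-- `β(q) = ∑_{j ≥ q} Δ(j)`. -/
def betaTail (Δ : ℕ → ℝ) (q : ℕ) : ℝ := ∑' j : ℕ, Δ (q + j)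

/-- `q^*(x) = min {q ≥ 1 : β(q) ≤ q x}`. -/
def qStar (Δ : ℕ → ℝ) (x : ℝ) : ℕ := sInf {q : ℕ | 1 ≤ q ∧ betaTail Δ q ≤ (q : ℝ) * x}

/-- `r(δ) = max {x > 0 : q^*(x) x ≤ δ}`, for `δ > 0`. -/
def rFun (Δ : ℕ → ℝ) (δ : ℝ) : ℝ := sSup {x : ℝ | 0 < x ∧ (qStar Δ x : ℝ) * x ≤ δ}

/-- `C_Δ = 4 d |L|_1 C_X^s C_R + C_f`. -/
def CDelta (d : ℕ) (L : ℕ → ℝ) (s C_X C_R C_f : ℝ) : ℝ :=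
  4 * d * (∑' j, L j) * C_X ^ s * C_R + C_f

/-- `Y_n = O_p(a_n)`: for every `η > 0` there is `K` with `P(|Y_n| > K a_n) ≤ η` for all
`n ≥ 1`. -/
def IsBigOp {Ω : Type*} [MeasurableSpace Ω] (μ : Measure Ω) (Y : ℕ → Ω → ℝ) (a : ℕ → ℝ) : Prop :=
  ∀ η : ℝ, 0 < η → ∃ K : ℝ, 0 < K ∧ ∀ n : ℕ, 1 ≤ n →
    μ {ω | K * a n < |Y n ω|} ≤ ENNReal.ofReal η

end FDep

end

/-!
The proof is a maximal inequality for bounded functionals of i.i.d. innovations, combined with a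
truncation.

All conditions concern the law of the innovations, so the process may be realised on the space of
two-sided paths with the product measure `pathLaw P`. There the conditional expectation given the
innovations from time `a` on is an honest integral, `condFrom P a g`, over an independent copy of the
earlier coordinates; independence and the tower property reduce to the fact that exchanging
coordinates between two independent paths preserves their joint law
(`measurePreserving_spliceSwap`). The projection difference `diffFrom P (i - k) g` is bounded in
`L²` by the effect of resampling `ε_{i-k}`, that is, by the functional dependence measure.

Let `g_i(f)` be the truncation of `f(Z_i, i/n)` at level `M`, and split `g_i - E g_i` at lag `q`.

* The remote past, `∑_i (g_i - E[g_i | ε_{i-q}, …, ε_i])`, is a sum over the lags `k > q` of reverse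
  martingales. The inequality `exp (x - x²) ≤ 1 + x + x²` yields a self-normalised exponential
  inequality (`integral_exp_martingale_le`) whose normaliser can be taken common to all `f`. Hence
  the expected maximum is at most a multiple of `√(n H) 𝔻^∞_n β(q)` (`expMax_sub_condFrom_le`).
* The recent past, `∑_i (E[g_i | ε_{i-q}, …, ε_i] - E g_i)`, is cut into blocks of length `q`. Blocks
  of equal parity are independent, bounded by `2 M q`, and their variances add up to at most a
  multiple of `n V(f)²`, by orthogonality at each lag and a weighted Cauchy–Schwarz inequality over
  the lags. A Bernstein argument bounds the expected maximum by a multiple of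
  `H M q + √(n H) σ` (`expMax_condFrom_sub_integral_le`).

With `x` comparable to `r(σ / 𝔻^∞_n)`, `q = q^*(x)` and `M = √n x 𝔻^∞_n / √H`, both bounds are of
order `√(n H) σ`. What the truncation cuts off is controlled by `M^{1-ν}` times the `ν`-th moments of
an envelope of the class (`Compatible.eLpNorm_envelope_le`), and the rate condition says exactly that
this is of order `√(n H)` as well (`truncation_moment_le`). Markov's inequality concludes.
-/

namespace FDep

/-! ### Splicing independent innovation paths -/

section PathSpace

variable {E : Type*}

open Classical in
/-- The path that follows `e` at the times in `S` and `e'` at all other times. -/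
noncomputable def splice (S : Set ℤ) (e e' : ℤ → E) : ℤ → E :=
  fun t => if t ∈ S then e t else e' t

lemma splice_of_mem {S : Set ℤ} {t : ℤ} (h : t ∈ S) (e e' : ℤ → E) :
    splice S e e' t = e t := by simp [splice, h]

lemma splice_of_notMem {S : Set ℤ} {t : ℤ} (h : t ∉ S) (e e' : ℤ → E) :
    splice S e e' t = e' t := by simp [splice, h]

variable [MeasurableSpace E]

/-- The law of an i.i.d. two-sided innovation path with marginal `P`. -/
noncomputable abbrev pathLaw (P : Measure E) : Measure (ℤ → E) :=
  Measure.infinitePi (fun _ : ℤ => P)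

lemma measurable_splice (S : Set ℤ) :
    Measurable (fun w : (ℤ → E) × (ℤ → E) => splice S w.1 w.2) := by
  refine measurable_pi_lambda _ fun t => ?_
  by_cases h : t ∈ S
  · simp only [splice_of_mem h]; fun_prop
  · simp only [splice_of_notMem h]; fun_prop

@[fun_prop]
lemma measurable_splice_comp {α : Type*} [MeasurableSpace α] (S : Set ℤ) {u v : α → ℤ → E}
    (hu : Measurable u) (hv : Measurable v) :
    Measurable (fun x => FDep.splice S (u x) (v x)) :=
  (measurable_splice S).comp (hu.prodMk hv)

variable (P : Measure E) [IsProbabilityMeasure P]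

/-- Exchanging the coordinates outside `S` between two independent i.i.d. paths does not change
their joint law. -/
lemma measurePreserving_spliceSwap (S : Set ℤ) :
    MeasurePreserving (fun w : (ℤ → E) × (ℤ → E) => (splice S w.1 w.2, splice S w.2 w.1))
      ((pathLaw P).prod (pathLaw P)) ((pathLaw P).prod (pathLaw P)) := by
  classical
  have hm : Measurable
      (fun w : (ℤ → E) × (ℤ → E) => (splice S w.1 w.2, splice S w.2 w.1)) := by fun_prop
  refine ⟨hm, ?_⟩
  set C : Set (Set (ℤ → E)) :=
    {A | ∃ (s : Finset ℤ) (t : ℤ → Set E), (∀ i, MeasurableSet (t i)) ∧ A = Set.pi s t} with hC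
  have hext : ∀ (s s' : Finset ℤ) (t : ℤ → Set E), s ⊆ s' →
      Set.pi (s : Set ℤ) t = Set.pi (s' : Set ℤ) (fun i => if i ∈ s then t i else Set.univ) := by
    intro s s' t hss
    ext e
    simp only [Set.mem_pi, Finset.mem_coe]
    constructor
    · intro h i _
      split_ifs with hi
      · exact h i hi
      · trivial
    · intro h i hi
      simpa [hi] using h i (hss hi)
  have hgen : MeasurableSpace.generateFrom C = MeasurableSpace.pi := by
    apply le_antisymm
    · refine MeasurableSpace.generateFrom_le ?_
      rintro _ ⟨s, t, ht, rfl⟩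
      exact MeasurableSet.pi s.countable_toSet fun i _ => ht i
    · refine iSup_le fun i => ?_
      rintro _ ⟨A, hA, rfl⟩
      refine MeasurableSpace.measurableSet_generateFrom
        ⟨{i}, fun _ => A, fun _ => hA, ?_⟩
      ext e; simp
  have hpi : IsPiSystem C := by
    rintro _ ⟨s, t, ht, rfl⟩ _ ⟨s', t', ht', rfl⟩ _
    refine ⟨s ∪ s', fun i => (if i ∈ s then t i else Set.univ) ∩
      (if i ∈ s' then t' i else Set.univ), fun i => ?_, ?_⟩
    · refine MeasurableSet.inter ?_ ?_ <;> split_ifs <;> simp [ht, ht']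
    · rw [hext s (s ∪ s') t Finset.subset_union_left, hext s' (s ∪ s') t' Finset.subset_union_right,
        ← Set.pi_inter_distrib]
  symm
  refine Measure.prod_eq_generateFrom hgen hgen hpi hpi
    ⟨fun _ => Set.univ, fun _ => ⟨∅, fun _ => Set.univ, by simp, by simp⟩,
      fun _ => by simp, Set.iUnion_const _⟩
    ⟨fun _ => Set.univ, fun _ => ⟨∅, fun _ => Set.univ, by simp, by simp⟩,
      fun _ => by simp, Set.iUnion_const _⟩ ?_
  rintro _ ⟨s, t, ht, rfl⟩ _ ⟨s', t', ht', rfl⟩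
  rw [hext s (s ∪ s') t Finset.subset_union_left, hext s' (s ∪ s') t' Finset.subset_union_right]
  set u : Finset ℤ := s ∪ s'
  set t1 : ℤ → Set E := fun i => if i ∈ s then t i else Set.univ with ht1
  set t2 : ℤ → Set E := fun i => if i ∈ s' then t' i else Set.univ with ht2
  have m1 : ∀ i, MeasurableSet (t1 i) := fun i => by
    simp only [ht1]; split_ifs <;> simp [ht]
  have m2 : ∀ i, MeasurableSet (t2 i) := fun i => by
    simp only [ht2]; split_ifs <;> simp [ht']
  have mpi : ∀ τ : ℤ → Set E, (∀ i, MeasurableSet (τ i)) →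
      MeasurableSet (Set.pi (u : Set ℤ) τ) :=
    fun τ h => MeasurableSet.pi u.countable_toSet fun i _ => h i
  rw [Measure.map_apply hm ((mpi _ m1).prod (mpi _ m2))]
  have hpre : (fun w : (ℤ → E) × (ℤ → E) => (splice S w.1 w.2, splice S w.2 w.1)) ⁻¹'
      (Set.pi (u : Set ℤ) t1 ×ˢ Set.pi (u : Set ℤ) t2) =
      Set.pi (u : Set ℤ) (fun i => if i ∈ S then t1 i else t2 i) ×ˢ
        Set.pi (u : Set ℤ) (fun i => if i ∈ S then t2 i else t1 i) := by
    ext w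
    simp only [Set.mem_preimage, Set.mem_prod, Set.mem_pi, ← forall_and]
    refine forall₂_congr fun i _ => ?_
    by_cases h : i ∈ S
    · simp [splice_of_mem h, h]
    · simp [splice_of_notMem h, h, and_comm]
  rw [hpre, Measure.prod_prod, Measure.infinitePi_pi, Measure.infinitePi_pi,
    Measure.infinitePi_pi, Measure.infinitePi_pi, ← Finset.prod_mul_distrib,
    ← Finset.prod_mul_distrib]
  · refine Finset.prod_congr rfl fun i _ => ?_
    split_ifs <;> simp [mul_comm]
  · exact fun i _ => m2 i
  · exact fun i _ => m1 i
  · intro i _; split_ifs <;> simp [m1, m2]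
  · intro i _; split_ifs <;> simp [m1, m2]

lemma measurePreserving_splice (S : Set ℤ) :
    MeasurePreserving (fun w : (ℤ → E) × (ℤ → E) => splice S w.1 w.2)
      ((pathLaw P).prod (pathLaw P)) (pathLaw P) :=
  measurePreserving_fst.comp (measurePreserving_spliceSwap P S)

end PathSpace

/-! ### Bounded measurable functions -/

/-- Bounded measurable real functions: the class in which every integral below is taken, so that
integrability and Fubini's theorem come for free. -/
structure BddMeasurable {α : Type*} [MeasurableSpace α] (f : α → ℝ) : Prop where
  measurable : Measurable f
  bdd : ∃ C, ∀ x, |f x| ≤ C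

namespace BddMeasurable

variable {α β : Type*} [MeasurableSpace α] [MeasurableSpace β] {f g : α → ℝ}

lemma const (c : ℝ) : BddMeasurable (fun _ : α => c) := ⟨measurable_const, |c|, fun _ => le_rfl⟩

lemma add (hf : BddMeasurable f) (hg : BddMeasurable g) : BddMeasurable (fun x => f x + g x) := by
  obtain ⟨C, hC⟩ := hf.bdd
  obtain ⟨D, hD⟩ := hg.bdd
  exact ⟨hf.measurable.add hg.measurable, C + D,
    fun x => (abs_add_le _ _).trans (add_le_add (hC x) (hD x))⟩

lemma mul (hf : BddMeasurable f) (hg : BddMeasurable g) : BddMeasurable (fun x => f x * g x) := by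
  obtain ⟨C, hC⟩ := hf.bdd
  obtain ⟨D, hD⟩ := hg.bdd
  refine ⟨hf.measurable.mul hg.measurable, C * D, fun x => ?_⟩
  rw [abs_mul]
  exact mul_le_mul (hC x) (hD x) (abs_nonneg _) ((abs_nonneg _).trans (hC x))

lemma neg (hf : BddMeasurable f) : BddMeasurable (fun x => - f x) := by
  obtain ⟨C, hC⟩ := hf.bdd
  exact ⟨hf.measurable.neg, C, fun x => by rw [abs_neg]; exact hC x⟩

lemma sub (hf : BddMeasurable f) (hg : BddMeasurable g) : BddMeasurable (fun x => f x - g x) := by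
  simpa only [sub_eq_add_neg] using hf.add hg.neg

lemma sq (hf : BddMeasurable f) : BddMeasurable (fun x => f x ^ 2) := by
  simpa only [pow_two] using hf.mul hf

lemma abs (hf : BddMeasurable f) : BddMeasurable (fun x => |f x|) := by
  obtain ⟨C, hC⟩ := hf.bdd
  exact ⟨hf.measurable.abs, C, fun x => by rw [abs_abs]; exact hC x⟩

lemma exp (hf : BddMeasurable f) : BddMeasurable (fun x => Real.exp (f x)) := by
  obtain ⟨C, hC⟩ := hf.bdd
  refine ⟨hf.measurable.exp, Real.exp C, fun x => ?_⟩
  rw [Real.abs_exp]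
  exact Real.exp_le_exp.2 ((le_abs_self _).trans (hC x))

lemma comp (hf : BddMeasurable f) {u : β → α} (hu : Measurable u) :
    BddMeasurable (fun x => f (u x)) := by
  obtain ⟨C, hC⟩ := hf.bdd
  exact ⟨hf.measurable.comp hu, C, fun x => hC _⟩

lemma sum {κ : Type*} (s : Finset κ) {f : κ → α → ℝ} (hf : ∀ i ∈ s, BddMeasurable (f i)) :
    BddMeasurable (fun x => ∑ i ∈ s, f i x) := by
  classical
  induction s using Finset.induction_on with
  | empty => simpa using const 0
  | insert i s hi ih =>
    simp only [Finset.sum_insert hi]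
    exact (hf i (Finset.mem_insert_self _ _)).add
      (ih fun j hj => hf j (Finset.mem_insert_of_mem hj))

lemma iSup {ι : Type*} [Finite ι] {f : ι → α → ℝ} (hf : ∀ i, BddMeasurable (f i)) :
    BddMeasurable (fun x => ⨆ i, f i x) := by
  have := Fintype.ofFinite ι
  choose C hC using fun i => (hf i).bdd
  refine ⟨Measurable.iSup fun i => (hf i).measurable, ∑ i, |C i|, fun x => ?_⟩
  have h : ∀ i, |f i x| ≤ ∑ i, |C i| := fun i => ((hC i x).trans (le_abs_self _)).trans
    (Finset.single_le_sum (f := fun i => |C i|) (fun _ _ => abs_nonneg _) (Finset.mem_univ i))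
  rcases isEmpty_or_nonempty ι with hι | hι
  · simp
  refine abs_le.2 ⟨?_, ciSup_le fun i => (abs_le.1 (h i)).2⟩
  obtain ⟨i⟩ := hι
  exact (abs_le.1 (h i)).1.trans (le_ciSup (Set.finite_range fun i => f i x).bddAbove i)

lemma integrable (hf : BddMeasurable f) (μ : Measure α) [IsFiniteMeasure μ] : Integrable f μ := by
  obtain ⟨C, hC⟩ := hf.bdd
  exact Integrable.of_bound hf.measurable.aestronglyMeasurable C (Filter.Eventually.of_forall hC)

lemma integral_prod {f : α × β → ℝ} (hf : BddMeasurable f) (μ : Measure β)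
    [IsProbabilityMeasure μ] : BddMeasurable (fun x => ∫ y, f (x, y) ∂μ) := by
  obtain ⟨C, hC⟩ := hf.bdd
  refine ⟨(hf.measurable.stronglyMeasurable.integral_prod_right').measurable, C, fun x => ?_⟩
  have := norm_integral_le_of_norm_le_const (μ := μ) (f := fun y => f (x, y)) (C := C)
    (Filter.Eventually.of_forall fun y => hC (x, y))
  simpa using this

lemma sq_integral_le (hf : BddMeasurable f) (μ : Measure α) [IsProbabilityMeasure μ] :
    (∫ x, f x ∂μ) ^ 2 ≤ ∫ x, f x ^ 2 ∂μ := by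
  obtain ⟨C, hC⟩ := hf.bdd
  have h := variance_eq_sub (X := f) (μ := μ)
    (MemLp.of_bound hf.measurable.aestronglyMeasurable C (Filter.Eventually.of_forall hC))
  have := variance_nonneg f μ
  simp only [Pi.pow_apply] at h
  linarith

end BddMeasurable

/-! ### Conditional expectation given the innovations from some time on -/

section CondFrom

variable {E : Type*} [MeasurableSpace E] (P : Measure E)

/-- The conditional expectation of `g` given the coordinates at times `≥ a` of an i.i.d. path,
realised pointwise by integrating out an independent copy of the earlier coordinates. -/
noncomputable def condFrom (a : ℤ) (g : (ℤ → E) → ℝ) (e : ℤ → E) : ℝ :=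
  ∫ e', g (splice (Set.Ici a) e e') ∂(pathLaw P)

variable [IsProbabilityMeasure P] {a b : ℤ} {g h : (ℤ → E) → ℝ}

lemma BddMeasurable.comp_splice (hg : BddMeasurable g) (S : Set ℤ) :
    BddMeasurable (fun w : (ℤ → E) × (ℤ → E) => g (splice S w.1 w.2)) :=
  hg.comp (measurable_splice S)

lemma BddMeasurable.comp_splice_right (hg : BddMeasurable g) (S : Set ℤ) (e : ℤ → E) :
    BddMeasurable (fun e' => g (splice S e e')) :=
  hg.comp (by fun_prop)

lemma BddMeasurable.condFrom (hg : BddMeasurable g) (a : ℤ) :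
    BddMeasurable (condFrom P a g) :=
  (hg.comp_splice (Set.Ici a)).integral_prod _

omit [IsProbabilityMeasure P] in
lemma dependsOn_condFrom {S : Set ℤ} (hg : DependsOn g S) :
    DependsOn (condFrom P a g) (S ∩ Set.Ici a) := by
  intro x y hxy
  refine integral_congr_ae (Filter.Eventually.of_forall fun e' => hg fun t ht => ?_)
  by_cases hta : t ∈ Set.Ici a
  · rw [splice_of_mem hta, splice_of_mem hta, hxy t ⟨ht, hta⟩]
  · rw [splice_of_notMem hta, splice_of_notMem hta]

lemma integral_splice {g : (ℤ → E) → ℝ} (hg : BddMeasurable g) (S : Set ℤ) :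
    ∫ e, ∫ e', g (splice S e e') ∂(pathLaw P) ∂(pathLaw P) = ∫ e, g e ∂(pathLaw P) := by
  rw [← integral_prod (fun w : (ℤ → E) × (ℤ → E) => g (splice S w.1 w.2))
    ((hg.comp_splice S).integrable _)]
  have hp := measurePreserving_splice P S
  conv_rhs => rw [← hp.map_eq]
  rw [integral_map hp.measurable.aemeasurable hg.measurable.aestronglyMeasurable]

lemma integral_condFrom (hg : BddMeasurable g) (a : ℤ) :
    ∫ e, condFrom P a g e ∂(pathLaw P) = ∫ e, g e ∂(pathLaw P) :=
  integral_splice P hg _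

omit [IsProbabilityMeasure P] in
lemma condFrom_mul (hh : DependsOn h (Set.Ici a)) (e : ℤ → E) :
    condFrom P a (fun e => h e * g e) e = h e * condFrom P a g e := by
  unfold condFrom
  rw [← integral_const_mul]
  refine integral_congr_ae (Filter.Eventually.of_forall fun e' => ?_)
  have : h (splice (Set.Ici a) e e') = h e := hh fun t ht => splice_of_mem ht _ _
  simp only [this]

omit [IsProbabilityMeasure P] in
lemma condFrom_of_dependsOn_Iio (hg : DependsOn g (Set.Iio a)) (e : ℤ → E) :
    condFrom P a g e = ∫ e', g e' ∂(pathLaw P) := by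
  refine integral_congr_ae (Filter.Eventually.of_forall fun e' => hg fun t ht => ?_)
  exact splice_of_notMem (by simpa using ht) _ _

lemma condFrom_condFrom_of_le (hg : BddMeasurable g) (hba : b ≤ a) (e : ℤ → E) :
    condFrom P a (condFrom P b g) e = condFrom P a g e := by
  have key : ∀ e' e'' : ℤ → E, splice (Set.Ici b) (splice (Set.Ici a) e e') e''
      = splice (Set.Ici a) e (splice (Set.Ici b) e' e'') := by
    intro e' e''
    funext t
    by_cases h1 : a ≤ t
    · simp [splice, h1, hba.trans h1]
    · by_cases h2 : b ≤ t <;> simp [splice, h1, h2]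
  unfold condFrom
  simp_rw [key]
  exact integral_splice P (hg.comp_splice_right (Set.Ici a) e) (Set.Ici b)

lemma condFrom_sub (hg : BddMeasurable g) (hh : BddMeasurable h) (e : ℤ → E) :
    condFrom P a (fun e => g e - h e) e = condFrom P a g e - condFrom P a h e :=
  integral_sub ((hg.comp_splice_right _ e).integrable _) ((hh.comp_splice_right _ e).integrable _)

lemma condFrom_mono (hg : BddMeasurable g) (hh : BddMeasurable h) (hgh : ∀ e, g e ≤ h e)
    (e : ℤ → E) : condFrom P a g e ≤ condFrom P a h e :=
  integral_mono ((hg.comp_splice_right _ e).integrable _)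
    ((hh.comp_splice_right _ e).integrable _) fun _ => hgh _

lemma sq_condFrom_le (hg : BddMeasurable g) (e : ℤ → E) :
    condFrom P a g e ^ 2 ≤ condFrom P a (fun e => g e ^ 2) e :=
  (hg.comp_splice_right _ e).sq_integral_le _

lemma abs_condFrom_le {C : ℝ} (hC : ∀ e, |g e| ≤ C) (e : ℤ → E) : |condFrom P a g e| ≤ C := by
  have := norm_integral_le_of_norm_le_const (μ := pathLaw P)
    (f := fun e' => g (splice (Set.Ici a) e e')) (C := C)
    (Filter.Eventually.of_forall fun y => hC _)
  simpa [condFrom] using this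

/-- The law of total expectation in the form used for orthogonality and for independence. -/
lemma integral_mul_eq_integral_mul_condFrom (hh : BddMeasurable h) (hg : BddMeasurable g)
    (hd : DependsOn h (Set.Ici a)) :
    ∫ e, h e * g e ∂(pathLaw P) = ∫ e, h e * condFrom P a g e ∂(pathLaw P) := by
  rw [← integral_condFrom P (hh.mul hg) a]
  simp_rw [condFrom_mul P hd]

/-- Functionals of the innovations before and from time `a` on are uncorrelated. -/
lemma integral_mul_of_dependsOn (hh : BddMeasurable h) (hg : BddMeasurable g)
    (hd : DependsOn h (Set.Ici a)) (hd' : DependsOn g (Set.Iio a)) :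
    ∫ e, h e * g e ∂(pathLaw P) = (∫ e, h e ∂(pathLaw P)) * ∫ e, g e ∂(pathLaw P) := by
  rw [integral_mul_eq_integral_mul_condFrom P hh hg hd]
  simp_rw [condFrom_of_dependsOn_Iio P hd', integral_mul_const]

/-- The σ-algebra generated by the coordinates at times `≥ a`. -/
abbrev sigmaFrom (E : Type*) [MeasurableSpace E] (a : ℤ) : MeasurableSpace (ℤ → E) :=
  MeasurableSpace.comap (fun e (t : Set.Ici a) => e t) MeasurableSpace.pi

lemma sigmaFrom_le (a : ℤ) : sigmaFrom E a ≤ MeasurableSpace.pi := by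
  have : Measurable (fun (e : ℤ → E) (t : Set.Ici a) => e t) := by fun_prop
  exact this.comap_le

lemma measurable_sigmaFrom_eval {a t : ℤ} (h : a ≤ t) :
    Measurable[sigmaFrom E a] (fun e : ℤ → E => e t) := by
  have h1 : Measurable[sigmaFrom E a] (fun (e : ℤ → E) (t : Set.Ici a) => e t) :=
    comap_measurable _
  exact (measurable_pi_apply (⟨t, h⟩ : Set.Ici a)).comp h1

lemma condFrom_ae_eq_condExp (hg : BddMeasurable g) (a : ℤ) :
    condFrom P a g =ᵐ[pathLaw P] (pathLaw P)[g | sigmaFrom E a] := by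
  refine ae_eq_condExp_of_forall_setIntegral_eq (sigmaFrom_le a) (hg.integrable _)
    (fun s _ _ => ((hg.condFrom P a).integrable _).integrableOn) (fun s hs _ => ?_) ?_
  · have hs' := sigmaFrom_le a s hs
    have hb : BddMeasurable (s.indicator (fun _ => (1 : ℝ))) :=
      ⟨measurable_const.indicator hs', 1, fun x => by
        by_cases hx : x ∈ s <;> simp [hx]⟩
    have hd : DependsOn (s.indicator (fun _ => (1 : ℝ))) (Set.Ici a) := by
      obtain ⟨A, -, rfl⟩ := hs
      intro x y hxy
      have : (fun t : Set.Ici a => x t) = fun t : Set.Ici a => y t :=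
        funext fun t => hxy t t.2
      simp only [Set.indicator]
      congr 1
      exact congrArg (· ∈ A) this
    have hind : ∀ f : (ℤ → E) → ℝ, ∫ e in s, f e ∂(pathLaw P)
        = ∫ e, s.indicator (fun _ => (1 : ℝ)) e * f e ∂(pathLaw P) := by
      intro f
      rw [← integral_indicator hs']
      refine integral_congr_ae (Filter.Eventually.of_forall fun e => ?_)
      by_cases he : e ∈ s <;> simp [he]
    rw [hind, hind, integral_mul_eq_integral_mul_condFrom P hb hg hd]
  · obtain ⟨c⟩ : Nonempty E := (inferInstance : (ae P).NeBot).nonempty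
    let ext : (Set.Ici a → E) → ℤ → E := fun r t => if ht : a ≤ t then r ⟨t, ht⟩ else c
    have hext : Measurable ext := by
      refine measurable_pi_lambda _ fun t => ?_
      by_cases ht : a ≤ t
      · simp only [ext, ht, dite_true]; fun_prop
      · simp only [ext, ht, dite_false]; fun_prop
    have hfac : condFrom P a g =
        (fun r => condFrom P a g (ext r)) ∘ fun (e : ℤ → E) (t : Set.Ici a) => e t := by
      funext e
      refine dependsOn_condFrom P (dependsOn_univ g) fun t ht => ?_
      have ht' : a ≤ t := ht.2
      simp [ext, ht']
    have h1 : Measurable[sigmaFrom E a] (fun (e : ℤ → E) (t : Set.Ici a) => e t) :=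
      comap_measurable _
    rw [hfac]
    exact (((hg.condFrom P a).measurable.comp hext).comp h1).stronglyMeasurable.aestronglyMeasurable

/-- Conditional expectations given longer and longer stretches of the past converge in `L¹`. -/
lemma tendsto_integral_abs_sub_condFrom (hg : BddMeasurable g) (a : ℤ) :
    Filter.Tendsto (fun N : ℕ => ∫ e, |g e - condFrom P (a - N) g e| ∂(pathLaw P))
      Filter.atTop (nhds 0) := by
  let ℱ : Filtration ℕ (MeasurableSpace.pi : MeasurableSpace (ℤ → E)) :=
    ⟨fun N => sigmaFrom E (a - N), fun N N' h => by
      change MeasurableSpace.comap _ _ ≤ _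
      refine Measurable.comap_le ?_
      refine @measurable_pi_lambda _ _ _ (sigmaFrom E (a - N')) _ _ fun t => ?_
      have := t.2
      simp only [Set.mem_Ici] at this
      exact measurable_sigmaFrom_eval (by omega), fun N => sigmaFrom_le _⟩
  have hsup : (⨆ n, ℱ n) = MeasurableSpace.pi := by
    refine le_antisymm (iSup_le fun n => ℱ.le n) (iSup_le fun t => ?_)
    refine le_trans (Measurable.comap_le (m₁ := sigmaFrom E (a - (a - t).toNat)) ?_)
      (le_iSup (fun n => ℱ n) (a - t).toNat)
    exact measurable_sigmaFrom_eval (by omega)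
  have h := (hg.integrable (pathLaw P)).tendsto_eLpNorm_condExp (ℱ := ℱ)
    (by rw [hsup]; exact hg.measurable.stronglyMeasurable)
  have h2 := (ENNReal.tendsto_toReal ENNReal.zero_ne_top).comp h
  simp only [ENNReal.toReal_zero] at h2
  refine h2.congr fun N => ?_
  have h3 : (pathLaw P)[g | ℱ N] - g =ᵐ[pathLaw P] fun e => condFrom P (a - N) g e - g e := by
    filter_upwards [condFrom_ae_eq_condExp P hg (a - N)] with e he
    simp only [Pi.sub_apply, he]
    rfl
  simp only [Function.comp_apply]
  rw [eLpNorm_congr_ae h3, eLpNorm_one_eq_lintegral_enorm,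
    ← integral_norm_eq_lintegral_enorm
      ((hg.condFrom P _).sub hg).measurable.aestronglyMeasurable]
  simp only [Real.norm_eq_abs, abs_sub_comm]

end CondFrom

/-! ### Maximal inequalities from exponential moments -/

lemma exp_sub_sq_le (x : ℝ) : Real.exp (x - x ^ 2) ≤ 1 + x + x ^ 2 := by
  have h1 : 1 - x + x ^ 2 ≤ Real.exp (x ^ 2 - x) := by
    linarith [Real.add_one_le_exp (x ^ 2 - x)]
  have h2 : 0 < 1 - x + x ^ 2 := by nlinarith [sq_nonneg (x - 1 / 2)]
  have h3 : 0 < 1 + x + x ^ 2 := by nlinarith [sq_nonneg (x + 1 / 2)]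
  have h4 : x - x ^ 2 = -(x ^ 2 - x) := by ring
  rw [h4, Real.exp_neg]
  refine inv_le_of_inv_le₀ h3 (le_trans ?_ h1)
  refine inv_le_of_inv_le₀ h2 ?_
  rw [inv_le_iff_one_le_mul₀ h2]
  nlinarith [sq_nonneg x, sq_nonneg (x ^ 2)]

lemma le_iSup_of_finite {ι : Type*} [Finite ι] (S : ι → ℝ) (f : ι) : S f ≤ ⨆ f, S f :=
  le_ciSup (Set.finite_range _).bddAbove f

/-- A finite maximum is controlled by self-normalised exponential moments with a common random
normaliser `Q`: the logarithm of the sum of the exponentials dominates the maximum, and it is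
bounded linearly by the tangent at `2 |ι|`. -/
lemma integral_iSup_abs_le_of_exp {α ι : Type*} [MeasurableSpace α] {μ : Measure α}
    [IsProbabilityMeasure μ] [Fintype ι] [Nonempty ι] {S : ι → α → ℝ} {Q : α → ℝ} {l : ℝ}
    (hl : 0 < l) (hS : ∀ f, BddMeasurable (S f)) (hQ : BddMeasurable Q)
    (hexp : ∀ f (l' : ℝ), l' ^ 2 = l ^ 2 →
      ∫ x, Real.exp (l' * S f x - l ^ 2 * Q x) ∂μ ≤ 1) :
    ∫ x, ⨆ f, |S f x| ∂μ ≤ Real.log (2 * Fintype.card ι) / l + l * ∫ x, Q x ∂μ := by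
  set N : ℝ := 2 * Fintype.card ι with hN
  have hNpos : 0 < N := by
    have : 0 < Fintype.card ι := Fintype.card_pos
    positivity
  have hE : ∀ l' f, BddMeasurable (fun x => Real.exp (l' * S f x - l ^ 2 * Q x)) := fun l' f =>
    (((BddMeasurable.const l').mul (hS f)).sub ((BddMeasurable.const (l ^ 2)).mul hQ)).exp
  set Y : α → ℝ := fun x => ∑ f, (Real.exp (l * S f x - l ^ 2 * Q x)
    + Real.exp (-l * S f x - l ^ 2 * Q x)) with hY
  have hYb : BddMeasurable Y := BddMeasurable.sum _ fun f _ => (hE l f).add (hE (-l) f)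
  have hYint : ∫ x, Y x ∂μ ≤ N := by
    rw [hY, integral_finsetSum _ fun f _ => ((hE l f).add (hE (-l) f)).integrable μ]
    calc ∑ f, ∫ x, (Real.exp (l * S f x - l ^ 2 * Q x) + Real.exp (-l * S f x - l ^ 2 * Q x)) ∂μ
        ≤ ∑ _f : ι, (2 : ℝ) := by
          refine Finset.sum_le_sum fun f _ => ?_
          rw [integral_add ((hE l f).integrable μ) ((hE (-l) f).integrable μ)]
          linarith [hexp f l rfl, hexp f (-l) (by ring)]
      _ = N := by simp [hN, mul_comm]
  have hpt : ∀ x, l * (⨆ f, |S f x|) ≤ Real.log N + l ^ 2 * Q x + (Y x / N - 1) := by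
    intro x
    obtain ⟨f, hf⟩ := exists_eq_ciSup_of_finite (f := fun f => |S f x|)
    rw [← hf]
    have h1 : Real.exp (l * |S f x| - l ^ 2 * Q x) ≤ Y x := by
      refine le_trans ?_ (Finset.single_le_sum (f := fun f =>
        Real.exp (l * S f x - l ^ 2 * Q x) + Real.exp (-l * S f x - l ^ 2 * Q x))
        (fun f _ => by positivity) (Finset.mem_univ f))
      rcases abs_choice (S f x) with h | h <;> rw [h]
      · exact le_add_of_nonneg_right (Real.exp_nonneg _)
      · rw [mul_neg, ← neg_mul]
        exact le_add_of_nonneg_left (Real.exp_nonneg _)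
    have h2 := Real.add_one_le_exp (l * |S f x| - l ^ 2 * Q x - Real.log N)
    rw [Real.exp_sub, Real.exp_log hNpos] at h2
    have h3 := div_le_div_of_nonneg_right h1 hNpos.le
    linarith
  have hsup : BddMeasurable (fun x => ⨆ f, |S f x|) := BddMeasurable.iSup fun f => (hS f).abs
  have hrhs : BddMeasurable (fun x => Real.log N + l ^ 2 * Q x + (Y x / N - 1)) := by
    simp only [div_eq_mul_inv]
    exact ((BddMeasurable.const _).add ((BddMeasurable.const _).mul hQ)).add
      ((hYb.mul (BddMeasurable.const _)).sub (BddMeasurable.const _))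
  have hmain := integral_mono (((BddMeasurable.const l).mul hsup).integrable μ)
    (hrhs.integrable μ) hpt
  rw [integral_const_mul, integral_add, integral_add, integral_sub, integral_const_mul,
    integral_div] at hmain
  · simp only [integral_const, probReal_univ, smul_eq_mul, one_mul] at hmain
    have h5 : (∫ x, Y x ∂μ) / N ≤ 1 := (div_le_one hNpos).2 hYint
    have h6 : l * ∫ x, ⨆ f, |S f x| ∂μ ≤ Real.log N + l ^ 2 * ∫ x, Q x ∂μ := by linarith
    have h7 : Real.log N / l + l * ∫ x, Q x ∂μ
        = (Real.log N + l ^ 2 * ∫ x, Q x ∂μ) / l := by field_simp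
    rw [h7, le_div_iff₀ hl]
    linarith
  · exact (hYb.integrable μ).div_const _
  · exact integrable_const _
  · exact integrable_const _
  · exact (hQ.integrable μ).const_mul _
  · exact (integrable_const _).add ((hQ.integrable μ).const_mul _)
  · exact ((hYb.integrable μ).div_const _).sub (integrable_const _)

section Path

variable {E : Type*} [MeasurableSpace E] (P : Measure E) [IsProbabilityMeasure P]

/-- Self-normalised exponential inequality for reverse martingale differences `d r`, where time
runs backwards from `a`. -/
lemma integral_exp_martingale_le {d m : ℕ → (ℤ → E) → ℝ} (a : ℤ) (R : ℕ)
    (hd : ∀ r < R, BddMeasurable (d r)) (hm : ∀ r < R, BddMeasurable (m r))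
    (hdd : ∀ r < R, DependsOn (d r) (Set.Ici (a - r)))
    (hmd : ∀ r < R, DependsOn (m r) (Set.Ici (a - r)))
    (hdm : ∀ r < R, ∀ e, d r e ^ 2 ≤ m r e)
    (hmart : ∀ r < R, ∀ e, condFrom P (a - r + 1) (d r) e = 0) (l : ℝ) :
    ∫ e, Real.exp (l * ∑ r ∈ Finset.range R, d r e
      - l ^ 2 * ∑ r ∈ Finset.range R, (m r e + condFrom P (a - r + 1) (m r) e)) ∂(pathLaw P)
      ≤ 1 := by
  induction R with
  | zero => simp
  | succ R ih =>
    have ih' := ih (fun r hr => hd r (by omega)) (fun r hr => hm r (by omega))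
      (fun r hr => hdd r (by omega)) (fun r hr => hmd r (by omega))
      (fun r hr => hdm r (by omega)) (fun r hr => hmart r (by omega))
    set b : ℤ := a - R + 1 with hb
    have hdR := hd R (by omega)
    have hmR := hm R (by omega)
    set Z : (ℤ → E) → ℝ := fun e => l * ∑ r ∈ Finset.range R, d r e
      - l ^ 2 * ∑ r ∈ Finset.range R, (m r e + condFrom P (a - r + 1) (m r) e) with hZ
    have hZb : BddMeasurable Z := by
      refine BddMeasurable.sub ((BddMeasurable.const l).mul (BddMeasurable.sum _ fun r hr => ?_))
        ((BddMeasurable.const _).mul (BddMeasurable.sum _ fun r hr => ?_))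
      · exact hd r (by have := Finset.mem_range.1 hr; omega)
      · have := hm r (by have := Finset.mem_range.1 hr; omega)
        exact this.add (this.condFrom P _)
    have hZd : DependsOn Z (Set.Ici b) := by
      intro x y hxy
      simp only [hZ]
      congr 2
      · refine Finset.sum_congr rfl fun r hr => hdd r ?_ fun t ht => hxy t ?_
        · have := Finset.mem_range.1 hr; omega
        · have := Finset.mem_range.1 hr
          simp only [Set.mem_Ici] at ht ⊢; omega
      · refine Finset.sum_congr rfl fun r hr => ?_
        have := Finset.mem_range.1 hr
        congr 1
        · refine hmd r (by omega) fun t ht => hxy t ?_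
          simp only [Set.mem_Ici] at ht ⊢; omega
        · refine dependsOn_condFrom P (dependsOn_univ _) fun t ht => hxy t ?_
          simp only [Set.univ_inter, Set.mem_Ici] at ht ⊢; omega
    have hCb := hmR.condFrom P b
    have hCd : DependsOn (condFrom P b (m R)) (Set.Ici b) := fun x y hxy =>
      dependsOn_condFrom P (dependsOn_univ _) fun t ht => hxy t ht.2
    set h : (ℤ → E) → ℝ := fun e => Real.exp (Z e - l ^ 2 * condFrom P b (m R) e) with hh
    set g : (ℤ → E) → ℝ := fun e => Real.exp (l * d R e - l ^ 2 * m R e) with hg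
    have hhb : BddMeasurable h := (hZb.sub ((BddMeasurable.const _).mul hCb)).exp
    have hgb : BddMeasurable g :=
      (((BddMeasurable.const _).mul hdR).sub ((BddMeasurable.const _).mul hmR)).exp
    have hhd : DependsOn h (Set.Ici b) := fun x y hxy => by
      simp only [hh]; rw [hZd hxy, hCd hxy]
    have hgle : ∀ e, condFrom P b g e ≤ Real.exp (l ^ 2 * condFrom P b (m R) e) := by
      intro e
      have hb1 : BddMeasurable (fun e => l * d R e) := (BddMeasurable.const _).mul hdR
      have hb2 : BddMeasurable (fun e => -(1 + l ^ 2 * m R e)) :=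
        ((BddMeasurable.const 1).add ((BddMeasurable.const _).mul hmR)).neg
      have h1 := condFrom_mono P (a := b) hgb (hb1.sub hb2) (fun e => by
        have h2 := exp_sub_sq_le (l * d R e)
        have h3 := mul_le_mul_of_nonneg_left (hdm R (by omega) e) (sq_nonneg l)
        have h4 : g e ≤ Real.exp (l * d R e - (l * d R e) ^ 2) := by
          apply Real.exp_le_exp.2
          rw [mul_pow]; linarith
        rw [mul_pow] at h2 h4
        linarith) e
      rw [condFrom_sub P hb1 hb2] at h1
      have h5 : condFrom P b (fun e => l * d R e) e = 0 := by
        have := hmart R (by omega) e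
        unfold condFrom at this ⊢
        rw [integral_const_mul, this, mul_zero]
      have h6 : condFrom P b (fun e => -(1 + l ^ 2 * m R e)) e
          = -(1 + l ^ 2 * condFrom P b (m R) e) := by
        unfold condFrom
        rw [integral_neg, integral_add (integrable_const _), integral_const_mul]
        · simp
        · exact ((hmR.comp_splice_right _ e).integrable _).const_mul _
      rw [h5, h6] at h1
      linarith [Real.add_one_le_exp (l ^ 2 * condFrom P b (m R) e)]
    calc _ = ∫ e, h e * g e ∂(pathLaw P) := by
          refine integral_congr_ae (Filter.Eventually.of_forall fun e => ?_)
          simp only [hh, hg, hZ, Finset.sum_range_succ]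
          rw [← Real.exp_add]
          congr 1
          ring
      _ = ∫ e, h e * condFrom P b g e ∂(pathLaw P) :=
          integral_mul_eq_integral_mul_condFrom P hhb hgb hhd
      _ ≤ ∫ e, Real.exp (Z e) ∂(pathLaw P) := by
          refine integral_mono ((hhb.mul (hgb.condFrom P b)).integrable _)
            (hZb.exp.integrable _) fun e => ?_
          calc h e * condFrom P b g e
              ≤ h e * Real.exp (l ^ 2 * condFrom P b (m R) e) :=
                mul_le_mul_of_nonneg_left (hgle e) (Real.exp_nonneg _)
            _ = Real.exp (Z e) := by
                simp only [hh]; rw [← Real.exp_add]; congr 1; ring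
      _ ≤ 1 := ih'

/-- Maximal inequality for finitely many reverse martingales; only the second moments of the
maxima of the differences enter. -/
lemma integral_iSup_martingale_le {ι : Type*} [Fintype ι] [Nonempty ι]
    {d : ℕ → ι → (ℤ → E) → ℝ} (a : ℤ) (R : ℕ)
    (hd : ∀ r < R, ∀ f, BddMeasurable (d r f))
    (hdd : ∀ r < R, ∀ f, DependsOn (d r f) (Set.Ici (a - r)))
    (hmart : ∀ r < R, ∀ f e, condFrom P (a - r + 1) (d r f) e = 0) {l : ℝ} (hl : 0 < l) :
    ∫ e, ⨆ f, |∑ r ∈ Finset.range R, d r f e| ∂(pathLaw P)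
      ≤ Real.log (2 * Fintype.card ι) / l
        + l * (2 * ∑ r ∈ Finset.range R, ∫ e, ⨆ f, d r f e ^ 2 ∂(pathLaw P)) := by
  set m : ℕ → (ℤ → E) → ℝ := fun r e => ⨆ f, d r f e ^ 2 with hm
  have hmb : ∀ r < R, BddMeasurable (m r) := fun r hr =>
    BddMeasurable.iSup fun f => (hd r hr f).sq
  have hQb : ∀ r ∈ Finset.range R, BddMeasurable
      (fun e => m r e + condFrom P (a - r + 1) (m r) e) := fun r hr =>
    (hmb r (Finset.mem_range.1 hr)).add ((hmb r (Finset.mem_range.1 hr)).condFrom P _)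
  have h := integral_iSup_abs_le_of_exp (μ := pathLaw P) (l := l)
    (S := fun f e => ∑ r ∈ Finset.range R, d r f e)
    (Q := fun e => ∑ r ∈ Finset.range R, (m r e + condFrom P (a - r + 1) (m r) e)) hl
    (fun f => BddMeasurable.sum _ fun r hr => hd r (Finset.mem_range.1 hr) f)
    (BddMeasurable.sum _ hQb) (fun f l' hl' => by
      have := integral_exp_martingale_le P (d := fun r => d r f) (m := m) a R
        (fun r hr => hd r hr f) hmb (fun r hr => hdd r hr f)
        (fun r hr x y hxy => by simp only [hm]; simp_rw [hdd r hr _ hxy])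
        (fun r hr e => le_iSup_of_finite (fun f => d r f e ^ 2) f)
        (fun r hr => hmart r hr f) l'
      rwa [hl'] at this)
  refine h.trans (le_of_eq ?_)
  congr 2
  rw [integral_finsetSum _ fun r hr => (hQb r hr).integrable _, Finset.mul_sum]
  refine Finset.sum_congr rfl fun r hr => ?_
  have hr' := hmb r (Finset.mem_range.1 hr)
  rw [integral_add (hr'.integrable _) ((hr'.condFrom P _).integrable _), integral_condFrom P hr']
  ring

/-- Bernstein-type maximal inequality for sums of independent, centred, bounded blocks. -/
lemma integral_iSup_blocks_le {ι : Type*} [Fintype ι] [Nonempty ι]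
    {Y : ℕ → ι → (ℤ → E) → ℝ} (t : ℕ → ℤ) (ht : Monotone t) (R : ℕ) {B v l : ℝ}
    (hY : ∀ c < R, ∀ f, BddMeasurable (Y c f))
    (hYd : ∀ c < R, ∀ f, DependsOn (Y c f) (Set.Ico (t c) (t (c + 1))))
    (hY0 : ∀ c < R, ∀ f, ∫ e, Y c f e ∂(pathLaw P) = 0)
    (hYB : ∀ c < R, ∀ f e, |Y c f e| ≤ B)
    (hv : ∀ f, ∑ c ∈ Finset.range R, ∫ e, Y c f e ^ 2 ∂(pathLaw P) ≤ v)
    (hl : 0 < l) (hlB : l * B ≤ 1) :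
    ∫ e, ⨆ f, |∑ c ∈ Finset.range R, Y c f e| ∂(pathLaw P)
      ≤ Real.log (2 * Fintype.card ι) / l + l * v := by
  have hexp : ∀ f (l' : ℝ), l' ^ 2 = l ^ 2 → ∀ R' ≤ R,
      ∫ e, Real.exp (l' * ∑ c ∈ Finset.range R', Y c f e) ∂(pathLaw P)
        ≤ Real.exp (l ^ 2 * ∑ c ∈ Finset.range R', ∫ e, Y c f e ^ 2 ∂(pathLaw P)) := by
    intro f l' hl' R' hR'
    induction R' with
    | zero => simp
    | succ R' ih =>
      have hYR := hY R' (by omega) f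
      have hg : BddMeasurable (fun e => Real.exp (l' * Y R' f e)) :=
        ((BddMeasurable.const _).mul hYR).exp
      have hh : BddMeasurable
          (fun e => Real.exp (l' * ∑ c ∈ Finset.range R', Y c f e)) :=
        ((BddMeasurable.const _).mul (BddMeasurable.sum _ fun c hc =>
          hY c (by have := Finset.mem_range.1 hc; omega) f)).exp
      have habs : |l'| = l := by
        rw [← abs_of_pos hl]; exact (sq_eq_sq_iff_abs_eq_abs _ _).1 hl'
      have hle : ∫ e, Real.exp (l' * Y R' f e) ∂(pathLaw P)
          ≤ Real.exp (l ^ 2 * ∫ e, Y R' f e ^ 2 ∂(pathLaw P)) := by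
        have h1 : ∫ e, Real.exp (l' * Y R' f e) ∂(pathLaw P)
            ≤ ∫ e, (1 + l' * Y R' f e + l ^ 2 * Y R' f e ^ 2) ∂(pathLaw P) := by
          refine integral_mono (hg.integrable _)
            ((((BddMeasurable.const 1).add ((BddMeasurable.const _).mul hYR)).add
              ((BddMeasurable.const _).mul hYR.sq)).integrable _) fun e => ?_
          have h2 : |l' * Y R' f e| ≤ 1 := by
            rw [abs_mul, habs]
            exact (mul_le_mul_of_nonneg_left (hYB R' (by omega) f e) hl.le).trans hlB
          have h3 := (abs_le.1 (Real.abs_exp_sub_one_sub_id_le h2)).2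
          rw [mul_pow, hl'] at h3
          dsimp only
          linarith
        rw [integral_add, integral_add, integral_const_mul, integral_const_mul,
          hY0 R' (by omega) f] at h1
        · simp only [integral_const, probReal_univ, smul_eq_mul, one_mul, mul_zero] at h1
          linarith [Real.add_one_le_exp (l ^ 2 * ∫ e, Y R' f e ^ 2 ∂(pathLaw P))]
        · exact integrable_const _
        · exact (hYR.integrable _).const_mul _
        · exact (integrable_const _).add ((hYR.integrable _).const_mul _)
        · exact (hYR.sq.integrable _).const_mul _
      have hsplit : ∫ e, Real.exp (l' * ∑ c ∈ Finset.range (R' + 1), Y c f e) ∂(pathLaw P)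
          = (∫ e, Real.exp (l' * Y R' f e) ∂(pathLaw P)) *
            ∫ e, Real.exp (l' * ∑ c ∈ Finset.range R', Y c f e) ∂(pathLaw P) := by
        rw [← integral_mul_of_dependsOn P (a := t R') hg hh]
        · refine integral_congr_ae (Filter.Eventually.of_forall fun e => ?_)
          simp only [Finset.sum_range_succ]
          rw [← Real.exp_add]; congr 1; ring
        · intro x y hxy
          have := hYd R' (by omega) f (x := x) (y := y) fun s hs => hxy s hs.1
          simp only [this]
        · intro x y hxy
          have : ∑ c ∈ Finset.range R', Y c f x = ∑ c ∈ Finset.range R', Y c f y := by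
            refine Finset.sum_congr rfl fun c hc => ?_
            have hc' := Finset.mem_range.1 hc
            refine hYd c (by omega) f fun s hs => hxy s ?_
            exact hs.2.trans_le (ht (by omega))
          simp only [this]
      rw [hsplit, Finset.sum_range_succ, mul_add, add_comm (l ^ 2 * _), Real.exp_add]
      exact mul_le_mul hle (ih (by omega)) (integral_nonneg fun e => (Real.exp_nonneg _))
        (Real.exp_nonneg _)
  have h := integral_iSup_abs_le_of_exp (μ := pathLaw P) (l := l)
    (S := fun f e => ∑ c ∈ Finset.range R, Y c f e) (Q := fun _ => v) hl
    (fun f => BddMeasurable.sum _ fun c hc => hY c (Finset.mem_range.1 hc) f)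
    (BddMeasurable.const v) (fun f l' hl' => by
      have h1 := hexp f l' hl' R le_rfl
      have h2 := h1.trans (Real.exp_le_exp.2 (mul_le_mul_of_nonneg_left (hv f) (sq_nonneg l)))
      simp_rw [Real.exp_sub, integral_div]
      exact (div_le_one (Real.exp_pos _)).2 h2)
  simpa using h

end Path

/-! ### Increments of the conditional expectation -/

section Increments

variable {E : Type*} [MeasurableSpace E] (P : Measure E) [IsProbabilityMeasure P]
  {a i : ℤ} {g : (ℤ → E) → ℝ}

/-- The projection difference of `g` at time `a`: the part of `g` explained by the innovation at
time `a` beyond the innovations at later times. -/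
noncomputable def diffFrom (P : Measure E) (a : ℤ) (g : (ℤ → E) → ℝ) (e : ℤ → E) : ℝ :=
  condFrom P a g e - condFrom P (a + 1) g e

lemma BddMeasurable.diffFrom (hg : BddMeasurable g) (a : ℤ) : BddMeasurable (diffFrom P a g) :=
  (hg.condFrom P a).sub (hg.condFrom P (a + 1))

omit [IsProbabilityMeasure P] in
lemma dependsOn_diffFrom (hg : DependsOn g (Set.Iic i)) :
    DependsOn (diffFrom P a g) (Set.Icc a i) := by
  intro x y hxy
  unfold diffFrom
  congr 1
  · exact dependsOn_condFrom P hg fun t ht => hxy t ⟨ht.2, ht.1⟩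
  · refine dependsOn_condFrom P hg fun t ht => hxy t ⟨?_, ht.1⟩
    have := ht.2
    simp only [Set.mem_Ici] at this
    omega

omit [IsProbabilityMeasure P] in
lemma dependsOn_diffFrom_Ici : DependsOn (diffFrom P a g) (Set.Ici a) := by
  intro x y hxy
  unfold diffFrom
  congr 1
  · exact dependsOn_condFrom P (dependsOn_univ g) fun t ht => hxy t ht.2
  · refine dependsOn_condFrom P (dependsOn_univ g) fun t ht => hxy t ?_
    have := ht.2
    simp only [Set.mem_Ici] at this ⊢
    omega

lemma condFrom_diffFrom (hg : BddMeasurable g) (e : ℤ → E) :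
    condFrom P (a + 1) (diffFrom P a g) e = 0 := by
  unfold diffFrom
  rw [condFrom_sub P (hg.condFrom P _) (hg.condFrom P _),
    condFrom_condFrom_of_le P hg (by omega), condFrom_condFrom_of_le P hg le_rfl, sub_self]

/-- Projection differences are `L²`-contractions. -/
lemma integral_sq_diffFrom_le (hg : BddMeasurable g) :
    ∫ e, diffFrom P a g e ^ 2 ∂(pathLaw P) ≤ ∫ e, g e ^ 2 ∂(pathLaw P) := by
  set u := condFrom P a g with hu
  set v := condFrom P (a + 1) g with hv
  have hub : BddMeasurable u := hg.condFrom P a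
  have hvb : BddMeasurable v := hg.condFrom P (a + 1)
  have hvd : DependsOn v (Set.Ici (a + 1)) := fun x y hxy =>
    dependsOn_condFrom P (dependsOn_univ g) fun t ht => hxy t ht.2
  have h1 : ∫ e, v e * u e ∂(pathLaw P) = ∫ e, v e * v e ∂(pathLaw P) := by
    rw [integral_mul_eq_integral_mul_condFrom P hvb hub hvd]
    simp_rw [hu, condFrom_condFrom_of_le P hg (show a ≤ a + 1 by omega)]
    rfl
  have h2 : ∫ e, diffFrom P a g e ^ 2 ∂(pathLaw P)
      = ∫ e, u e ^ 2 ∂(pathLaw P) - ∫ e, v e * v e ∂(pathLaw P) := by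
    have h3 : ∀ e, diffFrom P a g e ^ 2 = u e ^ 2 - (2 * (v e * u e) - v e * v e) := fun e => by
      simp only [diffFrom, hu, hv]; ring
    simp_rw [h3]
    have hvu : BddMeasurable (fun e => 2 * (v e * u e)) :=
      (BddMeasurable.const 2).mul (hvb.mul hub)
    rw [integral_sub (hub.sq.integrable _) ((hvu.sub (hvb.mul hvb)).integrable _),
      integral_sub (hvu.integrable _) ((hvb.mul hvb).integrable _), integral_const_mul, h1]
    ring
  have h4 : ∫ e, u e ^ 2 ∂(pathLaw P) ≤ ∫ e, g e ^ 2 ∂(pathLaw P) := by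
    rw [← integral_condFrom P hg.sq a]
    exact integral_mono (hub.sq.integrable _) ((hg.sq.condFrom P a).integrable _)
      fun e => sq_condFrom_le P hg e
  have h5 : 0 ≤ ∫ e, v e * v e ∂(pathLaw P) := integral_nonneg fun e => mul_self_nonneg _
  linarith

/-- The maximum of the projection differences at time `a` is controlled in `L²` by the effect of
resampling the innovation at time `a`. -/
lemma integral_iSup_sq_diffFrom_le {ι : Type*} [Finite ι] [Nonempty ι]
    {g : ι → (ℤ → E) → ℝ} (hg : ∀ f, BddMeasurable (g f)) (a : ℤ) :
    ∫ e, ⨆ f, diffFrom P a (g f) e ^ 2 ∂(pathLaw P)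
      ≤ ∫ w : (ℤ → E) × (ℤ → E), ⨆ f, (g f w.1 - g f (splice {a}ᶜ w.1 w.2)) ^ 2
          ∂((pathLaw P).prod (pathLaw P)) := by
  set G : (ℤ → E) × (ℤ → E) → ℝ := fun w => ⨆ f, (g f w.1 - g f (splice {a}ᶜ w.1 w.2)) ^ 2
  have hG : BddMeasurable G := BddMeasurable.iSup fun f =>
    (((hg f).comp measurable_fst).sub ((hg f).comp_splice _)).sq
  set T : (ℤ → E) × (ℤ → E) → (ℤ → E) × (ℤ → E) :=
    fun w => (splice (Set.Ici a) w.1 w.2, splice (Set.Ici a) w.2 w.1) with hT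
  have hTp := measurePreserving_spliceSwap P (Set.Ici a)
  have hGT : BddMeasurable (fun w => G (T w)) := hG.comp hTp.measurable
  have hkey : ∀ w : (ℤ → E) × (ℤ → E), splice {a}ᶜ (T w).1 (T w).2
      = splice (Set.Ici (a + 1)) w.1 w.2 := by
    intro w
    funext t
    rcases lt_trichotomy t a with h | h | h
    · have h1 : ¬ a ≤ t := by omega
      have h2 : ¬ a + 1 ≤ t := by omega
      simp [splice, hT, h.ne, h1, h2]
    · subst h
      simp [splice, hT]
    · have h1 : a ≤ t := by omega
      have h2 : a + 1 ≤ t := by omega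
      simp [splice, hT, h.ne', h1, h2]
  have hpt : ∀ e, ⨆ f, diffFrom P a (g f) e ^ 2 ≤ ∫ e', G (T (e, e')) ∂(pathLaw P) := by
    intro e
    refine ciSup_le fun f => ?_
    have hb1 := (hg f).comp_splice_right (Set.Ici a) e
    have hb2 := (hg f).comp_splice_right (Set.Ici (a + 1)) e
    have h1 : diffFrom P a (g f) e = ∫ e', (g f (splice (Set.Ici a) e e')
        - g f (splice (Set.Ici (a + 1)) e e')) ∂(pathLaw P) :=
      (integral_sub (hb1.integrable _) (hb2.integrable _)).symm
    rw [h1]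
    refine ((hb1.sub hb2).sq_integral_le _).trans ?_
    have hGe : BddMeasurable (fun e' => G (T (e, e'))) :=
      hGT.comp (measurable_prodMk_left (x := e))
    refine integral_mono ((hb1.sub hb2).sq.integrable _) (hGe.integrable _) fun e' => ?_
    have h2 : (g f (T (e, e')).1 - g f (splice {a}ᶜ (T (e, e')).1 (T (e, e')).2)) ^ 2
        ≤ G (T (e, e')) := le_iSup_of_finite
      (fun f => (g f (T (e, e')).1 - g f (splice {a}ᶜ (T (e, e')).1 (T (e, e')).2)) ^ 2) f
    rw [hkey] at h2
    exact h2
  have hsup : BddMeasurable (fun e => ⨆ f, diffFrom P a (g f) e ^ 2) :=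
    BddMeasurable.iSup fun f => ((hg f).diffFrom P a).sq
  calc ∫ e, ⨆ f, diffFrom P a (g f) e ^ 2 ∂(pathLaw P)
      ≤ ∫ e, ∫ e', G (T (e, e')) ∂(pathLaw P) ∂(pathLaw P) :=
        integral_mono (hsup.integrable _) ((hGT.integral_prod _).integrable _) hpt
    _ = ∫ w, G (T w) ∂((pathLaw P).prod (pathLaw P)) :=
        (integral_prod _ (hGT.integrable _)).symm
    _ = ∫ w, G w ∂((pathLaw P).prod (pathLaw P)) := by
        conv_rhs => rw [← hTp.map_eq]
        rw [integral_map hTp.measurable.aemeasurable hG.measurable.aestronglyMeasurable]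

lemma integral_sq_diffFrom_le_resample (hg : BddMeasurable g) (a : ℤ) :
    ∫ e, diffFrom P a g e ^ 2 ∂(pathLaw P)
      ≤ ∫ w : (ℤ → E) × (ℤ → E), (g w.1 - g (splice {a}ᶜ w.1 w.2)) ^ 2
          ∂((pathLaw P).prod (pathLaw P)) := by
  simpa using integral_iSup_sq_diffFrom_le P (g := fun _ : Unit => g) (fun _ => hg) a

lemma integral_diffFrom_mul_of_lt {b : ℤ} {g h : (ℤ → E) → ℝ} (hg : BddMeasurable g)
    (hh : BddMeasurable h) (hab : a < b) :
    ∫ e, diffFrom P b h e * diffFrom P a g e ∂(pathLaw P) = 0 := by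
  rw [integral_mul_eq_integral_mul_condFrom P (a := a + 1) (hh.diffFrom P b) (hg.diffFrom P a)]
  · simp_rw [condFrom_diffFrom P hg]; simp
  · intro x y hxy
    exact dependsOn_diffFrom_Ici P fun t ht => hxy t (by
      simp only [Set.mem_Ici] at ht ⊢; omega)

/-- Projection differences at a fixed lag are orthogonal. -/
lemma integral_sq_sum_diffFrom {g : ℕ → (ℤ → E) → ℝ} (k : ℤ) (s : Finset ℕ)
    (hg : ∀ i ∈ s, BddMeasurable (g i)) :
    ∫ e, (∑ i ∈ s, diffFrom P (i - k) (g i) e) ^ 2 ∂(pathLaw P)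
      = ∑ i ∈ s, ∫ e, diffFrom P (i - k) (g i) e ^ 2 ∂(pathLaw P) := by
  have hb : ∀ i ∈ s, ∀ j ∈ s, BddMeasurable
      (fun e => diffFrom P (i - k) (g i) e * diffFrom P (j - k) (g j) e) := fun i hi j hj =>
    ((hg i hi).diffFrom P _).mul ((hg j hj).diffFrom P _)
  simp_rw [pow_two, Finset.sum_mul_sum]
  rw [integral_finsetSum _ fun i hi => (BddMeasurable.sum _ (hb i hi)).integrable _]
  refine Finset.sum_congr rfl fun i hi => ?_
  rw [integral_finsetSum _ fun j hj => (hb i hi j hj).integrable _]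
  refine Finset.sum_eq_single_of_mem i hi fun j hj hji => ?_
  rcases lt_or_gt_of_ne hji with h | h
  · exact integral_diffFrom_mul_of_lt P (hg j hj) (hg i hi) (by omega)
  · simp_rw [mul_comm (diffFrom P (i - k) (g i) _)]
    exact integral_diffFrom_mul_of_lt P (hg i hi) (hg j hj) (by omega)

omit [IsProbabilityMeasure P] in
lemma condFrom_eq_integral_add_sum (hd : DependsOn g (Set.Iic i)) (N : ℕ) (e : ℤ → E) :
    condFrom P (i - N) g e = ∫ e', g e' ∂(pathLaw P)
      + ∑ k ∈ Finset.range (N + 1), diffFrom P (i - k) g e := by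
  have h0 : condFrom P (i + 1) g e = ∫ e', g e' ∂(pathLaw P) := by
    refine condFrom_of_dependsOn_Iio P (fun x y hxy => hd fun t ht => hxy t ?_) e
    simp only [Set.mem_Iic, Set.mem_Iio] at ht ⊢
    omega
  induction N with
  | zero => simp [diffFrom, h0]
  | succ N ih =>
    rw [Finset.sum_range_succ, ← add_assoc, ← ih]
    have : (i - (N + 1 : ℕ) + 1 : ℤ) = i - N := by push_cast; ring
    simp only [diffFrom]
    rw [this]
    ring

lemma integral_diffFrom (hg : BddMeasurable g) : ∫ e, diffFrom P a g e ∂(pathLaw P) = 0 := by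
  unfold diffFrom
  rw [integral_sub ((hg.condFrom P _).integrable _) ((hg.condFrom P _).integrable _),
    integral_condFrom P hg, integral_condFrom P hg, sub_self]

end Increments

/-! ### Expected maxima -/

section ExpMax

variable {α ι : Type*} [MeasurableSpace α] (μ : Measure α)

/-- The expected maximum `E max_f |S f|` of a finite family. -/
noncomputable def expMax (S : ι → α → ℝ) : ℝ := ∫ x, ⨆ f, |S f x| ∂μ

variable [Fintype ι] [IsProbabilityMeasure μ] [Nonempty ι] {S T : ι → α → ℝ}

lemma expMax_add_le (hS : ∀ f, BddMeasurable (S f)) (hT : ∀ f, BddMeasurable (T f)) :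
    expMax μ (fun f x => S f x + T f x) ≤ expMax μ S + expMax μ T := by
  have h1 : BddMeasurable (fun x => ⨆ f, |S f x|) := BddMeasurable.iSup fun f => (hS f).abs
  have h2 : BddMeasurable (fun x => ⨆ f, |T f x|) := BddMeasurable.iSup fun f => (hT f).abs
  have h3 : BddMeasurable (fun x => ⨆ f, |S f x + T f x|) :=
    BddMeasurable.iSup fun f => ((hS f).add (hT f)).abs
  unfold expMax
  rw [← integral_add (h1.integrable _) (h2.integrable _)]
  exact integral_mono (h3.integrable _) ((h1.add h2).integrable _) fun x =>
    ciSup_le fun f => (abs_add_le _ _).trans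
      (add_le_add (le_iSup_of_finite (fun f => |S f x|) f) (le_iSup_of_finite (fun f => |T f x|) f))

omit [Fintype ι] [IsProbabilityMeasure μ] [Nonempty ι] in
lemma expMax_zero : expMax μ (fun (_ : ι) (_ : α) => (0 : ℝ)) = 0 := by
  simp [expMax]

lemma expMax_sum_le {κ : Type*} (s : Finset κ) {S : κ → ι → α → ℝ}
    (hS : ∀ k ∈ s, ∀ f, BddMeasurable (S k f)) :
    expMax μ (fun f x => ∑ k ∈ s, S k f x) ≤ ∑ k ∈ s, expMax μ (S k) := by
  classical
  induction s using Finset.induction_on with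
  | empty => simp [expMax_zero]
  | insert k s hk ih =>
    simp only [Finset.sum_insert hk]
    exact (expMax_add_le μ (hS k (Finset.mem_insert_self _ _))
      fun f => BddMeasurable.sum _ fun j hj => hS j (Finset.mem_insert_of_mem hj) f).trans
      (add_le_add le_rfl (ih fun j hj => hS j (Finset.mem_insert_of_mem hj)))

lemma expMax_le_sum (hS : ∀ f, BddMeasurable (S f)) :
    expMax μ S ≤ ∑ f, ∫ x, |S f x| ∂μ := by
  unfold expMax
  rw [← integral_finsetSum _ fun f _ => (hS f).abs.integrable μ]
  exact integral_mono ((BddMeasurable.iSup fun f => (hS f).abs).integrable _)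
    ((BddMeasurable.sum _ fun f _ => (hS f).abs).integrable _) fun x => ciSup_le fun f =>
      Finset.single_le_sum (f := fun f => |S f x|) (fun _ _ => abs_nonneg _) (Finset.mem_univ f)

end ExpMax

/-! ### The maximal inequality for bounded functionals -/

section MaximalInequality

variable {E ι : Type*} [MeasurableSpace E] (P : Measure E) [IsProbabilityMeasure P]
  [Fintype ι] [Nonempty ι]

/-- Optimising over the free parameter `l`. -/
lemma le_of_forall_div_add_mul {x H w : ℝ} (hH : 0 < H) (hw : 0 ≤ w)
    (h : ∀ l : ℝ, 0 < l → x ≤ 2 * H / l + l * (2 * w ^ 2)) : x ≤ 4 * Real.sqrt H * w := by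
  rcases hw.eq_or_lt with rfl | hw
  · rw [mul_zero]
    refine le_of_forall_pos_le_add fun δ hδ => ?_
    have h1 := h (2 * H / δ) (by positivity)
    have h2 : 2 * H / (2 * H / δ) = δ := by field_simp
    rw [h2] at h1
    linarith
  · have hs : 0 < Real.sqrt H := Real.sqrt_pos.2 hH
    have h1 := h (Real.sqrt H / w) (by positivity)
    have h2 : 2 * H / (Real.sqrt H / w) + Real.sqrt H / w * (2 * w ^ 2)
        = 4 * Real.sqrt H * w := by
      have h3 : H = Real.sqrt H * Real.sqrt H := (Real.mul_self_sqrt hH.le).symm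
      have h4 : 2 * H / (Real.sqrt H / w) = 2 * Real.sqrt H * w := by
        rw [div_div_eq_mul_div, div_eq_iff hs.ne']
        linear_combination (2 * w) * h3
      have h5 : Real.sqrt H / w * (2 * w ^ 2) = 2 * Real.sqrt H * w := by
        field_simp
      rw [h4, h5]; ring
    linarith

/-- The projection differences at one lag. -/
lemma expMax_sum_diffFrom_le (n k : ℕ) {g : ℕ → ι → (ℤ → E) → ℝ}
    (hg : ∀ i ∈ Finset.Icc 1 n, ∀ f, BddMeasurable (g i f)) {H w : ℝ}
    (hH : 1 ≤ H) (hcard : Real.log (2 * Fintype.card ι) ≤ 2 * H) (hw : 0 ≤ w)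
    (hres : ∑ i ∈ Finset.Icc 1 n, ∫ x : (ℤ → E) × (ℤ → E), ⨆ f, (g i f x.1
      - g i f (splice {(i : ℤ) - (k : ℤ)}ᶜ x.1 x.2)) ^ 2 ∂((pathLaw P).prod (pathLaw P)) ≤ w ^ 2) :
    expMax (pathLaw P) (fun f e => ∑ i ∈ Finset.Icc 1 n,
      diffFrom P ((i : ℤ) - (k : ℤ)) (g i f) e) ≤ 4 * Real.sqrt H * w := by
  refine le_of_forall_div_add_mul (by linarith) hw fun l hl => ?_
  have hreidx : ∀ φ : ℕ → ℝ, ∑ i ∈ Finset.Icc 1 n, φ i = ∑ r ∈ Finset.range n, φ (n - r) := by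
    intro φ
    refine Finset.sum_nbij' (fun i => n - i) (fun r => n - r) ?_ ?_ ?_ ?_ ?_
    all_goals intro i hi
    all_goals simp only [Finset.mem_Icc, Finset.mem_range] at *
    · omega
    · omega
    · omega
    · omega
    · congr 1; omega
  have hmem : ∀ r < n, n - r ∈ Finset.Icc 1 n := fun r hr => by
    simp only [Finset.mem_Icc]; omega
  have hcast : ∀ r < n, ((n - r : ℕ) : ℤ) - (k : ℤ) = (n : ℤ) - k - r := fun r hr => by omega
  have h := integral_iSup_martingale_le P (ι := ι)
    (d := fun r f => diffFrom P (((n - r : ℕ) : ℤ) - (k : ℤ)) (g (n - r) f))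
    ((n : ℤ) - k) n (fun r hr f => (hg _ (hmem r hr) f).diffFrom P _)
    (fun r hr f => by rw [hcast r hr]; exact dependsOn_diffFrom_Ici P)
    (fun r hr f e => by rw [hcast r hr]; exact condFrom_diffFrom P (hg _ (hmem r hr) f) e) hl
  unfold expMax
  simp_rw [hreidx]
  refine h.trans (add_le_add (div_le_div_of_nonneg_right hcard hl.le) ?_)
  refine mul_le_mul_of_nonneg_left (mul_le_mul_of_nonneg_left ?_ (by norm_num)) hl.le
  refine le_trans ?_ hres
  rw [hreidx]
  exact Finset.sum_le_sum fun r hr => integral_iSup_sq_diffFrom_le P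
    (hg _ (hmem r (Finset.mem_range.1 hr))) _

/-- The remote past: replacing every functional by its conditional expectation given the last
`q` innovations costs only the tail of the dependence coefficients. -/
lemma expMax_sub_condFrom_le (n q : ℕ) {g : ℕ → ι → (ℤ → E) → ℝ}
    (hg : ∀ i ∈ Finset.Icc 1 n, ∀ f, BddMeasurable (g i f))
    (hgd : ∀ i ∈ Finset.Icc 1 n, ∀ f, DependsOn (g i f) (Set.Iic (i : ℤ)))
    {H W : ℝ} {w : ℕ → ℝ}
    (hH : 1 ≤ H) (hcard : Real.log (2 * Fintype.card ι) ≤ 2 * H) (hw : ∀ k, 0 ≤ w k)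
    (hres : ∀ k : ℕ, ∑ i ∈ Finset.Icc 1 n, ∫ x : (ℤ → E) × (ℤ → E), ⨆ f, (g i f x.1
      - g i f (splice {(i : ℤ) - (k : ℤ)}ᶜ x.1 x.2)) ^ 2
        ∂((pathLaw P).prod (pathLaw P)) ≤ w k ^ 2)
    (hW : ∀ N, ∑ k ∈ Finset.Ico (q + 1) N, w k ≤ W) :
    expMax (pathLaw P) (fun f e => ∑ i ∈ Finset.Icc 1 n,
      (g i f e - condFrom P ((i : ℤ) - (q : ℤ)) (g i f) e)) ≤ 4 * Real.sqrt H * W := by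
  have hN : ∀ N, q ≤ N → expMax (pathLaw P) (fun f e => ∑ i ∈ Finset.Icc 1 n,
      (g i f e - condFrom P ((i : ℤ) - (q : ℤ)) (g i f) e)) ≤ 4 * Real.sqrt H * W
        + ∑ f, ∑ i ∈ Finset.Icc 1 n,
          ∫ e, |g i f e - condFrom P ((i : ℤ) - (N : ℤ)) (g i f) e| ∂(pathLaw P) := by
    intro N hqN
    have hsplit : (fun f e => ∑ i ∈ Finset.Icc 1 n,
        (g i f e - condFrom P ((i : ℤ) - (q : ℤ)) (g i f) e)) = fun f e =>
        (∑ k ∈ Finset.Ico (q + 1) (N + 1), ∑ i ∈ Finset.Icc 1 n,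
          diffFrom P ((i : ℤ) - (k : ℤ)) (g i f) e) + ∑ i ∈ Finset.Icc 1 n,
          (g i f e - condFrom P ((i : ℤ) - (N : ℤ)) (g i f) e) := by
      funext f e
      rw [Finset.sum_comm, ← Finset.sum_add_distrib]
      refine Finset.sum_congr rfl fun i hi => ?_
      rw [condFrom_eq_integral_add_sum P (hgd i hi f), condFrom_eq_integral_add_sum P (hgd i hi f),
        Finset.sum_Ico_eq_sub _ (show q + 1 ≤ N + 1 by omega)]
      ring
    have hd : ∀ k ∈ Finset.Ico (q + 1) (N + 1), ∀ f, BddMeasurable (fun e =>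
        ∑ i ∈ Finset.Icc 1 n, diffFrom P ((i : ℤ) - (k : ℤ)) (g i f) e) := fun k _ f =>
      BddMeasurable.sum _ fun i hi => (hg i hi f).diffFrom P _
    have hr : ∀ f, BddMeasurable (fun e => ∑ i ∈ Finset.Icc 1 n,
        (g i f e - condFrom P ((i : ℤ) - (N : ℤ)) (g i f) e)) := fun f =>
      BddMeasurable.sum _ fun i hi => (hg i hi f).sub ((hg i hi f).condFrom P _)
    rw [hsplit]
    refine (expMax_add_le _ (fun f => BddMeasurable.sum _ fun k hk => hd k hk f) hr).trans
      (add_le_add ?_ ?_)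
    · refine (expMax_sum_le _ _ hd).trans ?_
      calc _ ≤ ∑ k ∈ Finset.Ico (q + 1) (N + 1), 4 * Real.sqrt H * w k :=
            Finset.sum_le_sum fun k _ =>
              expMax_sum_diffFrom_le P n k hg hH hcard (hw k) (hres k)
        _ ≤ 4 * Real.sqrt H * W := by
            rw [← Finset.mul_sum]
            exact mul_le_mul_of_nonneg_left (hW _) (by positivity)
    · refine (expMax_le_sum _ hr).trans (Finset.sum_le_sum fun f _ => ?_)
      rw [← integral_finsetSum _ fun i hi =>
        ((hg i hi f).sub ((hg i hi f).condFrom P _)).abs.integrable _]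
      exact integral_mono ((hr f).abs.integrable _) ((BddMeasurable.sum _ fun i hi =>
        ((hg i hi f).sub ((hg i hi f).condFrom P _)).abs).integrable _) fun e =>
          Finset.abs_sum_le_sum_abs _ _
  have hlim : Filter.Tendsto (fun N : ℕ => 4 * Real.sqrt H * W
      + ∑ f, ∑ i ∈ Finset.Icc 1 n,
          ∫ e, |g i f e - condFrom P ((i : ℤ) - (N : ℤ)) (g i f) e| ∂(pathLaw P))
      Filter.atTop (nhds (4 * Real.sqrt H * W + ∑ _f : ι, ∑ _i ∈ Finset.Icc 1 n, 0)) :=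
    tendsto_const_nhds.add (tendsto_finsetSum _ fun f _ => tendsto_finsetSum _ fun i hi =>
      tendsto_integral_abs_sub_condFrom P (hg i hi f) _)
  have := ge_of_tendsto hlim (Filter.eventually_atTop.2 ⟨q, hN⟩)
  simpa using this

/-- The block `c` of parity `ρ` when `1, …, n` is cut into consecutive blocks of length `q`. -/
def block (n q ρ c : ℕ) : Finset ℕ :=
  ((Finset.Icc 1 n).filter (fun i => (i - 1) / q % 2 = ρ)).filter (fun i => (i - 1) / q / 2 = c)

lemma sum_block_eq (n q ρ : ℕ) (φ : ℕ → ℝ) :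
    ∑ c ∈ Finset.range n, ∑ i ∈ block n q ρ c, φ i
      = ∑ i ∈ (Finset.Icc 1 n).filter (fun i => (i - 1) / q % 2 = ρ), φ i := by
  refine Finset.sum_fiberwise_of_maps_to (fun i hi => ?_) _
  have h1 := Finset.mem_Icc.1 (Finset.mem_filter.1 hi).1
  have h2 : (i - 1) / q / 2 ≤ i - 1 := (Nat.div_le_self _ _).trans (Nat.div_le_self _ _)
  simp only [Finset.mem_range]
  omega

lemma sum_sum_block_eq (n q : ℕ) (φ : ℕ → ℝ) :
    ∑ ρ ∈ Finset.range 2, ∑ c ∈ Finset.range n, ∑ i ∈ block n q ρ c, φ i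
      = ∑ i ∈ Finset.Icc 1 n, φ i := by
  simp_rw [sum_block_eq]
  exact Finset.sum_fiberwise_of_maps_to
    (fun i _ => Finset.mem_range.2 (Nat.mod_lt _ (by norm_num))) _

lemma mem_block {n q ρ c i : ℕ} (hq : 1 ≤ q) (h : i ∈ block n q ρ c) :
    i ∈ Finset.Icc 1 n ∧ (2 * c + ρ) * q + 1 ≤ i ∧ i ≤ (2 * c + ρ) * q + q := by
  simp only [block, Finset.mem_filter] at h
  obtain ⟨⟨h1, h2⟩, h3⟩ := h
  refine ⟨h1, ?_⟩
  have h4 : (i - 1) / q = 2 * c + ρ := by omega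
  have h5 := Nat.div_mul_le_self (i - 1) q
  have h6 := Nat.lt_div_mul_add (a := i - 1) (show 0 < q by omega)
  rw [h4] at h5 h6
  have := (Finset.mem_Icc.1 h1).1
  omega

lemma card_block_le {n q ρ c : ℕ} (hq : 1 ≤ q) : (block n q ρ c).card ≤ q := by
  have : block n q ρ c ⊆ Finset.Ioc ((2 * c + ρ) * q) ((2 * c + ρ) * q + q) := fun i hi => by
    have := mem_block hq hi
    simp only [Finset.mem_Ioc]; omega
  simpa using Finset.card_le_card this

/-- The recent past: conditional expectations given the last `q` innovations are summed over
blocks of length `q`; blocks of equal parity are independent. -/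
lemma expMax_condFrom_sub_integral_le (n q : ℕ) (hq : 1 ≤ q) {g : ℕ → ι → (ℤ → E) → ℝ} {M : ℝ}
    (hM : 0 ≤ M)
    (hg : ∀ i ∈ Finset.Icc 1 n, ∀ f, BddMeasurable (g i f))
    (hgM : ∀ i ∈ Finset.Icc 1 n, ∀ f e, |g i f e| ≤ M)
    (hgd : ∀ i ∈ Finset.Icc 1 n, ∀ f, DependsOn (g i f) (Set.Iic (i : ℤ)))
    {H s : ℝ} {c : ι → ℕ → ℝ} (hH : 1 ≤ H) (hcard : Real.log (2 * Fintype.card ι) ≤ 2 * H)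
    (hc : ∀ f k, 0 ≤ c f k) (hs : 0 < s)
    (hdiff : ∀ f, ∀ k ≤ q, ∑ i ∈ Finset.Icc 1 n,
      ∫ e, diffFrom P ((i : ℤ) - (k : ℤ)) (g i f) e ^ 2 ∂(pathLaw P) ≤ c f k ^ 2)
    (hcs : ∀ f, ∑ k ∈ Finset.range (q + 1), c f k ≤ s) :
    expMax (pathLaw P) (fun f e => ∑ i ∈ Finset.Icc 1 n,
      (condFrom P ((i : ℤ) - (q : ℤ)) (g i f) e - ∫ e', g i f e' ∂(pathLaw P)))
      ≤ 8 * (H * M * q) + 12 * Real.sqrt H * s := by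
  set T : ℕ → ι → (ℤ → E) → ℝ := fun i f e =>
    ∑ k ∈ Finset.range (q + 1), diffFrom P ((i : ℤ) - (k : ℤ)) (g i f) e with hT
  have hTeq : ∀ i ∈ Finset.Icc 1 n, ∀ f e, condFrom P ((i : ℤ) - (q : ℤ)) (g i f) e
      - ∫ e', g i f e' ∂(pathLaw P) = T i f e := fun i hi f e => by
    rw [condFrom_eq_integral_add_sum P (hgd i hi f)]; simp [hT]
  have hdb : ∀ i ∈ Finset.Icc 1 n, ∀ f (k : ℕ),
      BddMeasurable (diffFrom P ((i : ℤ) - (k : ℤ)) (g i f)) :=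
    fun i hi f k => (hg i hi f).diffFrom P _
  have hTb : ∀ i ∈ Finset.Icc 1 n, ∀ f, BddMeasurable (T i f) := fun i hi f =>
    BddMeasurable.sum _ fun k _ => hdb i hi f k
  have hTM : ∀ i ∈ Finset.Icc 1 n, ∀ f e, |T i f e| ≤ 2 * M := by
    intro i hi f e
    rw [← hTeq i hi f e]
    have h1 := abs_condFrom_le P (a := (i : ℤ) - (q : ℤ)) (hgM i hi f) e
    have h2 : |∫ e', g i f e' ∂(pathLaw P)| ≤ M := by
      have := norm_integral_le_of_norm_le_const (μ := pathLaw P) (f := g i f) (C := M)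
        (Filter.Eventually.of_forall (hgM i hi f))
      simpa using this
    exact (abs_sub _ _).trans (by linarith)
  have hT0 : ∀ i ∈ Finset.Icc 1 n, ∀ f, ∫ e, T i f e ∂(pathLaw P) = 0 := by
    intro i hi f
    simp only [hT]
    rw [integral_finsetSum _ fun k _ => (hdb i hi f k).integrable _]
    exact Finset.sum_eq_zero fun k _ => integral_diffFrom P (hg i hi f)
  have hTd : ∀ i ∈ Finset.Icc 1 n, ∀ f, DependsOn (T i f) (Set.Icc ((i : ℤ) - q) i) := by
    intro i hi f x y hxy
    refine Finset.sum_congr rfl fun k hk => dependsOn_diffFrom P (hgd i hi f) fun t ht => hxy t ?_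
    have := Finset.mem_range.1 hk
    simp only [Set.mem_Icc] at ht ⊢
    omega
  have hsH : 0 < Real.sqrt H := Real.sqrt_pos.2 (by linarith)
  set l : ℝ := (2 * M * q + s / Real.sqrt H)⁻¹ with hl
  have hden : 0 < 2 * M * q + s / Real.sqrt H := by positivity
  have hlpos : 0 < l := inv_pos.2 hden
  have hbd : ∀ ρ c i, i ∈ block n q ρ c → i ∈ Finset.Icc 1 n := fun ρ c i hi =>
    (mem_block hq hi).1
  -- the variances of the blocks, by a weighted Cauchy–Schwarz inequality over the lags
  have hvar : ∀ ρ f, ∑ b ∈ Finset.range n,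
      ∫ e, (∑ i ∈ block n q ρ b, T i f e) ^ 2 ∂(pathLaw P) ≤ (2 * s) ^ 2 := by
    intro ρ f
    set c' : ℕ → ℝ := fun k => c f k + s / (q + 1) with hc'
    have hc'pos : ∀ k, 0 < c' k := fun k => by
      have := hc f k
      have : 0 < s / (q + 1) := by positivity
      simp only [hc']; linarith
    have hc'sum : ∑ k ∈ Finset.range (q + 1), c' k ≤ 2 * s := by
      simp only [hc', Finset.sum_add_distrib, Finset.sum_const, Finset.card_range, nsmul_eq_mul]
      have : ((q + 1 : ℕ) : ℝ) * (s / (q + 1)) = s := by push_cast; field_simp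
      linarith [hcs f]
    have hc'0 : 0 ≤ ∑ k ∈ Finset.range (q + 1), c' k :=
      Finset.sum_nonneg fun k _ => (hc'pos k).le
    have hone : ∀ b, ∫ e, (∑ i ∈ block n q ρ b, T i f e) ^ 2 ∂(pathLaw P)
        ≤ (∑ k ∈ Finset.range (q + 1), c' k) * ∑ k ∈ Finset.range (q + 1),
          (∑ i ∈ block n q ρ b, ∫ e, diffFrom P ((i : ℤ) - (k : ℤ)) (g i f) e ^ 2 ∂(pathLaw P))
            / c' k := by
      intro b
      set y : ℕ → (ℤ → E) → ℝ := fun k e =>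
        ∑ i ∈ block n q ρ b, diffFrom P ((i : ℤ) - (k : ℤ)) (g i f) e with hy
      have hyb : ∀ k, BddMeasurable (y k) := fun k =>
        BddMeasurable.sum _ fun i hi => hdb i (hbd _ _ _ hi) f k
      have hyd : ∀ k, BddMeasurable (fun e => y k e ^ 2 / c' k) := fun k => by
        simp only [div_eq_mul_inv]
        exact (hyb k).sq.mul (BddMeasurable.const _)
      have h1 : ∀ e, (∑ i ∈ block n q ρ b, T i f e) ^ 2
          ≤ (∑ k ∈ Finset.range (q + 1), c' k) * ∑ k ∈ Finset.range (q + 1), y k e ^ 2 / c' k := by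
        intro e
        simp only [hT]
        rw [Finset.sum_comm]
        refine Finset.sum_sq_le_sum_mul_sum_of_sq_le_mul _ (fun k _ => (hc'pos k).le)
          (fun k _ => div_nonneg (sq_nonneg _) (hc'pos k).le) fun k _ => le_of_eq ?_
        have := (hc'pos k).ne'
        field_simp
        rfl
      have h2 := integral_mono (((BddMeasurable.sum (block n q ρ b) fun i hi =>
          hTb i (hbd _ _ _ hi) f).sq).integrable (pathLaw P))
        (((BddMeasurable.const _).mul (BddMeasurable.sum _ fun k _ => hyd k)).integrable _) h1
      rw [integral_const_mul, integral_finsetSum _ fun k _ => (hyd k).integrable _] at h2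
      refine h2.trans (le_of_eq ?_)
      congr 1
      refine Finset.sum_congr rfl fun k _ => ?_
      rw [integral_div]
      congr 1
      exact integral_sq_sum_diffFrom P (k : ℤ) _ fun i hi => hg i (hbd _ _ _ hi) f
    calc _ ≤ ∑ b ∈ Finset.range n, (∑ k ∈ Finset.range (q + 1), c' k) *
          ∑ k ∈ Finset.range (q + 1), (∑ i ∈ block n q ρ b,
            ∫ e, diffFrom P ((i : ℤ) - (k : ℤ)) (g i f) e ^ 2 ∂(pathLaw P)) / c' k :=
          Finset.sum_le_sum fun b _ => hone b
      _ = (∑ k ∈ Finset.range (q + 1), c' k) * ∑ k ∈ Finset.range (q + 1),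
          (∑ b ∈ Finset.range n, ∑ i ∈ block n q ρ b,
            ∫ e, diffFrom P ((i : ℤ) - (k : ℤ)) (g i f) e ^ 2 ∂(pathLaw P)) / c' k := by
          rw [← Finset.mul_sum, Finset.sum_comm]
          simp_rw [Finset.sum_div]
      _ ≤ (∑ k ∈ Finset.range (q + 1), c' k) * ∑ k ∈ Finset.range (q + 1), c' k := by
          refine mul_le_mul_of_nonneg_left (Finset.sum_le_sum fun k hk => ?_) hc'0
          rw [div_le_iff₀ (hc'pos k), sum_block_eq n q ρ
            (fun i => ∫ e, diffFrom P ((i : ℤ) - (k : ℤ)) (g i f) e ^ 2 ∂(pathLaw P))]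
          have hk' : k ≤ q := by have := Finset.mem_range.1 hk; omega
          calc _ ≤ ∑ i ∈ Finset.Icc 1 n,
                ∫ e, diffFrom P ((i : ℤ) - (k : ℤ)) (g i f) e ^ 2 ∂(pathLaw P) :=
                Finset.sum_le_sum_of_subset_of_nonneg (Finset.filter_subset _ _)
                  fun i _ _ => integral_nonneg fun e => sq_nonneg _
            _ ≤ c f k ^ 2 := hdiff f k hk'
            _ ≤ c' k * c' k := by
                rw [← pow_two]
                refine pow_le_pow_left₀ (hc f k) ?_ 2
                have : 0 < s / (q + 1) := by positivity
                simp only [hc']; linarith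
      _ ≤ (2 * s) ^ 2 := by
          rw [← pow_two]; exact pow_le_pow_left₀ hc'0 hc'sum 2
  have hpar : ∀ ρ, expMax (pathLaw P) (fun f e => ∑ b ∈ Finset.range n,
      ∑ i ∈ block n q ρ b, T i f e) ≤ 4 * (H * M * q) + 6 * Real.sqrt H * s := by
    intro ρ
    have h := integral_iSup_blocks_le P (ι := ι)
      (Y := fun b f e => ∑ i ∈ block n q ρ b, T i f e)
      (fun b => (2 * (b : ℤ) + ρ - 1) * q + 1) (fun b b' hbb => by
        have : (b : ℤ) ≤ b' := by exact_mod_cast hbb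
        dsimp only
        gcongr) n (B := 2 * M * q) (v := (2 * s) ^ 2) (l := l)
      (fun b _ f => BddMeasurable.sum _ fun i hi => hTb i (hbd _ _ _ hi) f)
      (fun b _ f x y hxy => Finset.sum_congr rfl fun i hi =>
        hTd i (hbd _ _ _ hi) f fun t ht => hxy t (by
          obtain ⟨-, h1, h2⟩ := mem_block hq hi
          have h1' : (2 * (b : ℤ) + ρ) * q + 1 ≤ i := by exact_mod_cast h1
          have h2' : (i : ℤ) ≤ (2 * (b : ℤ) + ρ) * q + q := by exact_mod_cast h2
          simp only [Set.mem_Icc, Set.mem_Ico] at ht ⊢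
          push_cast
          constructor <;> nlinarith))
      (fun b _ f => by
        rw [integral_finsetSum _ fun i hi => (hTb i (hbd _ _ _ hi) f).integrable _]
        exact Finset.sum_eq_zero fun i hi => hT0 i (hbd _ _ _ hi) f)
      (fun b _ f e => by
        refine (Finset.abs_sum_le_sum_abs _ _).trans
          ((Finset.sum_le_sum fun i hi => hTM i (hbd _ _ _ hi) f e).trans ?_)
        rw [Finset.sum_const, nsmul_eq_mul, mul_comm]
        have : ((block n q ρ b).card : ℝ) ≤ q := by exact_mod_cast card_block_le hq
        exact mul_le_mul_of_nonneg_left this (by positivity))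
      (fun f => hvar ρ f) hlpos (by
        rw [hl, inv_mul_le_iff₀ hden]
        have : 0 < s / Real.sqrt H := by positivity
        linarith)
    refine h.trans ?_
    have h1 : Real.log (2 * Fintype.card ι) / l ≤ 2 * H * (2 * M * q + s / Real.sqrt H) := by
      rw [hl, div_inv_eq_mul]
      exact mul_le_mul_of_nonneg_right hcard hden.le
    have h2 : H / Real.sqrt H = Real.sqrt H := Real.div_sqrt
    have h3 : l * (2 * s) ^ 2 ≤ 4 * Real.sqrt H * s := by
      rw [hl, inv_mul_le_iff₀ hden]
      have h4 : s / Real.sqrt H * (4 * Real.sqrt H * s) = (2 * s) ^ 2 := by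
        field_simp; ring
      have h5 : 0 ≤ 2 * M * q * (4 * Real.sqrt H * s) := by positivity
      linarith
    have h6 : 2 * H * (2 * M * q + s / Real.sqrt H)
        = 4 * (H * M * q) + 2 * (H / Real.sqrt H) * s := by ring
    rw [h6, h2] at h1
    linarith
  have hfin : (fun f e => ∑ i ∈ Finset.Icc 1 n,
      (condFrom P ((i : ℤ) - (q : ℤ)) (g i f) e - ∫ e', g i f e' ∂(pathLaw P)))
      = fun f e => ∑ ρ ∈ Finset.range 2, ∑ b ∈ Finset.range n, ∑ i ∈ block n q ρ b, T i f e := by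
    funext f e
    rw [sum_sum_block_eq]
    exact Finset.sum_congr rfl fun i hi => hTeq i hi f e
  rw [hfin]
  refine (expMax_sum_le _ _ fun ρ _ f => BddMeasurable.sum _ fun b _ =>
    BddMeasurable.sum _ fun i hi => hTb i (hbd _ _ _ hi) f).trans ?_
  rw [Finset.sum_range_succ, Finset.sum_range_one]
  linarith [hpar 0, hpar 1]

/-- Maximal inequality for bounded functionals of i.i.d. innovations: `M` bounds the functionals,
`w` the dependence of their maximum, and `s` the variance of each normalised sum. -/
theorem expMax_centered_sum_le (n q : ℕ) (hq : 1 ≤ q) {g : ℕ → ι → (ℤ → E) → ℝ} {M : ℝ}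
    (hM : 0 ≤ M)
    (hg : ∀ i ∈ Finset.Icc 1 n, ∀ f, BddMeasurable (g i f))
    (hgM : ∀ i ∈ Finset.Icc 1 n, ∀ f e, |g i f e| ≤ M)
    (hgd : ∀ i ∈ Finset.Icc 1 n, ∀ f, DependsOn (g i f) (Set.Iic (i : ℤ)))
    {H W s : ℝ} {w : ℕ → ℝ} {c : ι → ℕ → ℝ} (hH : 1 ≤ H)
    (hcard : Real.log (2 * Fintype.card ι) ≤ 2 * H) (hw : ∀ k, 0 ≤ w k)
    (hres : ∀ k : ℕ, ∑ i ∈ Finset.Icc 1 n, ∫ x : (ℤ → E) × (ℤ → E), ⨆ f, (g i f x.1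
      - g i f (splice {(i : ℤ) - (k : ℤ)}ᶜ x.1 x.2)) ^ 2
        ∂((pathLaw P).prod (pathLaw P)) ≤ w k ^ 2)
    (hW : ∀ N, ∑ k ∈ Finset.Ico (q + 1) N, w k ≤ W)
    (hc : ∀ f k, 0 ≤ c f k) (hs : 0 < s)
    (hdiff : ∀ f, ∀ k ≤ q, ∑ i ∈ Finset.Icc 1 n,
      ∫ e, diffFrom P ((i : ℤ) - (k : ℤ)) (g i f) e ^ 2 ∂(pathLaw P) ≤ c f k ^ 2)
    (hcs : ∀ f, ∑ k ∈ Finset.range (q + 1), c f k ≤ s) :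
    expMax (pathLaw P) (fun f e => ∑ i ∈ Finset.Icc 1 n,
      (g i f e - ∫ e', g i f e' ∂(pathLaw P)))
      ≤ 4 * Real.sqrt H * W + (8 * (H * M * q) + 12 * Real.sqrt H * s) := by
  have hsplit : (fun f e => ∑ i ∈ Finset.Icc 1 n, (g i f e - ∫ e', g i f e' ∂(pathLaw P)))
      = fun f e => ∑ i ∈ Finset.Icc 1 n,
          (g i f e - condFrom P ((i : ℤ) - (q : ℤ)) (g i f) e)
        + ∑ i ∈ Finset.Icc 1 n,
          (condFrom P ((i : ℤ) - (q : ℤ)) (g i f) e - ∫ e', g i f e' ∂(pathLaw P)) := by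
    funext f e
    rw [← Finset.sum_add_distrib]
    exact Finset.sum_congr rfl fun i _ => by ring
  rw [hsplit]
  exact (expMax_add_le _
    (fun f => BddMeasurable.sum _ fun i hi => (hg i hi f).sub ((hg i hi f).condFrom P _))
    (fun f => BddMeasurable.sum _ fun i hi =>
      ((hg i hi f).condFrom P _).sub (BddMeasurable.const _))).trans
    (add_le_add (expMax_sub_condFrom_le P n q hg hgd hH hcard hw hres hW)
      (expMax_condFrom_sub_integral_le P n q hq hM hg hgM hgd hH hcard hc hs hdiff hcs))

end MaximalInequality

/-! ### Moment bounds for weighted series -/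

section Moments

variable {α : Type*} [MeasurableSpace α] {μ : Measure α} {d : ℕ}

lemma one_le_ofReal_mul {ν : ℝ} {p : ℝ≥0∞} (hν : 2 ≤ ν) (hp : 1 ≤ p) :
    1 ≤ ENNReal.ofReal ν * p := by
  have : (1 : ℝ≥0∞) ≤ ENNReal.ofReal ν := by
    rw [← ENNReal.ofReal_one]; exact ENNReal.ofReal_le_ofReal (by linarith)
  exact one_le_mul this hp

lemma holderTriple_ofReal_mul {ν : ℝ} {p : ℝ≥0∞} (hν : 2 ≤ ν) (hp : 1 < p) :
    ENNReal.HolderTriple (ENNReal.ofReal ν * ENNReal.conjExponent p) (ENNReal.ofReal ν * p)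
      (ENNReal.ofReal ν) := by
  have h0 : ENNReal.ofReal ν ≠ 0 := (ENNReal.ofReal_pos.2 (by linarith)).ne'
  have h1 : ENNReal.ofReal ν ≠ ∞ := ENNReal.ofReal_ne_top
  have h := (ENNReal.HolderConjugate.conjExponent hp.le).inv_add_inv_eq_inv
  refine ⟨?_⟩
  rw [ENNReal.mul_inv (Or.inl h0) (Or.inl h1), ENNReal.mul_inv (Or.inl h0) (Or.inl h1), ← mul_add,
    add_comm, h, inv_one, mul_one]

/-- Moments of powers of the maximum norm from moments of the coordinates. -/
lemma eLpNorm_norm_rpow_le {Y : α → Fin d → ℝ} (hY : Measurable Y) {s : ℝ} (hs : 0 < s)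
    {b C : ℝ≥0∞} (hb : 1 ≤ b)
    (hC : ∀ c, eLpNorm (fun x => Y x c) (b * ENNReal.ofReal s) μ ≤ C) :
    eLpNorm (fun x => ‖Y x‖ ^ s) b μ ≤ d * C ^ s := by
  have hYc : ∀ c, Measurable (fun x => Y x c) := fun c => (measurable_pi_apply c).comp hY
  have hpt : ∀ x, ‖‖Y x‖ ^ s‖ ≤ (∑ c : Fin d, fun x => ‖Y x c‖ ^ s) x := by
    intro x
    rw [Real.norm_of_nonneg (by positivity), Finset.sum_apply]
    rcases isEmpty_or_nonempty (Fin d) with h | h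
    · have : Y x = 0 := Subsingleton.elim _ _
      simp [this, hs.ne']
    · obtain ⟨c, hc⟩ : ∃ c, ‖Y x‖ = ‖Y x c‖ := by
        obtain ⟨c, hc⟩ := Finite.exists_max (fun c => ‖Y x c‖)
        exact ⟨c, le_antisymm ((pi_norm_le_iff_of_nonneg (norm_nonneg _)).2 hc) (norm_le_pi_norm _ _)⟩
      rw [hc]
      exact Finset.single_le_sum (f := fun c => ‖Y x c‖ ^ s) (fun _ _ => by positivity)
        (Finset.mem_univ c)
  refine (eLpNorm_mono_real hpt).trans ((eLpNorm_sum_le (fun c _ =>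
    ((hYc c).norm.pow_const s).aestronglyMeasurable) hb).trans ?_)
  calc ∑ c : Fin d, eLpNorm (fun x => ‖Y x c‖ ^ s) b μ ≤ ∑ _c : Fin d, C ^ s := by
        refine Finset.sum_le_sum fun c _ => ?_
        rw [eLpNorm_norm_rpow _ hs]
        exact ENNReal.rpow_le_rpow (hC c) hs.le
    _ = d * C ^ s := by simp

lemma eLpNorm_weighted_le {A : α → ℝ} {l : ℝ} (hl : 0 ≤ l) (b : ℝ≥0∞) :
    eLpNorm (fun x => l * A x) b μ = ENNReal.ofReal l * eLpNorm A b μ := by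
  have := eLpNorm_const_smul (μ := μ) l A b
  rw [Real.enorm_eq_ofReal hl] at this
  exact this

lemma eLpNorm_weighted_sum_le {A : ℕ → α → ℝ} (hA : ∀ j, Measurable (A j)) {L : ℕ → ℝ}
    (hL : ∀ j, 0 ≤ L j) {b : ℝ≥0∞} (hb : 1 ≤ b) (N : ℕ) :
    eLpNorm (fun x => ∑ j ∈ Finset.range N, L j * A j x) b μ
      ≤ ∑ j ∈ Finset.range N, ENNReal.ofReal (L j) * eLpNorm (A j) b μ := by
  have h : (fun x => ∑ j ∈ Finset.range N, L j * A j x)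
      = ∑ j ∈ Finset.range N, fun x => L j * A j x := by
    funext x; simp
  rw [h]
  refine (eLpNorm_sum_le (fun j _ => ((hA j).const_mul _).aestronglyMeasurable) hb).trans ?_
  exact Finset.sum_le_sum fun j _ => (eLpNorm_weighted_le (hL j) b).le

lemma ae_summable_weighted {A : ℕ → α → ℝ} (hA : ∀ j, Measurable (A j)) (hA0 : ∀ j x, 0 ≤ A j x)
    {L : ℕ → ℝ} (hL : ∀ j, 0 ≤ L j) (hLs : Summable L) {b C : ℝ≥0∞} (hb : 1 ≤ b) (hC : C ≠ ∞)
    (hAC : ∀ j, eLpNorm (A j) b μ ≤ C) : ∀ᵐ x ∂μ, Summable (fun j => L j * A j x) := by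
  have h := summable_norm_of_tsum_eLpNorm_ne_top (μ := μ) hb
    (f := fun j x => L j * A j x) (fun j => ((hA j).const_mul _).aestronglyMeasurable) (by
      simp_rw [fun j => eLpNorm_weighted_le (μ := μ) (A := A j) (hL j) b]
      refine ne_top_of_le_ne_top ?_ (ENNReal.tsum_le_tsum fun j => mul_le_mul_right (hAC j) _)
      rw [ENNReal.tsum_mul_right]
      exact ENNReal.mul_ne_top hLs.tsum_ofReal_ne_top hC)
  filter_upwards [h] with x hx
  refine hx.congr fun j => ?_
  rw [Real.norm_of_nonneg (mul_nonneg (hL j) (hA0 j x))]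

lemma eLpNorm_weighted_tsum_le {A : ℕ → α → ℝ} (hA : ∀ j, Measurable (A j))
    (hA0 : ∀ j x, 0 ≤ A j x) {L : ℕ → ℝ} (hL : ∀ j, 0 ≤ L j) (hLs : Summable L) {b C : ℝ≥0∞}
    (hb : 1 ≤ b) (hC : C ≠ ∞) (hAC : ∀ j, eLpNorm (A j) b μ ≤ C) :
    eLpNorm (fun x => ∑' j, L j * A j x) b μ ≤ ENNReal.ofReal (∑' j, L j) * C := by
  refine (Lp.eLpNorm_lim_le_liminf_eLpNorm
    (f := fun N x => ∑ j ∈ Finset.range N, L j * A j x)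
    (fun N => (Finset.measurable_fun_sum _ fun j _ => (hA j).const_mul _).aestronglyMeasurable) _
    ?_).trans ?_
  · filter_upwards [ae_summable_weighted hA hA0 hL hLs hb hC hAC] with x hx
    exact hx.hasSum.tendsto_sum_nat
  · refine Filter.liminf_le_of_le (by isBoundedDefault) fun c hc => ?_
    obtain ⟨N, hN⟩ := hc.exists
    refine hN.trans ((eLpNorm_weighted_sum_le hA hL hb N).trans ?_)
    calc ∑ j ∈ Finset.range N, ENNReal.ofReal (L j) * eLpNorm (A j) b μ
        ≤ ∑ j ∈ Finset.range N, ENNReal.ofReal (L j) * C :=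
          Finset.sum_le_sum fun j _ => mul_le_mul_right (hAC j) _
      _ = ENNReal.ofReal (∑ j ∈ Finset.range N, L j) * C := by
          rw [← Finset.sum_mul, ENNReal.ofReal_sum_of_nonneg fun j _ => hL j]
      _ ≤ ENNReal.ofReal (∑' j, L j) * C :=
          mul_le_mul_left (ENNReal.ofReal_le_ofReal (hLs.sum_le_tsum _ fun j _ => hL j)) _

lemma eLpNorm_mul_le_of_holder {A B : α → ℝ} (hA : Measurable A) (hB : Measurable B)
    {a b r : ℝ≥0∞} (h : ENNReal.HolderTriple b a r) :
    eLpNorm (fun x => A x * B x) r μ ≤ eLpNorm A b μ * eLpNorm B a μ :=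
  eLpNorm_smul_le_mul_eLpNorm (φ := A) (f := B) hB.aestronglyMeasurable hA.aestronglyMeasurable

/-- From an `L^r`-bound to an integrable power and a bound on its integral. -/
lemma integrable_rpow_of_eLpNorm_le {A : α → ℝ} (hA : Measurable A) (hA0 : ∀ x, 0 ≤ A x)
    {r C : ℝ} (hr : 0 < r) (hC : 0 ≤ C)
    (h : eLpNorm A (ENNReal.ofReal r) μ ≤ ENNReal.ofReal C) :
    Integrable (fun x => A x ^ r) μ ∧ ∫ x, A x ^ r ∂μ ≤ C ^ r := by
  have hr0 : ENNReal.ofReal r ≠ 0 := (ENNReal.ofReal_pos.2 hr).ne'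
  have hmem : MemLp A (ENNReal.ofReal r) μ :=
    ⟨hA.aestronglyMeasurable, h.trans_lt ENNReal.ofReal_lt_top⟩
  have hint : Integrable (fun x => A x ^ r) μ := by
    have := hmem.integrable_norm_rpow hr0 ENNReal.ofReal_ne_top
    rw [ENNReal.toReal_ofReal hr.le] at this
    refine this.congr (Filter.Eventually.of_forall fun x => ?_)
    simp only [Real.norm_of_nonneg (hA0 x)]
  refine ⟨hint, ?_⟩
  have hI : 0 ≤ ∫ x, A x ^ r ∂μ := integral_nonneg fun x => Real.rpow_nonneg (hA0 x) _
  have h2 := hmem.eLpNorm_eq_integral_rpow_norm hr0 ENNReal.ofReal_ne_top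
  rw [ENNReal.toReal_ofReal hr.le] at h2
  simp only [Real.norm_of_nonneg (hA0 _)] at h2
  rw [h2, ENNReal.ofReal_le_ofReal_iff hC] at h
  calc ∫ x, A x ^ r ∂μ = ((∫ x, A x ^ r ∂μ) ^ r⁻¹) ^ r := by
        rw [← Real.rpow_mul hI, inv_mul_cancel₀ hr.ne', Real.rpow_one]
    _ ≤ C ^ r := Real.rpow_le_rpow (Real.rpow_nonneg hI _) h hr.le

end Moments

/-! ### Reduction to the coordinate process on path space -/

section Canonical

variable {d m : ℕ} {J : ℕ → ℤ → (ℕ → (Fin m → ℝ)) → (Fin d → ℝ)} {n : ℕ}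

/-- The coordinate process on the space of two-sided innovation paths. -/
def coordProc (m : ℕ) : ℤ → (ℤ → (Fin m → ℝ)) → (Fin m → ℝ) := fun t e => e t

lemma measurable_shiftProc (hJ : ∀ i : ℤ, i ≤ (n : ℤ) → Measurable (J n i)) {i : ℤ}
    (hi : i ≤ n) : Measurable (shiftProc J n i) :=
  (hJ i hi).comp (measurable_pi_lambda _ fun _ => measurable_pi_apply _)

lemma dependsOn_shiftProc (i : ℤ) : DependsOn (shiftProc J n i) (Set.Iic i) := by
  intro x y hxy
  unfold shiftProc
  congr 1
  funext k
  exact hxy _ (by simp)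

lemma measurable_obsPast_coordProc (hJ : ∀ i : ℤ, i ≤ (n : ℤ) → Measurable (J n i)) {i : ℤ}
    (hi : i ≤ n) : Measurable (obsPast (coordProc m) J n i) :=
  measurable_pi_lambda _ fun j => measurable_shiftProc hJ (by omega)

lemma dependsOn_obsPast_coordProc (i : ℤ) :
    DependsOn (obsPast (coordProc m) J n i) (Set.Iic i) := by
  intro x y hxy
  funext j
  refine dependsOn_shiftProc (i - (j : ℤ)) fun t ht => hxy t ?_
  simp only [Set.mem_Iic] at ht ⊢
  omega

lemma coupledPath_coordProc (l : ℤ) (w : (ℤ → (Fin m → ℝ)) × (ℤ → (Fin m → ℝ))) :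
    coupledPath (coordProc m) l w = splice {l}ᶜ w.1 w.2 := by
  funext t
  by_cases h : t = l
  · subst h; simp [coupledPath, coordProc, splice]
  · simp [coupledPath, coordProc, splice, h]

variable {Ω : Type*} [MeasurableSpace Ω] {μ : Measure Ω}
  {ε : ℤ → Ω → (Fin m → ℝ)}

lemma IsIID.measurePreserving_path (hε : IsIID μ ε) :
    MeasurePreserving (fun ω t => ε t ω) μ (pathLaw (μ.map (ε 0))) := by
  refine ⟨measurable_pi_lambda _ hε.measurable, ?_⟩
  rw [hε.indep.map_fun_eq_infinitePi_map hε.measurable]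
  congr 1
  funext t
  exact (hε.ident t).map_eq

lemma depMeasure_coordProc [IsProbabilityMeasure μ] (hε : IsIID μ ε)
    (hJ : ∀ i : ℤ, i ≤ (n : ℤ) → Measurable (J n i)) (q : ℝ≥0∞) (k : ℕ) :
    depMeasure (pathLaw (μ.map (ε 0))) (coordProc m) J n q k = depMeasure μ ε J n q k := by
  have : IsProbabilityMeasure (μ.map (ε 0)) :=
    Measure.isProbabilityMeasure_map (hε.measurable 0).aemeasurable
  have hp := hε.measurePreserving_path
  unfold depMeasure
  refine iSup_congr fun i => iSup_congr fun j => ?_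
  have hX := measurable_shiftProc (J := J) hJ i.2
  have hmeas : Measurable (fun w : (ℤ → (Fin m → ℝ)) × (ℤ → (Fin m → ℝ)) =>
      shiftProc J n i (fun t => coordProc m t w.1) j
        - shiftProc J n i (coupledPath (coordProc m) ((i : ℤ) - (k : ℤ)) w) j) := by
    simp only [coupledPath_coordProc]
    exact ((measurable_pi_apply j).comp (hX.comp measurable_fst)).sub
      ((measurable_pi_apply j).comp (hX.comp (measurable_splice _)))
  exact (eLpNorm_comp_measurePreserving hmeas.aestronglyMeasurable (hp.prod hp)).symm

lemma normTwo_coordProc (hε : IsIID μ ε)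
    (hJ : ∀ i : ℤ, i ≤ (n : ℤ) → Measurable (J n i)) {f : Fn d} (hf : Measurable f) :
    normTwo (pathLaw (μ.map (ε 0))) (coordProc m) J n f = normTwo μ ε J n f := by
  unfold normTwo
  congr 2
  refine Finset.sum_congr rfl fun i hi => ?_
  congr 1
  have h := measurable_obsPast_coordProc (m := m) (J := J) hJ (i := i)
    (by exact_mod_cast (Finset.mem_Icc.1 hi).2)
  exact (eLpNorm_comp_measurePreserving
    (hf.comp (h.prodMk measurable_const)).aestronglyMeasurable hε.measurePreserving_path).symm

lemma empProc_coordProc (hε : IsIID μ ε)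
    (hJ : ∀ i : ℤ, i ≤ (n : ℤ) → Measurable (J n i)) {f : Fn d} (hf : Measurable f) (ω : Ω) :
    empProc (pathLaw (μ.map (ε 0))) (coordProc m) J n f (fun t => ε t ω) = empProc μ ε J n f ω := by
  unfold empProc
  congr 1
  refine Finset.sum_congr rfl fun i hi => ?_
  congr 1
  have h := measurable_obsPast_coordProc (m := m) (J := J) hJ (i := i)
    (by exact_mod_cast (Finset.mem_Icc.1 hi).2)
  rw [← hε.measurePreserving_path.map_eq]
  exact integral_map hε.measurePreserving_path.measurable.aemeasurable
    (hf.comp (h.prodMk measurable_const)).aestronglyMeasurable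

/-- The compatibility condition only concerns the law of the innovations. -/
lemma Compatible.to_pathLaw [IsProbabilityMeasure μ] {F : Finset (Fn d)} {D : Fn d → unitInterval → ℝ} {fbar : Fn d → Fn d}
    {L : ℕ → ℝ} {s : ℝ} {R : Fn d} {C_R C_f ν : ℝ} {p : ℝ≥0∞} {C_X : ℝ} {Δ : ℕ → ℝ} {DDn : ℝ}
    (h : Compatible μ ε J n F D fbar L s R C_R C_f ν p C_X Δ DDn) (hε : IsIID μ ε)
    (hJ : ∀ i : ℤ, i ≤ (n : ℤ) → Measurable (J n i)) :
    Compatible (pathLaw (μ.map (ε 0))) (coordProc m) J n F D fbar L s R C_R C_f ν p C_X Δ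
      DDn where
  f_measurable := h.f_measurable
  decomp := h.decomp
  holderClass := h.holderClass
  two_le := h.two_le
  one_lt := h.one_lt
  C_X_pos := h.C_X_pos
  R_moment i hi u := by
    have hz := measurable_obsPast_coordProc (m := m) (J := J) hJ (i := i)
      (by exact_mod_cast (Finset.mem_Icc.1 hi).2)
    refine le_trans (le_of_eq ?_) (h.R_moment i hi u)
    exact (eLpNorm_comp_measurePreserving
      ((h.holderClass.R_measurable u).comp hz).aestronglyMeasurable
      hε.measurePreserving_path).symm
  X_moment i hi j := by
    refine le_trans (le_of_eq ?_) (h.X_moment i hi j)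
    exact (eLpNorm_comp_measurePreserving
      ((measurable_pi_apply j).comp (measurable_shiftProc hJ hi)).aestronglyMeasurable
      hε.measurePreserving_path).symm
  dependence k := by
    simp_rw [depMeasure_coordProc hε hJ]
    exact h.dependence k
  D_bound := h.D_bound

end Canonical

/-! ### Envelopes of the class -/

section Envelope

variable {d m : ℕ} {J : ℕ → ℤ → (ℕ → (Fin m → ℝ)) → (Fin d → ℝ)} {n : ℕ}
  {P : Measure (Fin m → ℝ)}
  {F : Finset (Fn d)} {D : Fn d → unitInterval → ℝ} {fbar : Fn d → Fn d}
  {L : ℕ → ℝ} {s : ℝ} {R : Fn d} {C_R C_f ν : ℝ} {p : ℝ≥0∞} {C_X : ℝ} {Δ : ℕ → ℝ} {DDn : ℝ}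

/-- The Hölder bound for the effect on `fbar (Z_i, u)` of resampling the innovation at time
`i - k`. -/
noncomputable def resampleEnv (J : ℕ → ℤ → (ℕ → (Fin m → ℝ)) → (Fin d → ℝ)) (n : ℕ)
    (L : ℕ → ℝ) (s : ℝ) (R : Fn d) (i : ℤ) (k : ℕ) (u : unitInterval)
    (w : (ℤ → (Fin m → ℝ)) × (ℤ → (Fin m → ℝ))) : ℝ :=
  (∑ j ∈ Finset.range (k + 1), L j * ‖shiftProc J n (i - (j : ℤ)) w.1
      - shiftProc J n (i - (j : ℤ)) (splice {i - (k : ℤ)}ᶜ w.1 w.2)‖ ^ s)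
    * (R (obsPast (coordProc m) J n i w.1, u)
      + R (obsPast (coordProc m) J n i (splice {i - (k : ℤ)}ᶜ w.1 w.2), u))

/-- An envelope of `fbar (Z_i, u)`, from the Hölder bound at `(Z_i, 0)`. -/
noncomputable def envelope (J : ℕ → ℤ → (ℕ → (Fin m → ℝ)) → (Fin d → ℝ)) (n : ℕ)
    (L : ℕ → ℝ) (s : ℝ) (R : Fn d) (C_R C_f : ℝ) (i : ℤ) (u : unitInterval)
    (e : ℤ → (Fin m → ℝ)) : ℝ :=
  C_f + (∑' j, L j * ‖shiftProc J n (i - (j : ℤ)) e‖ ^ s)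
    * (R (obsPast (coordProc m) J n i e, u) + C_R)

lemma Compatible.resampleEnv_nonneg
    (h : Compatible (pathLaw P) (coordProc m) J n F D fbar L s R C_R C_f ν p C_X Δ DDn)
    (i : ℤ) (k : ℕ) (u : unitInterval) (w : (ℤ → (Fin m → ℝ)) × (ℤ → (Fin m → ℝ))) :
    0 ≤ resampleEnv J n L s R i k u w :=
  mul_nonneg (Finset.sum_nonneg fun j _ => mul_nonneg (h.holderClass.L_nonneg j) (by positivity))
    (add_nonneg (h.holderClass.R_nonneg _) (h.holderClass.R_nonneg _))

lemma Compatible.envelope_nonneg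
    (h : Compatible (pathLaw P) (coordProc m) J n F D fbar L s R C_R C_f ν p C_X Δ DDn)
    (i : ℤ) (u : unitInterval) (e : ℤ → (Fin m → ℝ)) :
    0 ≤ envelope J n L s R C_R C_f i u e :=
  add_nonneg h.holderClass.C_f_pos.le (mul_nonneg
    (tsum_nonneg fun j => mul_nonneg (h.holderClass.L_nonneg j) (by positivity))
    (add_nonneg (h.holderClass.R_nonneg _) h.holderClass.C_R_pos.le))

lemma Compatible.abs_sub_le_resampleEnv
    (h : Compatible (pathLaw P) (coordProc m) J n F D fbar L s R C_R C_f ν p C_X Δ DDn)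
    {f : Fn d} (hf : f ∈ F) (i : ℤ) (k : ℕ) (u : unitInterval)
    (w : (ℤ → (Fin m → ℝ)) × (ℤ → (Fin m → ℝ))) :
    |f (obsPast (coordProc m) J n i w.1, u)
        - f (obsPast (coordProc m) J n i (splice {i - (k : ℤ)}ᶜ w.1 w.2), u)|
      ≤ |D f u| * resampleEnv J n L s R i k u w := by
  set e' := splice {i - (k : ℤ)}ᶜ w.1 w.2 with he'
  have hs := h.holderClass.s_pos
  have hzero : ∀ j ∉ Finset.range (k + 1), L j * ‖obsPast (coordProc m) J n i w.1 j
      - obsPast (coordProc m) J n i e' j‖ ^ s = 0 := by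
    intro j hj
    have hj' : k + 1 ≤ j := by simpa using hj
    have : obsPast (coordProc m) J n i w.1 j = obsPast (coordProc m) J n i e' j := by
      refine dependsOn_shiftProc (i - (j : ℤ)) fun t ht => ?_
      have ht' : t ≠ i - (k : ℤ) := by
        simp only [Set.mem_Iic] at ht
        omega
      change w.1 t = e' t
      rw [he', splice_of_mem (by simpa using ht')]
    rw [this, sub_self, norm_zero, Real.zero_rpow hs.ne', mul_zero]
  have h1 := h.holderClass.holder (fbar f) ⟨f, hf, rfl⟩ u
    (obsPast (coordProc m) J n i w.1) (obsPast (coordProc m) J n i e')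
    (summable_of_ne_finset_zero hzero)
  rw [tsum_eq_sum hzero] at h1
  rw [h.decomp f hf, h.decomp f hf, ← mul_sub, abs_mul]
  exact mul_le_mul_of_nonneg_left h1 (abs_nonneg _)

lemma Compatible.abs_le_envelope
    (h : Compatible (pathLaw P) (coordProc m) J n F D fbar L s R C_R C_f ν p C_X Δ DDn)
    {f : Fn d} (hf : f ∈ F) (i : ℤ) (u : unitInterval) {e : ℤ → (Fin m → ℝ)}
    (he : Summable (fun j : ℕ => L j * ‖shiftProc J n (i - (j : ℤ)) e‖ ^ s)) :
    |f (obsPast (coordProc m) J n i e, u)| ≤ |D f u| * envelope J n L s R C_R C_f i u e := by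
  rw [h.decomp f hf, abs_mul]
  refine mul_le_mul_of_nonneg_left ?_ (abs_nonneg _)
  have hs : (fun j : ℕ => L j * ‖obsPast (coordProc m) J n i e j - (0 : Seq d) j‖ ^ s)
      = fun j : ℕ => L j * ‖shiftProc J n (i - (j : ℤ)) e‖ ^ s := by
    funext j
    rw [Pi.zero_apply, sub_zero]; rfl
  have h1 := h.holderClass.holder (fbar f) ⟨f, hf, rfl⟩ u
    (obsPast (coordProc m) J n i e) 0 (by rw [hs]; exact he)
  rw [hs] at h1
  have h2 := h.holderClass.f_zero (fbar f) ⟨f, hf, rfl⟩ u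
  have h3 : R (0, u) ≤ C_R := (le_abs_self _).trans (h.holderClass.R_zero u)
  have h4 : 0 ≤ ∑' j : ℕ, L j * ‖shiftProc J n (i - (j : ℤ)) e‖ ^ s :=
    tsum_nonneg fun j => mul_nonneg (h.holderClass.L_nonneg j) (by positivity)
  have h5 := mul_le_mul_of_nonneg_left
    (add_le_add_right h3 (R (obsPast (coordProc m) J n i e, u))) h4
  have h6 := abs_add_le (fbar f (obsPast (coordProc m) J n i e, u) - fbar f (0, u))
    (fbar f (0, u))
  rw [sub_add_cancel] at h6
  unfold envelope
  linarith

/-- Resampling one innovation changes the class by at most `Δ(k)` in `L^ν`. -/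
lemma Compatible.eLpNorm_resampleEnv_le [IsProbabilityMeasure P]
    (h : Compatible (pathLaw P) (coordProc m) J n F D fbar L s R C_R C_f ν p C_X Δ DDn)
    (hJ : ∀ i : ℤ, i ≤ (n : ℤ) → Measurable (J n i)) {i : ℕ} (hi : i ∈ Finset.Icc 1 n) (k : ℕ)
    (u : unitInterval) :
    eLpNorm (resampleEnv J n L s R i k u) (ENNReal.ofReal ν) ((pathLaw P).prod (pathLaw P))
      ≤ ENNReal.ofReal (Δ k) := by
  have hin : (i : ℤ) ≤ n := by exact_mod_cast (Finset.mem_Icc.1 hi).2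
  have hs := h.holderClass.s_pos
  set b := ENNReal.ofReal ν * ENNReal.conjExponent p with hb
  set a := ENNReal.ofReal ν * p with ha
  have hb1 : 1 ≤ b := one_le_ofReal_mul h.two_le (by simp [ENNReal.conjExponent])
  have ha1 : 1 ≤ a := one_le_ofReal_mul h.two_le h.one_lt.le
  have hbs : b * ENNReal.ofReal s = ENNReal.ofReal (ν * s) * ENNReal.conjExponent p := by
    rw [hb, ENNReal.ofReal_mul (by linarith [h.two_le])]
    ring
  have hX : ∀ j : ℕ, Measurable (shiftProc J n ((i : ℤ) - (j : ℤ))) := fun j =>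
    measurable_shiftProc hJ (by omega)
  have hXd : ∀ j : ℕ, Measurable (fun w : (ℤ → (Fin m → ℝ)) × (ℤ → (Fin m → ℝ)) =>
      shiftProc J n ((i : ℤ) - (j : ℤ)) w.1
        - shiftProc J n ((i : ℤ) - (j : ℤ)) (splice {(i : ℤ) - (k : ℤ)}ᶜ w.1 w.2)) := fun j =>
    ((hX j).comp measurable_fst).sub ((hX j).comp (measurable_splice _))
  have hA : ∀ j : ℕ, Measurable (fun w : (ℤ → (Fin m → ℝ)) × (ℤ → (Fin m → ℝ)) =>
      ‖shiftProc J n ((i : ℤ) - (j : ℤ)) w.1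
        - shiftProc J n ((i : ℤ) - (j : ℤ)) (splice {(i : ℤ) - (k : ℤ)}ᶜ w.1 w.2)‖ ^ s) :=
    fun j => (hXd j).norm.pow_const s
  have hRm : Measurable (fun e => R (obsPast (coordProc m) J n i e, u)) :=
    (h.holderClass.R_measurable u).comp (measurable_obsPast_coordProc hJ hin)
  have hR1 : Measurable (fun w : (ℤ → (Fin m → ℝ)) × (ℤ → (Fin m → ℝ)) =>
      R (obsPast (coordProc m) J n i w.1, u)) := hRm.comp measurable_fst
  have hR2 : Measurable (fun w : (ℤ → (Fin m → ℝ)) × (ℤ → (Fin m → ℝ)) =>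
      R (obsPast (coordProc m) J n i (splice {(i : ℤ) - (k : ℤ)}ᶜ w.1 w.2), u)) :=
    hRm.comp (measurable_splice _)
  have hsum := eLpNorm_weighted_sum_le (μ := (pathLaw P).prod (pathLaw P)) hA
    h.holderClass.L_nonneg hb1 (k + 1)
  have hterm : ∀ j ∈ Finset.range (k + 1), eLpNorm (fun w : (ℤ → (Fin m → ℝ)) × (ℤ → (Fin m → ℝ)) =>
      ‖shiftProc J n ((i : ℤ) - (j : ℤ)) w.1
        - shiftProc J n ((i : ℤ) - (j : ℤ)) (splice {(i : ℤ) - (k : ℤ)}ᶜ w.1 w.2)‖ ^ s) b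
        ((pathLaw P).prod (pathLaw P)) ≤ d * depMeasure (pathLaw P) (coordProc m) J n
          (ENNReal.ofReal (ν * s) * ENNReal.conjExponent p) (k - j) ^ s := by
    intro j hj
    have hjk : j ≤ k := by have := Finset.mem_range.1 hj; omega
    refine eLpNorm_norm_rpow_le (hXd j) hs hb1 fun c => ?_
    rw [hbs]
    refine le_trans (le_of_eq ?_) (le_iSup_of_le ⟨(i : ℤ) - (j : ℤ), by omega⟩
      (le_iSup_of_le c le_rfl))
    congr 1
    funext w
    rw [coupledPath_coordProc]
    have : (i : ℤ) - (j : ℤ) - ((k - j : ℕ) : ℤ) = (i : ℤ) - (k : ℤ) := by omega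
    simp only [this]
    rfl
  have hRR : eLpNorm (fun w : (ℤ → (Fin m → ℝ)) × (ℤ → (Fin m → ℝ)) =>
      R (obsPast (coordProc m) J n i w.1, u)
        + R (obsPast (coordProc m) J n i (splice {(i : ℤ) - (k : ℤ)}ᶜ w.1 w.2), u)) a
        ((pathLaw P).prod (pathLaw P)) ≤ ENNReal.ofReal C_R + ENNReal.ofReal C_R := by
    refine (eLpNorm_add_le hR1.aestronglyMeasurable hR2.aestronglyMeasurable ha1).trans
      (add_le_add ?_ ?_)
    · refine le_trans (le_of_eq ?_) (h.R_moment i hi u)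
      exact eLpNorm_comp_measurePreserving hRm.aestronglyMeasurable measurePreserving_fst
    · refine le_trans (le_of_eq ?_) (h.R_moment i hi u)
      exact eLpNorm_comp_measurePreserving hRm.aestronglyMeasurable (measurePreserving_splice P _)
  refine (eLpNorm_mul_le_of_holder (Finset.measurable_fun_sum _ fun j _ => (hA j).const_mul _)
    (hR1.add hR2) (holderTriple_ofReal_mul h.two_le h.one_lt)).trans ?_
  refine (mul_le_mul' (hsum.trans (Finset.sum_le_sum fun j hj =>
    mul_le_mul_right (hterm j hj) _)) hRR).trans (le_trans (le_of_eq ?_) (h.dependence k))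
  have hCR : ENNReal.ofReal (2 * d * C_R) = d * (ENNReal.ofReal C_R + ENNReal.ofReal C_R) := by
    rw [ENNReal.ofReal_mul (by positivity), ENNReal.ofReal_mul (by norm_num)]
    simp only [ENNReal.ofReal_ofNat, ENNReal.ofReal_natCast]
    ring
  rw [hCR, Finset.mul_sum, Finset.sum_mul]
  exact Finset.sum_congr rfl fun j _ => by ring

lemma Compatible.measurable_resampleEnv
    (h : Compatible (pathLaw P) (coordProc m) J n F D fbar L s R C_R C_f ν p C_X Δ DDn)
    (hJ : ∀ i : ℤ, i ≤ (n : ℤ) → Measurable (J n i)) {i : ℕ} (hi : i ∈ Finset.Icc 1 n) (k : ℕ)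
    (u : unitInterval) : Measurable (resampleEnv J n L s R i k u) := by
  have hin : (i : ℤ) ≤ n := by exact_mod_cast (Finset.mem_Icc.1 hi).2
  have hX : ∀ j : ℕ, Measurable (shiftProc J n ((i : ℤ) - (j : ℤ))) := fun j =>
    measurable_shiftProc hJ (by omega)
  have hRm : Measurable (fun e => R (obsPast (coordProc m) J n i e, u)) :=
    (h.holderClass.R_measurable u).comp (measurable_obsPast_coordProc hJ hin)
  exact (Finset.measurable_fun_sum _ fun j _ => ((((hX j).comp measurable_fst).sub
    ((hX j).comp (measurable_splice _))).norm.pow_const s).const_mul _).mul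
    ((hRm.comp measurable_fst).add (hRm.comp (measurable_splice _)))

lemma Compatible.integral_sq_resampleEnv_le [IsProbabilityMeasure P]
    (h : Compatible (pathLaw P) (coordProc m) J n F D fbar L s R C_R C_f ν p C_X Δ DDn)
    (hJ : ∀ i : ℤ, i ≤ (n : ℤ) → Measurable (J n i)) {i : ℕ} (hi : i ∈ Finset.Icc 1 n) (k : ℕ)
    (u : unitInterval) (hΔ : 0 ≤ Δ k) :
    Integrable (fun w => resampleEnv J n L s R i k u w ^ 2) ((pathLaw P).prod (pathLaw P)) ∧
      ∫ w, resampleEnv J n L s R i k u w ^ 2 ∂((pathLaw P).prod (pathLaw P)) ≤ Δ k ^ 2 := by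
  have hm := h.measurable_resampleEnv hJ hi k u
  have h2 := (eLpNorm_le_eLpNorm_of_exponent_le (p := ENNReal.ofReal 2)
    (ENNReal.ofReal_le_ofReal h.two_le) hm.aestronglyMeasurable).trans
      (h.eLpNorm_resampleEnv_le hJ hi k u)
  have := integrable_rpow_of_eLpNorm_le hm (h.resampleEnv_nonneg i k u) (by norm_num) hΔ h2
  simpa only [Real.rpow_ofNat] using this

lemma Compatible.measurable_envelope
    (h : Compatible (pathLaw P) (coordProc m) J n F D fbar L s R C_R C_f ν p C_X Δ DDn)
    (hJ : ∀ i : ℤ, i ≤ (n : ℤ) → Measurable (J n i)) {i : ℕ} (hi : i ∈ Finset.Icc 1 n)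
    (u : unitInterval) : Measurable (envelope J n L s R C_R C_f i u) := by
  have hin : (i : ℤ) ≤ n := by exact_mod_cast (Finset.mem_Icc.1 hi).2
  have hX : ∀ j : ℕ, Measurable (shiftProc J n ((i : ℤ) - (j : ℤ))) := fun j =>
    measurable_shiftProc hJ (by omega)
  have hRm : Measurable (fun e => R (obsPast (coordProc m) J n i e, u)) :=
    (h.holderClass.R_measurable u).comp (measurable_obsPast_coordProc hJ hin)
  exact measurable_const.add ((Measurable.tsum fun j =>
    ((hX j).norm.pow_const s).const_mul _).mul (hRm.add measurable_const))

/-- Moments of the powers `‖X_{i-j}‖^s` entering the envelope. -/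
lemma Compatible.eLpNorm_norm_shiftProc_le
    (h : Compatible (pathLaw P) (coordProc m) J n F D fbar L s R C_R C_f ν p C_X Δ DDn)
    (hJ : ∀ i : ℤ, i ≤ (n : ℤ) → Measurable (J n i)) {i : ℤ} (hi : i ≤ n) :
    eLpNorm (fun e => ‖shiftProc J n i e‖ ^ s) (ENNReal.ofReal ν * ENNReal.conjExponent p)
      (pathLaw P) ≤ ENNReal.ofReal (d * C_X ^ s) := by
  have hb1 : 1 ≤ ENNReal.ofReal ν * ENNReal.conjExponent p :=
    one_le_ofReal_mul h.two_le (by simp [ENNReal.conjExponent])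
  refine (eLpNorm_norm_rpow_le (measurable_shiftProc hJ hi) h.holderClass.s_pos hb1
    (C := ENNReal.ofReal C_X) fun c => ?_).trans (le_of_eq ?_)
  · refine le_trans (le_of_eq ?_) (h.X_moment i hi c)
    congr 1
    rw [ENNReal.ofReal_mul (by linarith [h.two_le])]
    ring
  · rw [ENNReal.ofReal_mul (by positivity), ENNReal.ofReal_natCast,
      ENNReal.ofReal_rpow_of_pos h.C_X_pos]

lemma Compatible.ae_summable
    (h : Compatible (pathLaw P) (coordProc m) J n F D fbar L s R C_R C_f ν p C_X Δ DDn)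
    (hJ : ∀ i : ℤ, i ≤ (n : ℤ) → Measurable (J n i)) {i : ℕ} (hi : i ∈ Finset.Icc 1 n) :
    ∀ᵐ e ∂(pathLaw P), Summable (fun j : ℕ => L j * ‖shiftProc J n ((i : ℤ) - (j : ℤ)) e‖ ^ s) := by
  have hin : (i : ℤ) ≤ n := by exact_mod_cast (Finset.mem_Icc.1 hi).2
  exact ae_summable_weighted
    (fun j => (measurable_shiftProc hJ (show (i : ℤ) - (j : ℤ) ≤ n by omega)).norm.pow_const s)
    (fun j x => by positivity) h.holderClass.L_nonneg h.holderClass.L_summable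
    (one_le_ofReal_mul h.two_le (by simp [ENNReal.conjExponent])) ENNReal.ofReal_ne_top
    fun j => h.eLpNorm_norm_shiftProc_le hJ (by omega)

lemma Compatible.CDelta_pos
    (h : Compatible (pathLaw P) (coordProc m) J n F D fbar L s R C_R C_f ν p C_X Δ DDn) :
    0 < CDelta d L s C_X C_R C_f := by
  have h1 := h.holderClass.C_f_pos
  have h2 := h.holderClass.C_R_pos
  have h3 := h.C_X_pos
  have h4 : 0 ≤ ∑' j, L j := tsum_nonneg h.holderClass.L_nonneg
  unfold CDelta
  positivity

/-- The envelope has `ν`-th moment at most `C_Δ`. -/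
lemma Compatible.eLpNorm_envelope_le [IsProbabilityMeasure P]
    (h : Compatible (pathLaw P) (coordProc m) J n F D fbar L s R C_R C_f ν p C_X Δ DDn)
    (hJ : ∀ i : ℤ, i ≤ (n : ℤ) → Measurable (J n i)) {i : ℕ} (hi : i ∈ Finset.Icc 1 n)
    (u : unitInterval) :
    eLpNorm (envelope J n L s R C_R C_f i u) (ENNReal.ofReal ν) (pathLaw P)
      ≤ ENNReal.ofReal (CDelta d L s C_X C_R C_f) := by
  have hin : (i : ℤ) ≤ n := by exact_mod_cast (Finset.mem_Icc.1 hi).2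
  have hν0 : ENNReal.ofReal ν ≠ 0 := (ENNReal.ofReal_pos.2 (by linarith [h.two_le])).ne'
  have hν1 : 1 ≤ ENNReal.ofReal ν := by
    simpa using one_le_ofReal_mul h.two_le (le_refl (1 : ℝ≥0∞))
  have hb1 : 1 ≤ ENNReal.ofReal ν * ENNReal.conjExponent p :=
    one_le_ofReal_mul h.two_le (by simp [ENNReal.conjExponent])
  have ha1 : 1 ≤ ENNReal.ofReal ν * p := one_le_ofReal_mul h.two_le h.one_lt.le
  have hX : ∀ j : ℕ, Measurable (shiftProc J n ((i : ℤ) - (j : ℤ))) := fun j =>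
    measurable_shiftProc hJ (by omega)
  have hRm : Measurable (fun e => R (obsPast (coordProc m) J n i e, u)) :=
    (h.holderClass.R_measurable u).comp (measurable_obsPast_coordProc hJ hin)
  have hSm : Measurable (fun e => ∑' j : ℕ, L j * ‖shiftProc J n ((i : ℤ) - (j : ℤ)) e‖ ^ s) :=
    Measurable.tsum fun j => ((hX j).norm.pow_const s).const_mul _
  have hS := eLpNorm_weighted_tsum_le (μ := pathLaw P)
    (A := fun j e => ‖shiftProc J n ((i : ℤ) - (j : ℤ)) e‖ ^ s)
    (fun j => (hX j).norm.pow_const s) (fun j x => by positivity)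
    h.holderClass.L_nonneg h.holderClass.L_summable hb1 ENNReal.ofReal_ne_top
    fun j => h.eLpNorm_norm_shiftProc_le hJ (by omega)
  have hRR : eLpNorm (fun e => R (obsPast (coordProc m) J n i e, u) + C_R)
      (ENNReal.ofReal ν * p) (pathLaw P) ≤ ENNReal.ofReal C_R + ENNReal.ofReal C_R := by
    refine (eLpNorm_add_le hRm.aestronglyMeasurable measurable_const.aestronglyMeasurable
      ha1).trans (add_le_add (h.R_moment i hi u) ?_)
    rw [eLpNorm_const _ (zero_lt_one.trans_le ha1).ne' (NeZero.ne _)]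
    simp [Real.enorm_eq_ofReal h.holderClass.C_R_pos.le]
  have hprod := (eLpNorm_mul_le_of_holder (μ := pathLaw P) hSm (hRm.add measurable_const)
    (holderTriple_ofReal_mul h.two_le h.one_lt)).trans (mul_le_mul' hS hRR)
  refine (eLpNorm_add_le (f := fun _ => C_f) measurable_const.aestronglyMeasurable
    (hSm.mul (hRm.add measurable_const)).aestronglyMeasurable hν1).trans ?_
  refine (add_le_add_right hprod _).trans ?_
  have hL : 0 ≤ ∑' j, L j := tsum_nonneg h.holderClass.L_nonneg
  have hCX : 0 ≤ C_X ^ s := Real.rpow_nonneg h.C_X_pos.le _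
  have hCR := h.holderClass.C_R_pos.le
  rw [eLpNorm_const _ hν0 (NeZero.ne _), Real.enorm_eq_ofReal h.holderClass.C_f_pos.le,
    measure_univ, ENNReal.one_rpow, mul_one, ← ENNReal.ofReal_add hCR hCR,
    ← ENNReal.ofReal_mul hL, ← ENNReal.ofReal_mul (by positivity),
    ← ENNReal.ofReal_add h.holderClass.C_f_pos.le (by positivity)]
  refine ENNReal.ofReal_le_ofReal ?_
  unfold CDelta
  have : 0 ≤ (∑' j, L j) * (d * C_X ^ s) * C_R := by positivity
  nlinarith

end Envelope

/-! ### The functions `q^*` and `r` -/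

section Rate

variable {Δ : ℕ → ℝ}

lemma tendsto_betaTail (Δ : ℕ → ℝ) : Filter.Tendsto (betaTail Δ) Filter.atTop (nhds 0) := by
  have := tendsto_sum_nat_add Δ
  unfold betaTail
  simpa only [add_comm] using this

lemma exists_betaTail_le (Δ : ℕ → ℝ) {x : ℝ} (hx : 0 < x) : ∃ q : ℕ, 1 ≤ q ∧ betaTail Δ q ≤ x := by
  obtain ⟨q, hq, h⟩ := (((tendsto_betaTail Δ).eventually (gt_mem_nhds hx)).and
    (Filter.eventually_ge_atTop 1)).exists
  exact ⟨q, h, hq.le⟩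

lemma qStar_spec (Δ : ℕ → ℝ) {x : ℝ} (hx : 0 < x) :
    1 ≤ qStar Δ x ∧ betaTail Δ (qStar Δ x) ≤ (qStar Δ x : ℝ) * x := by
  have hne : {q : ℕ | 1 ≤ q ∧ betaTail Δ q ≤ (q : ℝ) * x}.Nonempty := by
    obtain ⟨q, hq, h⟩ := exists_betaTail_le Δ hx
    refine ⟨q, hq, h.trans ?_⟩
    have : (1 : ℝ) ≤ q := by exact_mod_cast hq
    nlinarith
  exact Nat.sInf_mem hne

/-- The threshold `r(δ)` is positive, and some admissible `x` is at least half as large; this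
avoids having to show that the supremum is attained. -/
lemma exists_admissible (Δ : ℕ → ℝ) {δ : ℝ} (hδ : 0 < δ) :
    0 < rFun Δ δ ∧ ∃ x, 0 < x ∧ rFun Δ δ ≤ 2 * x ∧ ∃ q : ℕ, 1 ≤ q ∧
      betaTail Δ q ≤ (q : ℝ) * x ∧ (q : ℝ) * x ≤ δ := by
  set S : Set ℝ := {x : ℝ | 0 < x ∧ (qStar Δ x : ℝ) * x ≤ δ} with hS
  have hne : S.Nonempty := by
    obtain ⟨Q, hQ, h⟩ := exists_betaTail_le Δ hδ
    have hQ' : (0 : ℝ) < Q := by exact_mod_cast hQ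
    have hQx : (Q : ℝ) * (δ / Q) = δ := by field_simp
    refine ⟨δ / Q, by positivity, ?_⟩
    have h1 : qStar Δ (δ / Q) ≤ Q := Nat.sInf_le ⟨hQ, by rw [hQx]; exact h⟩
    calc (qStar Δ (δ / Q) : ℝ) * (δ / Q) ≤ Q * (δ / Q) := by gcongr
      _ = δ := hQx
  have hbdd : BddAbove S := by
    refine ⟨δ, fun x hx => ?_⟩
    have h1 : (1 : ℝ) ≤ qStar Δ x := by exact_mod_cast (qStar_spec Δ hx.1).1
    have := hx.2
    nlinarith [hx.1]
  have hpos : 0 < rFun Δ δ := by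
    obtain ⟨x, hx⟩ := hne
    exact hx.1.trans_le (le_csSup hbdd hx)
  refine ⟨hpos, ?_⟩
  obtain ⟨x, hx, hlt⟩ := exists_lt_of_lt_csSup hne (show rFun Δ δ / 2 < sSup S by
    change _ < rFun Δ δ; linarith)
  exact ⟨x, hx.1, by linarith, qStar Δ x, (qStar_spec Δ hx.1).1, (qStar_spec Δ hx.1).2, hx.2⟩

lemma sum_Ico_le_betaTail (hΔ : ∀ k, 0 ≤ Δ k) (hs : Summable Δ) (q N : ℕ) :
    ∑ k ∈ Finset.Ico (q + 1) N, Δ k ≤ betaTail Δ q := by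
  have h1 : Summable (fun j => Δ (q + j)) := by
    simpa only [add_comm] using (summable_nat_add_iff q).2 hs
  calc ∑ k ∈ Finset.Ico (q + 1) N, Δ k ≤ ∑ k ∈ Finset.Ico q N, Δ k :=
        Finset.sum_le_sum_of_subset_of_nonneg (Finset.Ico_subset_Ico_left (by omega))
          fun k _ _ => hΔ k
    _ = ∑ j ∈ Finset.range (N - q), Δ (q + j) := Finset.sum_Ico_eq_sum_range _ _ _
    _ ≤ betaTail Δ q := h1.sum_le_tsum _ fun j _ => hΔ _

/-- The truncation level balances the unbounded part against `√(n H)`. -/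
lemma truncation_moment_le {n H x D ν T σ : ℝ} (hn : 0 < n) (hH : 1 ≤ H) (hx : 0 < x) (hD : 0 < D)
    (hν : 2 ≤ ν) (hT : H / (n ^ (1 - 2 / ν) * x ^ 2) ≤ T) (hxD : x * D ≤ σ) :
    n * D ^ ν * (Real.sqrt n * x * D / Real.sqrt H) ^ (1 - ν)
      ≤ T ^ (ν / 2) * σ * (Real.sqrt n * Real.sqrt H) := by
  have hsn : 0 < Real.sqrt n := Real.sqrt_pos.2 hn
  have hsH : 0 < Real.sqrt H := Real.sqrt_pos.2 (by linarith)
  have hsH1 : 1 ≤ Real.sqrt H := Real.one_le_sqrt.2 hH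
  have hν0 : ν ≠ 0 := by linarith
  set a : ℝ := Real.sqrt n * x / Real.sqrt H with ha
  have hapos : 0 < a := by positivity
  set T0 : ℝ := H / (n ^ (1 - 2 / ν) * x ^ 2) with hT0
  have hT0pos : 0 < T0 := by positivity
  have haD : Real.sqrt n * x * D / Real.sqrt H = a * D := by rw [ha]; ring
  have ha2 : (a ^ 2)⁻¹ = T0 * n ^ (-(2 / ν)) := by
    have h1 : a ^ 2 = n * x ^ 2 / H := by
      rw [ha, div_pow, mul_pow, Real.sq_sqrt hn.le, Real.sq_sqrt (by linarith)]
    have h2 : n ^ (1 - 2 / ν) = n * n ^ (-(2 / ν)) := by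
      rw [sub_eq_add_neg, Real.rpow_add hn, Real.rpow_one]
    have h3 : n ^ (-(2 / ν)) ≠ 0 := (Real.rpow_pos_of_pos hn _).ne'
    rw [h1, hT0, h2]
    field_simp
  have haν : a ^ (-ν) = T0 ^ (ν / 2) * n⁻¹ := by
    have h1 : a ^ (-ν) = ((a ^ 2)⁻¹) ^ (ν / 2) := by
      rw [← Real.rpow_natCast, ← Real.rpow_neg hapos.le, ← Real.rpow_mul hapos.le]
      congr 1; push_cast; ring
    rw [h1, ha2, Real.mul_rpow hT0pos.le (Real.rpow_nonneg hn.le _), ← Real.rpow_mul hn.le,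
      ← Real.rpow_neg_one n]
    congr 2
    field_simp
  have hmain : n * D ^ ν * (a * D) ^ (1 - ν) = T0 ^ (ν / 2) * (x * D) * (Real.sqrt n / Real.sqrt H)
      := by
    rw [Real.mul_rpow hapos.le hD.le, sub_eq_add_neg, Real.rpow_add hapos, Real.rpow_add hD,
      Real.rpow_one, Real.rpow_one, haν, Real.rpow_neg hD.le]
    have : D ^ ν ≠ 0 := (Real.rpow_pos_of_pos hD _).ne'
    rw [ha]
    field_simp
  rw [haD, hmain]
  have hσ : 0 ≤ σ := le_trans (by positivity) hxD
  have h4 : Real.sqrt n / Real.sqrt H ≤ Real.sqrt n * Real.sqrt H := by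
    rw [div_le_iff₀ hsH]
    have : 1 ≤ Real.sqrt H * Real.sqrt H := one_le_mul_of_one_le_of_one_le hsH1 hsH1
    nlinarith
  have hT1 : 0 ≤ T ^ (ν / 2) := Real.rpow_nonneg (hT0pos.le.trans hT) _
  gcongr

end Rate

/-! ### Averages of the multipliers -/

section Averages

variable {d : ℕ} {F : Finset (Fn d)} {D : Fn d → unitInterval → ℝ} {n : ℕ}

lemma supD_nonneg (u : unitInterval) : 0 ≤ supD F D u := Real.iSup_nonneg fun _ => abs_nonneg _

lemma abs_le_supD {f : Fn d} (hf : f ∈ F) (u : unitInterval) : |D f u| ≤ supD F D u :=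
  le_iSup_of_finite (fun f : {f // f ∈ F} => |D f u|) ⟨f, hf⟩

lemma supDMean_nonneg (κ : ℝ) : 0 ≤ supDMean F D κ n :=
  Real.rpow_nonneg (mul_nonneg (by positivity)
    (Finset.sum_nonneg fun _ _ => Real.rpow_nonneg (supD_nonneg _) _)) _

lemma sum_supD_rpow_le (hn : 1 ≤ n) {κ K : ℝ} (hκ : 0 < κ) (h : supDMean F D κ n ≤ K) :
    ∑ i ∈ Finset.Icc 1 n, supD F D (gridPoint n i) ^ κ ≤ n * K ^ κ := by
  have hn' : (0 : ℝ) < n := by exact_mod_cast hn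
  set A := ∑ i ∈ Finset.Icc 1 n, supD F D (gridPoint n i) ^ κ with hA
  have hA0 : 0 ≤ A := Finset.sum_nonneg fun _ _ => Real.rpow_nonneg (supD_nonneg _) _
  have h1 : (1 / (n : ℝ) * A) = (supDMean F D κ n) ^ κ := by
    unfold supDMean
    rw [← hA, ← Real.rpow_mul (by positivity), one_div_mul_cancel hκ.ne', Real.rpow_one]
  have h2 := Real.rpow_le_rpow (supDMean_nonneg κ) h hκ.le
  rw [← h1, one_div, inv_mul_le_iff₀ hn'] at h2
  exact h2

lemma one_le_entropyH : 1 ≤ entropyH F := le_max_left _ _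

lemma log_two_mul_card_le (hF : F.Nonempty) :
    Real.log (2 * Fintype.card {f // f ∈ F}) ≤ 2 * entropyH F := by
  have hc : (0 : ℝ) < F.card := by exact_mod_cast hF.card_pos
  rw [Fintype.card_coe, Real.log_mul two_ne_zero hc.ne']
  have h1 : Real.log 2 ≤ 1 := by linarith [Real.log_two_lt_d9]
  have h2 : Real.log F.card ≤ entropyH F := le_max_right _ _
  linarith [one_le_entropyH (F := F)]

end Averages

/-! ### Truncation -/

/-- Truncation of `y` to `[-M, M]`. -/
noncomputable def clip (M y : ℝ) : ℝ := max (-M) (min y M)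

lemma abs_clip_le {M : ℝ} (hM : 0 ≤ M) (y : ℝ) : |clip M y| ≤ M :=
  abs_le.2 ⟨le_max_left _ _, max_le (by linarith) (min_le_right _ _)⟩

lemma abs_clip_sub_clip_le (M x y : ℝ) : |clip M x - clip M y| ≤ |x - y| := by
  unfold clip
  refine (abs_max_sub_max_le_max _ _ _ _).trans ?_
  rw [sub_self, abs_zero, max_eq_right (abs_nonneg _)]
  refine (abs_min_sub_min_le_max _ _ _ _).trans ?_
  rw [sub_self, abs_zero, max_eq_left (abs_nonneg _)]

lemma abs_clip_le_abs {M : ℝ} (hM : 0 ≤ M) (y : ℝ) : |clip M y| ≤ |y| := by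
  have h := abs_clip_sub_clip_le M y 0
  have h0 : clip M 0 = 0 := by simp [clip, hM]
  simpa [h0] using h

lemma measurable_clip (M : ℝ) : Measurable (clip M) :=
  measurable_const.max (measurable_id.min measurable_const)

/-- The part cut off by the truncation is controlled by a `ν`-th moment of an envelope `t`. -/
lemma abs_sub_clip_le {M y t ν : ℝ} (hM : 0 < M) (hν : 1 ≤ ν) (hy : |y| ≤ t) :
    |y - clip M y| ≤ t ^ ν * M ^ (1 - ν) := by
  have ht : 0 ≤ t := (abs_nonneg _).trans hy
  rcases le_or_gt |y| M with h | h
  · have : clip M y = y := by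
      rw [clip, min_eq_left (abs_le.1 h).2, max_eq_right (abs_le.1 h).1]
    rw [this, sub_self, abs_zero]
    positivity
  · have htpos : 0 < t := hM.trans (h.trans_le hy)
    have h1 : |y - clip M y| ≤ |y| := by
      unfold clip
      rcases abs_cases y with ⟨h2, h3⟩ | ⟨h2, h3⟩
      · rw [min_eq_right (by linarith), max_eq_right (by linarith), h2,
          abs_of_nonneg (by linarith)]
        linarith
      · rw [min_eq_left (by linarith), max_eq_left (by linarith), h2,
          abs_of_nonpos (by linarith)]
        linarith
    calc |y - clip M y| ≤ t := h1.trans hy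
      _ = t ^ ν * t ^ (1 - ν) := by
          rw [← Real.rpow_add htpos]; simp
      _ ≤ t ^ ν * M ^ (1 - ν) := by
          refine mul_le_mul_of_nonneg_left ?_ (Real.rpow_nonneg ht _)
          exact Real.rpow_le_rpow_of_nonpos hM (by linarith) (by linarith)

/-! ### Bounds for one row of the array -/

section Row

variable {d m : ℕ} {J : ℕ → ℤ → (ℕ → (Fin m → ℝ)) → (Fin d → ℝ)} {n : ℕ}
  {P : Measure (Fin m → ℝ)} [IsProbabilityMeasure P]
  {F : Finset (Fn d)} {D : Fn d → unitInterval → ℝ} {fbar : Fn d → Fn d}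
  {L : ℕ → ℝ} {s : ℝ} {R : Fn d} {C_R C_f ν : ℝ} {p : ℝ≥0∞} {C_X : ℝ} {Δ : ℕ → ℝ} {DD : ℕ → ℝ}

lemma measurable_eval_obsPast (hJ : ∀ i : ℤ, i ≤ (n : ℤ) → Measurable (J n i)) {f : Fn d}
    (hf : Measurable f) {i : ℕ} (hi : i ∈ Finset.Icc 1 n) (u : unitInterval) :
    Measurable (fun e => f (obsPast (coordProc m) J n i e, u)) :=
  hf.comp ((measurable_obsPast_coordProc hJ
    (by exact_mod_cast (Finset.mem_Icc.1 hi).2)).prodMk measurable_const)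

omit [IsProbabilityMeasure P] in
lemma sum_integral_sq_le_normTwo (hJ : ∀ i : ℤ, i ≤ (n : ℤ) → Measurable (J n i)) {f : Fn d}
    (hf : Measurable f) (hn : 1 ≤ n) (hN : normTwo (pathLaw P) (coordProc m) J n f ≠ ∞) :
    (∀ i ∈ Finset.Icc 1 n, Integrable
      (fun e => f (obsPast (coordProc m) J n i e, gridPoint n i) ^ 2) (pathLaw P)) ∧
    ∑ i ∈ Finset.Icc 1 n,
      ∫ e, f (obsPast (coordProc m) J n i e, gridPoint n i) ^ 2 ∂(pathLaw P)
      ≤ n * (normTwo (pathLaw P) (coordProc m) J n f).toReal ^ 2 := by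
  set E2 : ℕ → ℝ≥0∞ := fun i =>
    eLpNorm (fun e => f (obsPast (coordProc m) J n i e, gridPoint n i)) 2 (pathLaw P) with hE2
  have hnpos : (0 : ℝ) < n := by exact_mod_cast hn
  have hn0 : ((n : ℝ≥0∞)⁻¹) ≠ 0 := ENNReal.inv_ne_zero.2 (ENNReal.natCast_ne_top n)
  have hdef : normTwo (pathLaw P) (coordProc m) J n f
      = ((n : ℝ≥0∞)⁻¹ * ∑ i ∈ Finset.Icc 1 n, E2 i ^ 2) ^ (1 / 2 : ℝ) := rfl
  have hX : (n : ℝ≥0∞)⁻¹ * ∑ i ∈ Finset.Icc 1 n, E2 i ^ 2 ≠ ∞ := by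
    intro hc
    rw [hdef, hc] at hN
    exact hN (ENNReal.top_rpow_of_pos (by norm_num))
  have hsum : ∑ i ∈ Finset.Icc 1 n, E2 i ^ 2 ≠ ∞ := by
    intro hc
    rw [hc, ENNReal.mul_top hn0] at hX
    exact hX rfl
  have hfin : ∀ i ∈ Finset.Icc 1 n, E2 i ≠ ∞ := by
    intro i hi hc
    have := ENNReal.sum_ne_top.1 hsum i hi
    rw [hc] at this
    exact this (by simp)
  have hone : ∀ i ∈ Finset.Icc 1 n, Integrable
      (fun e => f (obsPast (coordProc m) J n i e, gridPoint n i) ^ 2) (pathLaw P) ∧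
      ∫ e, f (obsPast (coordProc m) J n i e, gridPoint n i) ^ 2 ∂(pathLaw P)
        ≤ (E2 i).toReal ^ 2 := by
    intro i hi
    have hm := measurable_eval_obsPast hJ hf hi (gridPoint n i)
    have hE : eLpNorm (fun e => |f (obsPast (coordProc m) J n i e, gridPoint n i)|)
        (ENNReal.ofReal 2) (pathLaw P) = E2 i := by
      rw [ENNReal.ofReal_ofNat]
      exact eLpNorm_congr_norm_ae (Filter.Eventually.of_forall fun e => by simp)
    have h1 := integrable_rpow_of_eLpNorm_le (μ := pathLaw P)
      (A := fun e => |f (obsPast (coordProc m) J n i e, gridPoint n i)|) (r := 2)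
      (C := (E2 i).toReal) hm.abs (fun _ => abs_nonneg _) (by norm_num) ENNReal.toReal_nonneg
      (by rw [hE, ENNReal.ofReal_toReal (hfin i hi)])
    simpa only [Real.rpow_ofNat, sq_abs] using h1
  refine ⟨fun i hi => (hone i hi).1, (Finset.sum_le_sum fun i hi => (hone i hi).2).trans ?_⟩
  have h3 : (normTwo (pathLaw P) (coordProc m) J n f).toReal ^ 2
      = (n : ℝ)⁻¹ * ∑ i ∈ Finset.Icc 1 n, (E2 i).toReal ^ 2 := by
    rw [hdef, ← ENNReal.toReal_rpow, ← Real.sqrt_eq_rpow, Real.sq_sqrt ENNReal.toReal_nonneg, ENNReal.toReal_mul,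
      ENNReal.toReal_sum fun i hi => ENNReal.pow_ne_top (hfin i hi)]
    simp [ENNReal.toReal_pow]
  rw [h3, mul_inv_cancel_left₀ hnpos.ne']

/-- The lag coefficients of one function: `‖f‖_{2,n}` at lag `0` and `min (‖f‖_{2,n}, 𝔻_n Δ(k))`
at lag `k ≥ 1`. -/
noncomputable def lagCoeff (N DDn : ℝ) (Δ : ℕ → ℝ) (k : ℕ) : ℝ :=
  if k = 0 then N else min N (DDn * Δ k)

omit [IsProbabilityMeasure P] in
lemma sum_lagCoeff_le {f : Fn d} {σ : ℝ} (hσ : 0 < σ) (hDD : 0 ≤ DD n) (hΔ : ∀ k, 0 ≤ Δ k)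
    (hV : V (pathLaw P) (coordProc m) J Δ DD n f ≤ ENNReal.ofReal σ) (q : ℕ) :
    ∑ k ∈ Finset.range (q + 1),
      lagCoeff (normTwo (pathLaw P) (coordProc m) J n f).toReal (DD n) Δ k ≤ σ := by
  set N := normTwo (pathLaw P) (coordProc m) J n f with hN
  have hNtop : N ≠ ∞ := ne_top_of_le_ne_top ENNReal.ofReal_ne_top (le_self_add.trans hV)
  have hnn : ∀ k, 0 ≤ min N.toReal (DD n * Δ (k + 1)) := fun k =>
    le_min ENNReal.toReal_nonneg (mul_nonneg hDD (hΔ _))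
  rw [Finset.sum_range_succ']
  simp only [lagCoeff, Nat.add_eq_zero_iff, one_ne_zero, and_false, if_false, if_true]
  rw [← ENNReal.ofReal_le_ofReal_iff hσ.le]
  refine le_trans ?_ hV
  rw [ENNReal.ofReal_add (Finset.sum_nonneg fun k _ => hnn k) ENNReal.toReal_nonneg,
    ENNReal.ofReal_toReal hNtop, ENNReal.ofReal_sum_of_nonneg fun k _ => hnn k, add_comm]
  refine add_le_add le_rfl (le_trans (Finset.sum_le_sum fun k _ => ?_)
    (ENNReal.sum_le_tsum (Finset.range q)))
  rw [ENNReal.ofReal_min, ENNReal.ofReal_toReal hNtop]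

/-- The truncated class satisfies the maximal inequality for bounded functionals. -/
lemma Compatible.expMax_clip_le
    (h : Compatible (pathLaw P) (coordProc m) J n F D fbar L s R C_R C_f ν p C_X Δ (DD n))
    (hJ : ∀ i : ℤ, i ≤ (n : ℤ) → Measurable (J n i)) (hF : F.Nonempty) (hn : 1 ≤ n)
    (hΔ : ∀ k, 0 ≤ Δ k) (hΔs : Summable Δ) (hDD : 0 ≤ DD n) {D2 σ M : ℝ} {q : ℕ} (hq : 1 ≤ q)
    (hD2 : supDMean F D 2 n ≤ D2) (hσ : 0 < σ)
    (hV : ∀ f ∈ F, V (pathLaw P) (coordProc m) J Δ DD n f ≤ ENNReal.ofReal σ) (hM : 0 ≤ M) :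
    expMax (pathLaw P) (fun (f : {f // f ∈ F}) e => ∑ i ∈ Finset.Icc 1 n,
      (clip M (f.1 (obsPast (coordProc m) J n i e, gridPoint n i))
        - ∫ e', clip M (f.1 (obsPast (coordProc m) J n i e', gridPoint n i)) ∂(pathLaw P)))
      ≤ 4 * Real.sqrt (entropyH F) * (Real.sqrt n * D2 * betaTail Δ q)
        + (8 * (entropyH F * M * q) + 12 * Real.sqrt (entropyH F) * (Real.sqrt n * σ)) := by
  have : Nonempty {f // f ∈ F} := by obtain ⟨f, hf⟩ := hF; exact ⟨⟨f, hf⟩⟩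
  have hnpos : (0 : ℝ) < n := by exact_mod_cast hn
  have hD20 : 0 ≤ D2 := (supDMean_nonneg 2).trans hD2
  set g : ℕ → {f // f ∈ F} → (ℤ → (Fin m → ℝ)) → ℝ := fun i f e =>
    clip M (f.1 (obsPast (coordProc m) J n i e, gridPoint n i)) with hg
  have hgb : ∀ i ∈ Finset.Icc 1 n, ∀ f, BddMeasurable (g i f) := fun i hi f =>
    ⟨(measurable_clip M).comp (measurable_eval_obsPast hJ (h.f_measurable f.1 f.2) hi _), M,
      fun e => abs_clip_le hM _⟩
  have hgd : ∀ i ∈ Finset.Icc 1 n, ∀ f, DependsOn (g i f) (Set.Iic (i : ℤ)) := by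
    intro i _ f x y hxy
    simp only [hg]
    rw [dependsOn_obsPast_coordProc (i : ℤ) hxy]
  have hres1 : ∀ i : ℕ, ∀ f : {f // f ∈ F}, ∀ (k : ℕ) (w : (ℤ → (Fin m → ℝ)) × (ℤ → (Fin m → ℝ))),
      (g i f w.1 - g i f (splice {(i : ℤ) - (k : ℤ)}ᶜ w.1 w.2)) ^ 2
        ≤ |D f.1 (gridPoint n i)| ^ 2 * resampleEnv J n L s R i k (gridPoint n i) w ^ 2 := by
    intro i f k w
    rw [← mul_pow, ← sq_abs]
    exact pow_le_pow_left₀ (abs_nonneg _) ((abs_clip_sub_clip_le _ _ _).trans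
      (h.abs_sub_le_resampleEnv f.2 i k (gridPoint n i) w)) 2
  have hresb : ∀ i ∈ Finset.Icc 1 n, ∀ f (k : ℕ), BddMeasurable
      (fun w : (ℤ → (Fin m → ℝ)) × (ℤ → (Fin m → ℝ)) =>
        (g i f w.1 - g i f (splice {(i : ℤ) - (k : ℤ)}ᶜ w.1 w.2)) ^ 2) := fun i hi f k =>
    (((hgb i hi f).comp measurable_fst).sub ((hgb i hi f).comp_splice _)).sq
  refine expMax_centered_sum_le P n q hq (g := g) hM hgb (fun i _ f e => abs_clip_le hM _) hgd
    (w := fun k => Real.sqrt n * D2 * Δ k)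
    (c := fun f k => Real.sqrt n *
      lagCoeff (normTwo (pathLaw P) (coordProc m) J n f.1).toReal (DD n) Δ k)
    one_le_entropyH (log_two_mul_card_le hF)
    (fun k => mul_nonneg (mul_nonneg (Real.sqrt_nonneg _) hD20) (hΔ k)) (fun k => ?_)
    (fun N => ?_) (fun f k => ?_) (by positivity) (fun f k hk => ?_) (fun f => ?_)
  · calc _ ≤ ∑ i ∈ Finset.Icc 1 n, supD F D (gridPoint n i) ^ 2 * Δ k ^ 2 := by
          refine Finset.sum_le_sum fun i hi => ?_
          obtain ⟨h1, h2⟩ := h.integral_sq_resampleEnv_le hJ hi k (gridPoint n i) (hΔ k)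
          calc _ ≤ ∫ w, supD F D (gridPoint n i) ^ 2
                * resampleEnv J n L s R i k (gridPoint n i) w ^ 2
                  ∂((pathLaw P).prod (pathLaw P)) := by
                refine integral_mono ((BddMeasurable.iSup fun f => hresb i hi f k).integrable _)
                  (h1.const_mul _) fun w => ciSup_le fun f => (hres1 i f k w).trans ?_
                exact mul_le_mul_of_nonneg_right
                  (pow_le_pow_left₀ (abs_nonneg _) (abs_le_supD f.2 _) 2) (sq_nonneg _)
            _ ≤ _ := by
                rw [integral_const_mul]
                exact mul_le_mul_of_nonneg_left h2 (sq_nonneg _)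
      _ ≤ (n * D2 ^ 2) * Δ k ^ 2 := by
          rw [← Finset.sum_mul]
          have h3 := sum_supD_rpow_le hn (by norm_num) hD2
          simp only [Real.rpow_ofNat] at h3
          exact mul_le_mul_of_nonneg_right h3 (sq_nonneg _)
      _ = (Real.sqrt n * D2 * Δ k) ^ 2 := by
          rw [mul_pow, mul_pow, Real.sq_sqrt hnpos.le]
  · rw [← Finset.mul_sum]
    exact mul_le_mul_of_nonneg_left (sum_Ico_le_betaTail hΔ hΔs q N)
      (mul_nonneg (Real.sqrt_nonneg _) hD20)
  · refine mul_nonneg (Real.sqrt_nonneg _) ?_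
    unfold lagCoeff
    split_ifs
    · exact ENNReal.toReal_nonneg
    · exact le_min ENNReal.toReal_nonneg (mul_nonneg hDD (hΔ _))
  · have hNtop : normTwo (pathLaw P) (coordProc m) J n f.1 ≠ ∞ :=
      ne_top_of_le_ne_top ENNReal.ofReal_ne_top (le_self_add.trans (hV f.1 f.2))
    obtain ⟨hint, hsum⟩ := sum_integral_sq_le_normTwo hJ (h.f_measurable f.1 f.2) hn hNtop
    set N := (normTwo (pathLaw P) (coordProc m) J n f.1).toReal with hN
    have hA : ∑ i ∈ Finset.Icc 1 n,
        ∫ e, diffFrom P ((i : ℤ) - (k : ℤ)) (g i f) e ^ 2 ∂(pathLaw P) ≤ n * N ^ 2 := by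
      refine (Finset.sum_le_sum fun i hi => ?_).trans hsum
      refine (integral_sq_diffFrom_le P (hgb i hi f)).trans
        (integral_mono ((hgb i hi f).sq.integrable _) (hint i hi) fun e => ?_)
      exact sq_le_sq.2 (abs_clip_le_abs hM _)
    have hB : ∑ i ∈ Finset.Icc 1 n,
        ∫ e, diffFrom P ((i : ℤ) - (k : ℤ)) (g i f) e ^ 2 ∂(pathLaw P)
          ≤ n * (DD n * Δ k) ^ 2 := by
      calc _ ≤ ∑ i ∈ Finset.Icc 1 n, |D f.1 (gridPoint n i)| ^ 2 * Δ k ^ 2 := by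
            refine Finset.sum_le_sum fun i hi => ?_
            obtain ⟨h1, h2⟩ := h.integral_sq_resampleEnv_le hJ hi k (gridPoint n i) (hΔ k)
            refine (integral_sq_diffFrom_le_resample P (hgb i hi f) _).trans ?_
            refine (integral_mono ((hresb i hi f k).integrable _) (h1.const_mul _)
              (hres1 i f k)).trans ?_
            rw [integral_const_mul]
            exact mul_le_mul_of_nonneg_left h2 (sq_nonneg _)
        _ ≤ (n * DD n ^ 2) * Δ k ^ 2 := by
            rw [← Finset.sum_mul]
            refine mul_le_mul_of_nonneg_right ?_ (sq_nonneg _)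
            have h3 := (Real.sqrt_le_left hDD).1 (h.D_bound f.1 f.2)
            rwa [one_div, inv_mul_le_iff₀ hnpos] at h3
        _ = n * (DD n * Δ k) ^ 2 := by ring
    rw [mul_pow, Real.sq_sqrt hnpos.le]
    unfold lagCoeff
    split_ifs
    · exact hA
    · rcases min_choice N (DD n * Δ k) with h4 | h4 <;> rw [h4]
      · exact hA
      · exact hB
  · rw [← Finset.mul_sum]
    exact mul_le_mul_of_nonneg_left (sum_lagCoeff_le hσ hDD hΔ (hV f.1 f.2) q)
      (Real.sqrt_nonneg _)

/-- Tail bound for one row: Markov's inequality for the truncated class, plus the part cut off. -/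
lemma Compatible.measure_iSup_empProc_le
    (h : Compatible (pathLaw P) (coordProc m) J n F D fbar L s R C_R C_f ν p C_X Δ (DD n))
    (hJ : ∀ i : ℤ, i ≤ (n : ℤ) → Measurable (J n i)) (hF : F.Nonempty) (hn : 1 ≤ n)
    {Dν M B t : ℝ} (hDν : supDMean F D ν n ≤ Dν) (hM : 0 < M) (ht : 0 < t)
    (hB : expMax (pathLaw P) (fun (f : {f // f ∈ F}) e => ∑ i ∈ Finset.Icc 1 n,
      (clip M (f.1 (obsPast (coordProc m) J n i e, gridPoint n i))
        - ∫ e', clip M (f.1 (obsPast (coordProc m) J n i e', gridPoint n i)) ∂(pathLaw P))) ≤ B) :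
    pathLaw P {e | t < |(⨆ f : {f // f ∈ F}, |empProc (pathLaw P) (coordProc m) J n f e|)|}
      ≤ ENNReal.ofReal ((B + 2 * (CDelta d L s C_X C_R C_f ^ ν * (n * Dν ^ ν) * M ^ (1 - ν)))
          / (Real.sqrt n * t)) := by
  have : Nonempty {f // f ∈ F} := by obtain ⟨f, hf⟩ := hF; exact ⟨⟨f, hf⟩⟩
  have hnpos : (0 : ℝ) < n := by exact_mod_cast hn
  have hsn : 0 < Real.sqrt n := Real.sqrt_pos.2 hnpos
  have hν2 := h.two_le
  set g : ℕ → {f // f ∈ F} → (ℤ → (Fin m → ℝ)) → ℝ := fun i f e =>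
    clip M (f.1 (obsPast (coordProc m) J n i e, gridPoint n i)) with hg
  have hgb : ∀ i ∈ Finset.Icc 1 n, ∀ f, BddMeasurable (g i f) := fun i hi f =>
    ⟨(measurable_clip M).comp (measurable_eval_obsPast hJ (h.f_measurable f.1 f.2) hi _), M,
      fun e => abs_clip_le hM.le _⟩
  set ρ : ℕ → (ℤ → (Fin m → ℝ)) → ℝ := fun i e =>
    (supD F D (gridPoint n i) * envelope J n L s R C_R C_f i (gridPoint n i) e) ^ ν
      * M ^ (1 - ν) with hρ
  have henv0 : ∀ (i : ℕ) e, 0 ≤ envelope J n L s R C_R C_f i (gridPoint n i) e :=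
    fun i e => h.envelope_nonneg i _ e
  have hρ0 : ∀ i e, 0 ≤ ρ i e := fun i e => by
    have := henv0 i e
    have := supD_nonneg (F := F) (D := D) (gridPoint n i)
    simp only [hρ]
    positivity
  have hρeq : ∀ i, ρ i = fun e => supD F D (gridPoint n i) ^ ν * M ^ (1 - ν)
      * envelope J n L s R C_R C_f i (gridPoint n i) e ^ ν := fun i => by
    funext e
    simp only [hρ]
    rw [Real.mul_rpow (supD_nonneg _) (henv0 i e)]
    ring
  have hρint : ∀ i ∈ Finset.Icc 1 n, Integrable (ρ i) (pathLaw P) ∧ ∫ e, ρ i e ∂(pathLaw P)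
      ≤ supD F D (gridPoint n i) ^ ν * M ^ (1 - ν) * CDelta d L s C_X C_R C_f ^ ν := by
    intro i hi
    obtain ⟨h1, h2⟩ := integrable_rpow_of_eLpNorm_le (h.measurable_envelope hJ hi (gridPoint n i))
      (henv0 i) (by linarith) h.CDelta_pos.le (h.eLpNorm_envelope_le hJ hi (gridPoint n i))
    rw [hρeq i]
    refine ⟨h1.const_mul _, ?_⟩
    rw [integral_const_mul]
    exact mul_le_mul_of_nonneg_left h2 (mul_nonneg (Real.rpow_nonneg (supD_nonneg _) _)
      (Real.rpow_nonneg hM.le _))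
  have hae : ∀ᵐ e ∂(pathLaw P), ∀ i ∈ Finset.Icc 1 n, ∀ f : {f // f ∈ F},
      |f.1 (obsPast (coordProc m) J n i e, gridPoint n i) - g i f e| ≤ ρ i e := by
    rw [Filter.eventually_all_finset]
    intro i hi
    filter_upwards [h.ae_summable hJ hi] with e he f
    refine abs_sub_clip_le hM (by linarith) ((h.abs_le_envelope f.2 i (gridPoint n i) he).trans ?_)
    exact mul_le_mul_of_nonneg_right (abs_le_supD f.2 _) (henv0 i e)
  have hfint : ∀ i ∈ Finset.Icc 1 n, ∀ f : {f // f ∈ F}, Integrable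
      (fun e => f.1 (obsPast (coordProc m) J n i e, gridPoint n i) - g i f e) (pathLaw P) := by
    intro i hi f
    refine (hρint i hi).1.mono' ((measurable_eval_obsPast hJ (h.f_measurable f.1 f.2) hi _).sub
      (hgb i hi f).measurable).aestronglyMeasurable ?_
    filter_upwards [hae] with e he
    exact he i hi f
  set A : (ℤ → (Fin m → ℝ)) → ℝ := fun e => ⨆ f : {f // f ∈ F}, |∑ i ∈ Finset.Icc 1 n,
    (g i f e - ∫ e', g i f e' ∂(pathLaw P))| with hA
  have hAb : BddMeasurable A := BddMeasurable.iSup fun f =>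
    (BddMeasurable.sum _ fun i hi => (hgb i hi f).sub (BddMeasurable.const _)).abs
  set W : (ℤ → (Fin m → ℝ)) → ℝ := fun e => A e + ∑ i ∈ Finset.Icc 1 n,
    (ρ i e + ∫ e', ρ i e' ∂(pathLaw P)) with hW
  have hρc : ∀ i ∈ Finset.Icc 1 n,
      Integrable (fun e => ρ i e + ∫ e', ρ i e' ∂(pathLaw P)) (pathLaw P) := fun i hi =>
    (hρint i hi).1.add (integrable_const _)
  have hWint : Integrable W (pathLaw P) := (hAb.integrable _).add (integrable_finsetSum _ hρc)
  have hW0 : ∀ e, 0 ≤ W e := fun e => add_nonneg (Real.iSup_nonneg fun _ => abs_nonneg _)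
    (Finset.sum_nonneg fun i _ => add_nonneg (hρ0 i e) (integral_nonneg (hρ0 i)))
  have hWbound : ∫ e, W e ∂(pathLaw P)
      ≤ B + 2 * (CDelta d L s C_X C_R C_f ^ ν * (n * Dν ^ ν) * M ^ (1 - ν)) := by
    have hWeq : ∫ e, W e ∂(pathLaw P) = ∫ e, A e ∂(pathLaw P)
        + ∑ i ∈ Finset.Icc 1 n, ∫ e, (ρ i e + ∫ e', ρ i e' ∂(pathLaw P)) ∂(pathLaw P) := by
      rw [← integral_finsetSum _ hρc]
      exact integral_add (hAb.integrable _) (integrable_finsetSum _ hρc)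
    rw [hWeq]
    refine add_le_add hB ?_
    calc _ ≤ ∑ i ∈ Finset.Icc 1 n, 2 * (supD F D (gridPoint n i) ^ ν * M ^ (1 - ν)
            * CDelta d L s C_X C_R C_f ^ ν) := by
          refine Finset.sum_le_sum fun i hi => ?_
          rw [integral_add (hρint i hi).1 (integrable_const _)]
          simp only [integral_const, probReal_univ, smul_eq_mul, one_mul]
          linarith [(hρint i hi).2]
      _ = 2 * (CDelta d L s C_X C_R C_f ^ ν * (∑ i ∈ Finset.Icc 1 n,
            supD F D (gridPoint n i) ^ ν) * M ^ (1 - ν)) := by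
          rw [← Finset.mul_sum, ← Finset.sum_mul, ← Finset.sum_mul]; ring
      _ ≤ _ := by
          have h1 := sum_supD_rpow_le hn (by linarith) hDν
          have h2 : 0 ≤ CDelta d L s C_X C_R C_f ^ ν := Real.rpow_nonneg h.CDelta_pos.le _
          have h3 : 0 ≤ M ^ (1 - ν) := Real.rpow_nonneg hM.le _
          gcongr
  have hdom : ∀ᵐ e ∂(pathLaw P), |(⨆ f : {f // f ∈ F},
      |empProc (pathLaw P) (coordProc m) J n f e|)| ≤ 1 / Real.sqrt n * W e := by
    filter_upwards [hae] with e he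
    rw [abs_of_nonneg (Real.iSup_nonneg fun _ => abs_nonneg _)]
    refine ciSup_le fun f => ?_
    unfold empProc
    rw [abs_mul, abs_of_pos (by positivity : 0 < 1 / Real.sqrt n)]
    refine mul_le_mul_of_nonneg_left ?_ (by positivity)
    have hsplit : ∑ i ∈ Finset.Icc 1 n, (f.1 (obsPast (coordProc m) J n i e, gridPoint n i)
          - ∫ e', f.1 (obsPast (coordProc m) J n i e', gridPoint n i) ∂(pathLaw P))
        = ∑ i ∈ Finset.Icc 1 n, (g i f e - ∫ e', g i f e' ∂(pathLaw P))
          + ∑ i ∈ Finset.Icc 1 n,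
            ((f.1 (obsPast (coordProc m) J n i e, gridPoint n i) - g i f e)
            - ∫ e', (f.1 (obsPast (coordProc m) J n i e', gridPoint n i) - g i f e')
                ∂(pathLaw P)) := by
      rw [← Finset.sum_add_distrib]
      refine Finset.sum_congr rfl fun i hi => ?_
      have h1 := integral_add (hfint i hi f) ((hgb i hi f).integrable (pathLaw P))
      simp only [sub_add_cancel] at h1
      rw [h1]
      ring
    rw [hsplit]
    refine (abs_add_le _ _).trans (add_le_add (le_iSup_of_finite (fun f : {f // f ∈ F} =>
      |∑ i ∈ Finset.Icc 1 n, (g i f e - ∫ e', g i f e' ∂(pathLaw P))|) f) ?_)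
    refine (Finset.abs_sum_le_sum_abs _ _).trans (Finset.sum_le_sum fun i hi => ?_)
    refine (abs_sub _ _).trans (add_le_add (he i hi f) ?_)
    have h2 := norm_integral_le_integral_norm (μ := pathLaw P)
      (fun e' => f.1 (obsPast (coordProc m) J n i e', gridPoint n i) - g i f e')
    refine h2.trans (integral_mono_ae (hfint i hi f).norm (hρint i hi).1 ?_)
    filter_upwards [hae] with e' he'
    exact he' i hi f
  have hst : 0 < Real.sqrt n * t := by positivity
  calc pathLaw P {e | t < |(⨆ f : {f // f ∈ F}, |empProc (pathLaw P) (coordProc m) J n f e|)|}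
      ≤ pathLaw P {e | Real.sqrt n * t ≤ W e} := by
        refine measure_mono_ae ?_
        filter_upwards [hdom] with e he hlt
        have h1 : t < 1 / Real.sqrt n * W e := lt_of_lt_of_le hlt he
        rw [one_div, lt_inv_mul_iff₀ hsn] at h1
        exact h1.le
    _ = ENNReal.ofReal ((pathLaw P).real {e | Real.sqrt n * t ≤ W e}) :=
        (ofReal_measureReal (measure_ne_top _ _)).symm
    _ ≤ _ := by
        refine ENNReal.ofReal_le_ofReal ?_
        rw [le_div_iff₀ hst, mul_comm]
        exact (mul_meas_ge_le_integral_of_nonneg (Filter.Eventually.of_forall hW0) hWint _).trans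
          hWbound

end Row

/-! ### The rate -/

/-- With the truncation level `M = √n x 𝔻^∞_n / √H`, every term of the row bound is of order
`√(n H)`; the constant does not depend on the row. -/
lemma Compatible.measure_iSup_empProc_le_const {d m : ℕ}
    {J : ℕ → ℤ → (ℕ → (Fin m → ℝ)) → (Fin d → ℝ)} {n : ℕ} {P : Measure (Fin m → ℝ)}
    [IsProbabilityMeasure P] {F : Finset (Fn d)} {D : Fn d → unitInterval → ℝ}
    {fbar : Fn d → Fn d} {L : ℕ → ℝ} {s : ℝ} {R : Fn d} {C_R C_f ν : ℝ} {p : ℝ≥0∞} {C_X : ℝ}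
    {Δ : ℕ → ℝ} {DD : ℕ → ℝ}
    (h : Compatible (pathLaw P) (coordProc m) J n F D fbar L s R C_R C_f ν p C_X Δ (DD n))
    (hJ : ∀ i : ℤ, i ≤ (n : ℤ) → Measurable (J n i)) (hF : F.Nonempty) (hn : 1 ≤ n)
    (hΔ : ∀ k, 0 ≤ Δ k) (hΔs : Summable Δ) (hDD : 0 ≤ DD n) {D2 Dν σ K₁ K₂ : ℝ}
    (hD2 : supDMean F D 2 n ≤ D2) (hDν : supDMean F D ν n ≤ Dν) (hD2pos : 0 < D2) (hσ : 0 < σ)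
    (hV : ∀ f ∈ F, V (pathLaw P) (coordProc m) J Δ DD n f ≤ ENNReal.ofReal σ)
    (hK₁ : Dν / D2 ≤ K₁)
    (hK₂ : CDelta d L s C_X C_R C_f * entropyH F
      / ((n : ℝ) ^ (1 - 2 / ν) * rFun Δ (σ / D2) ^ 2) ≤ K₂) {t : ℝ} (ht : 0 < t) :
    pathLaw P {e | t * Real.sqrt (entropyH F)
        < |(⨆ f : {f // f ∈ F}, |empProc (pathLaw P) (coordProc m) J n f e|)|}
      ≤ ENNReal.ofReal ((24 * σ + 2 * (CDelta d L s C_X C_R C_f ^ ν * K₁ ^ ν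
          * ((4 * K₂ / CDelta d L s C_X C_R C_f) ^ (ν / 2) * σ))) / t) := by
  have hν := h.two_le
  have hnpos : (0 : ℝ) < n := by exact_mod_cast hn
  have hsn : 0 < Real.sqrt n := Real.sqrt_pos.2 hnpos
  set C := CDelta d L s C_X C_R C_f with hC
  have hCpos : 0 < C := h.CDelta_pos
  set H := entropyH F with hH
  have hH1 : 1 ≤ H := one_le_entropyH
  have hsH : 0 < Real.sqrt H := Real.sqrt_pos.2 (by linarith)
  obtain ⟨hr, x, hx, hrx, q, hq, hβ, hqx⟩ := exists_admissible Δ (div_pos hσ hD2pos)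
  set r := rFun Δ (σ / D2) with hrdef
  have hq1 : (1 : ℝ) ≤ q := by exact_mod_cast hq
  have hqxD : (q : ℝ) * x * D2 ≤ σ := (le_div_iff₀ hD2pos).1 hqx
  have hxD : x * D2 ≤ σ := by
    refine le_trans ?_ hqxD
    have : 0 < x * D2 := by positivity
    nlinarith
  have hDν0 : 0 ≤ Dν := (supDMean_nonneg ν).trans hDν
  have hDνK : Dν ≤ K₁ * D2 := (div_le_iff₀ hD2pos).1 hK₁
  have hK₁0 : 0 ≤ K₁ := le_trans (by positivity) hK₁
  set M := Real.sqrt n * x * D2 / Real.sqrt H with hM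
  have hMpos : 0 < M := by positivity
  -- the rate condition, with `x ≥ r / 2` in place of `r`
  have hT : H / ((n : ℝ) ^ (1 - 2 / ν) * x ^ 2) ≤ 4 * K₂ / C := by
    have hN : 0 < (n : ℝ) ^ (1 - 2 / ν) := Real.rpow_pos_of_pos hnpos _
    rw [div_le_iff₀ (by positivity)] at hK₂
    have hK₂0 : 0 ≤ K₂ := by
      by_contra hneg
      have : K₂ * ((n : ℝ) ^ (1 - 2 / ν) * r ^ 2) < 0 := mul_neg_of_neg_of_pos (by linarith)
        (by positivity)
      nlinarith
    have h1 : r ^ 2 ≤ 4 * x ^ 2 := by nlinarith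
    rw [div_le_div_iff₀ (by positivity) hCpos]
    calc H * C = C * H := mul_comm _ _
      _ ≤ K₂ * ((n : ℝ) ^ (1 - 2 / ν) * r ^ 2) := hK₂
      _ ≤ K₂ * ((n : ℝ) ^ (1 - 2 / ν) * (4 * x ^ 2)) := by gcongr
      _ = 4 * K₂ * ((n : ℝ) ^ (1 - 2 / ν) * x ^ 2) := by ring
  have hbal := truncation_moment_le hnpos hH1 hx hD2pos hν hT hxD
  have hmain := h.expMax_clip_le hJ hF hn hΔ hΔs hDD hq hD2 hσ hV hMpos.le
  have hbd : 4 * Real.sqrt H * (Real.sqrt n * D2 * betaTail Δ q)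
        + (8 * (H * M * q) + 12 * Real.sqrt H * (Real.sqrt n * σ))
      ≤ 24 * σ * (Real.sqrt n * Real.sqrt H) := by
    have h1 : D2 * betaTail Δ q ≤ σ := by
      calc D2 * betaTail Δ q ≤ D2 * (q * x) := mul_le_mul_of_nonneg_left hβ hD2pos.le
        _ = q * x * D2 := by ring
        _ ≤ σ := hqxD
    have h2 : H * M * q = Real.sqrt n * Real.sqrt H * (q * x * D2) := by
      have : H = Real.sqrt H * Real.sqrt H := (Real.mul_self_sqrt (by linarith)).symm
      rw [hM]
      nth_rewrite 1 [this]
      field_simp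
    have h3 : 0 ≤ Real.sqrt n * Real.sqrt H := by positivity
    have h4 := mul_le_mul_of_nonneg_left h1 h3
    have h5 := mul_le_mul_of_nonneg_left hqxD h3
    rw [h2]
    linarith
  refine (h.measure_iSup_empProc_le hJ hF hn hDν hMpos (t := t * Real.sqrt H) (by positivity)
    (hmain.trans hbd)).trans (ENNReal.ofReal_le_ofReal ?_)
  have hres : C ^ ν * (n * Dν ^ ν) * M ^ (1 - ν)
      ≤ C ^ ν * K₁ ^ ν * ((4 * K₂ / C) ^ (ν / 2) * σ) * (Real.sqrt n * Real.sqrt H) := by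
    have h1 : Dν ^ ν ≤ K₁ ^ ν * D2 ^ ν := by
      rw [← Real.mul_rpow hK₁0 hD2pos.le]
      exact Real.rpow_le_rpow hDν0 hDνK (by linarith)
    have h2 : 0 ≤ C ^ ν := Real.rpow_nonneg hCpos.le _
    have h3 : 0 ≤ K₁ ^ ν := Real.rpow_nonneg hK₁0 _
    have h4 : 0 ≤ M ^ (1 - ν) := Real.rpow_nonneg hMpos.le _
    calc C ^ ν * (n * Dν ^ ν) * M ^ (1 - ν)
        ≤ C ^ ν * (n * (K₁ ^ ν * D2 ^ ν)) * M ^ (1 - ν) := by gcongr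
      _ = C ^ ν * K₁ ^ ν * (n * D2 ^ ν * M ^ (1 - ν)) := by ring
      _ ≤ C ^ ν * K₁ ^ ν * ((4 * K₂ / C) ^ (ν / 2) * σ * (Real.sqrt n * Real.sqrt H)) :=
          mul_le_mul_of_nonneg_left hbal (mul_nonneg h2 h3)
      _ = _ := by ring
  rw [div_le_div_iff₀ (by positivity) ht]
  calc _ ≤ (24 * σ * (Real.sqrt n * Real.sqrt H)
        + 2 * (C ^ ν * K₁ ^ ν * ((4 * K₂ / C) ^ (ν / 2) * σ) * (Real.sqrt n * Real.sqrt H))) * t := by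
        gcongr
    _ = _ := by ring

end FDep

theorem mainTheorem1 {Ω : Type*} [MeasurableSpace Ω] (μ : Measure Ω) [IsProbabilityMeasure μ]
    {d m : ℕ}
    -- innovations and the array `X_i = J_{i,n}(ε_i, ε_{i-1}, …)`
    (ε : ℤ → Ω → (Fin m → ℝ)) (hε : FDep.IsIID μ ε)
    (J : ℕ → ℤ → (ℕ → (Fin m → ℝ)) → (Fin d → ℝ))
    (hJ : ∀ n : ℕ, 1 ≤ n → ∀ i : ℤ, i ≤ (n : ℤ) → Measurable (J n i))
    -- the finite classes and the decompositions `f = D_{f,n} · fbar`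
    (F : ℕ → Finset (FDep.Fn d)) (D : ℕ → FDep.Fn d → unitInterval → ℝ)
    (fbar : ℕ → FDep.Fn d → FDep.Fn d)
    -- the sequences `Δ` and `𝔻_n`
    (Δ : ℕ → ℝ) (hΔ_nonneg : ∀ k, 0 ≤ Δ k) (hΔ_anti : Antitone Δ) (hΔ_sum : Summable Δ)
    (DD : ℕ → ℝ) (hDD : ∀ n, 1 ≤ n → 0 ≤ DD n)
    -- the compatibility condition
    (L : ℕ → ℝ) (s : ℝ) (R : ℕ → FDep.Fn d) (C_R C_f ν : ℝ) (p : ENNReal) (C_X : ℝ)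
    (hF : ∀ n, 1 ≤ n →
      FDep.Compatible μ ε J n (F n) (D n) (fbar n) L s (R n) C_R C_f ν p C_X Δ (DD n))
    -- `Dinf κ n` is `𝔻^∞_{κ,n}`, needed for `κ = 2` and `κ = ν`
    (Dinf : ℝ → ℕ → ℝ)
    (hDinf_two : ∀ n, 1 ≤ n → FDep.supDMean (F n) (D n) 2 n ≤ Dinf 2 n)
    (hDinf_nu : ∀ n, 1 ≤ n → FDep.supDMean (F n) (D n) ν n ≤ Dinf ν n)
    (hDinf_pos : ∀ n, 1 ≤ n → 0 < Dinf 2 n)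
    -- `sup_n sup_f V(f) ≤ σ < ∞`
    (σ : ℝ) (hσ : 0 < σ)
    (hV : ∀ n, 1 ≤ n → ∀ f ∈ F n, FDep.V μ ε J Δ DD n f ≤ ENNReal.ofReal σ)
    -- `sup_n 𝔻^∞_{ν,n} / 𝔻^∞_n < ∞`
    (hratio : ∃ K : ℝ, ∀ n, 1 ≤ n → Dinf ν n / Dinf 2 n ≤ K)
    -- `sup_n C_Δ H / (n^{1 - 2/ν} r(σ / 𝔻^∞_n)^2) < ∞`
    (hrate : ∃ K : ℝ, ∀ n : ℕ, 1 ≤ n →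
      FDep.CDelta d L s C_X C_R C_f * FDep.entropyH (F n)
        / ((n : ℝ) ^ (1 - 2 / ν) * FDep.rFun Δ (σ / Dinf 2 n) ^ 2) ≤ K) :
    FDep.IsBigOp μ (fun n ω => ⨆ f : {f // f ∈ F n}, |FDep.empProc μ ε J n f ω|)
      (fun n => Real.sqrt (FDep.entropyH (F n))) := by
  intro η hη
  obtain ⟨K₁, hK₁⟩ := hratio
  obtain ⟨K₂, hK₂⟩ := hrate
  set A : ℝ := 24 * σ + 2 * (FDep.CDelta d L s C_X C_R C_f ^ ν * K₁ ^ ν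
    * ((4 * K₂ / FDep.CDelta d L s C_X C_R C_f) ^ (ν / 2) * σ)) with hA
  have hKpos : 0 < (|A| + 1) / η := by positivity
  refine ⟨(|A| + 1) / η, hKpos, fun n hn => ?_⟩
  rcases (F n).eq_empty_or_nonempty with hF0 | hF0
  · have : IsEmpty {f // f ∈ F n} := by
      rw [hF0]
      exact ⟨fun f => Finset.notMem_empty _ f.2⟩
    have hempty : {ω | (|A| + 1) / η * Real.sqrt (FDep.entropyH (F n))
        < |(⨆ f : {f // f ∈ F n}, |FDep.empProc μ ε J n f ω|)|} = ∅ := by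
      refine Set.eq_empty_of_forall_notMem fun ω hω => ?_
      rw [Set.mem_ofPred_eq, Real.iSup_of_isEmpty, abs_zero] at hω
      exact absurd hω (not_lt.2 (mul_nonneg hKpos.le (Real.sqrt_nonneg _)))
    rw [hempty, measure_empty]
    exact zero_le
  · have hP : IsProbabilityMeasure (μ.map (ε 0)) :=
      Measure.isProbabilityMeasure_map (hε.measurable 0).aemeasurable
    have hJn := hJ n hn
    have hmeas := (hF n hn).f_measurable
    have hrow := ((hF n hn).to_pathLaw hε hJn).measure_iSup_empProc_le_const hJn hF0 hn hΔ_nonneg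
      hΔ_sum (hDD n hn) (hDinf_two n hn) (hDinf_nu n hn) (hDinf_pos n hn) hσ
      (fun f hf => by
        unfold FDep.V
        rw [FDep.normTwo_coordProc hε hJn (hmeas f hf)]
        exact hV n hn f hf)
      (hK₁ n hn) (hK₂ n hn) hKpos
    have hpre : {ω | (|A| + 1) / η * Real.sqrt (FDep.entropyH (F n))
        < |(⨆ f : {f // f ∈ F n}, |FDep.empProc μ ε J n f ω|)|}
        = (fun ω t => ε t ω) ⁻¹' {e | (|A| + 1) / η * Real.sqrt (FDep.entropyH (F n))
          < |(⨆ f : {f // f ∈ F n},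
            |FDep.empProc (FDep.pathLaw (μ.map (ε 0))) (FDep.coordProc m) J n f e|)|} := by
      ext ω
      simp only [Set.mem_ofPred_eq, Set.mem_preimage]
      have : ∀ f : {f // f ∈ F n}, FDep.empProc (FDep.pathLaw (μ.map (ε 0))) (FDep.coordProc m) J n
          f (fun t => ε t ω) = FDep.empProc μ ε J n f ω := fun f =>
        FDep.empProc_coordProc hε hJn (hmeas f f.2) ω
      simp only [this]
    have hpath := hε.measurePreserving_path
    calc _ ≤ (μ.map (fun ω t => ε t ω)) {e | (|A| + 1) / η * Real.sqrt (FDep.entropyH (F n))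
          < |(⨆ f : {f // f ∈ F n},
            |FDep.empProc (FDep.pathLaw (μ.map (ε 0))) (FDep.coordProc m) J n f e|)|} :=
          (congrArg μ hpre).trans_le (Measure.le_map_apply hpath.measurable.aemeasurable _)
      _ ≤ ENNReal.ofReal (A / ((|A| + 1) / η)) := by rw [hpath.map_eq]; exact hrow
      _ ≤ ENNReal.ofReal η := by
          refine ENNReal.ofReal_le_ofReal ?_
          rw [div_div_eq_mul_div, div_le_iff₀ (by positivity), mul_comm]
          exact mul_le_mul_of_nonneg_left (by linarith [le_abs_self A]) hη.le
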